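/- A triangulation of the 2-sphere with $n$ vertices is an abstract simplicial complex $K$ with exactly $n$ vertices whose geometric realization is homeomorphic to the sphere $S^2$. Two triangulations are isomorphic if there is a bijection between their vertices under which faces correspond to faces. Let $\mu(n)$ be the number of isomorphism classes of triangulations of the 2-sphere with $n$ vertices. Then $$\mu(4)=1,\qquad \mu(5)=1,\qquad \mu(6)=2,\qquad \mu(7)=5,\qquad \mu(8)=14,$$ and the numbers of isomorphism classes of the graphs that are 1-skeletons of triangulations of the 2-sphere with $4,5,6,7,8$ vertices are also $1,1,2,5,14$. There is no triangulation of the 2-sphere with fewer than four vertices. More precisely, the following complexes, given by their triangles (the vertices are the digits $0,\dots,n-1$, and $abc$ stands for the triangle $\{a,b,c\}$), are triangulations of the 2-sphere; the 1-skeletons of any two different ones with the same number of vertices are non-isomorphic graphs, so that the two triangulations are non-isomorphic; every triangulation of the 2-sphere with $4$, $5$, $6$, $7$ or $8$ vertices is isomorphic to one of them; and the degrees of the vertices in their 1-skeletons are as stated (in increasing order, not in the order of the labels). In particular the degree sequences distinguish all of them except $G_{8,4}$ and $G_{8,27}$, which have the same degree sequence but are not isomorphic. - $G_{4}$: 012 013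 023 123; degrees $3,3,3,3$ - $G_{5}$: 023 024 034 123 124 134; degrees $3,3,4,4,4$ - $G_{6,1}$: 012 013 024 034 125 135 245 345; degrees $4,4,4,4,4,4$ - $G_{6,2}$: 024 025 045 134 135 145 234 235; degrees $3,3,4,4,5,5$ - $G_{7,1}$: 045 046 056 123 124 135 145 236 246 356; degrees $3,4,4,4,5,5,5$ - $G_{7,2}$: 015 016 025 026 135 136 245 246 345 346; degrees $4,4,4,4,4,5,5$ - $G_{7,3}$: 024 026 046 135 136 156 245 256 345 346; degrees $3,3,4,4,5,5,6$ - $G_{7,4}$: 025 026 056 135 136 156 245 246 345 346; degrees $3,3,4,4,4,6,6$ - $G_{7,5}$: 034 036 046 135 136 156 245 246 256 345; degrees $3,3,3,5,5,5,6$ - $G_{8,3}$: 045 046 056 145 147 157 246 247 267 356 357 367; degrees $3,3,3,3,6,6,6,6$ - $G_{8,2}$: 035 036 056 145 147 157 246 247 267 357 367 456; degrees $3,3,3,4,5,6,6,6$ - $G_{8,1}$: 036 037 067 145 147 157 246 247 267 356 357 456; degrees $3,3,3,4,5,5,6,7$ - $G_{8,14}$: 026 027 067 136 137 167 246 247 356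 357 456 457; degrees $3,3,4,4,4,4,7,7$ - $G_{8,10}$: 025 027 057 136 137 167 256 267 346 347 456 457; degrees $3,3,4,4,4,5,6,7$ - $G_{8,16}$: 024 027 047 135 137 157 246 267 356 367 456 457; degrees $3,3,4,4,5,5,5,7$ - $G_{8,4}$: 046 047 067 156 157 167 234 235 246 256 347 357; degrees $3,3,4,4,5,5,6,6$ - $G_{8,27}$: 024 026 046 135 137 157 247 267 356 367 456 457; degrees $3,3,4,4,5,5,6,6$ - $G_{8,9}$: 034 037 047 156 157 167 234 235 246 256 357 467; degrees $3,3,4,5,5,5,5,6$ - $G_{8,39}$: 023 024 034 156 157 167 235 246 256 347 357 467; degrees $3,3,5,5,5,5,5,5$ - $G_{8,11}$: 016 017 067 156 157 234 235 246 256 347 357 467; degrees $3,4,4,4,4,5,6,6$ - $G_{8,6}$: 045 047 057 126 127 136 137 246 247 356 357 456; degrees $3,4,4,4,5,5,5,6$ - $G_{8,13}$: 016 017 026 027 136 137 246 247 356 357 456 457; degrees $4,4,4,4,4,4,6,6$ - $G_{8,28}$: 014 015 046 056 147 157 236 237 246 247 356 357; degrees $4,4,4,4,5,5,5,5$ Moreover,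 for $4\le n\le 7$ every triangulation of the 2-sphere with $n+1$ vertices is obtained, up to isomorphism, from a triangulation of the 2-sphere with $n$ vertices by adding one new vertex $v$ in one of the following three ways: 1. inside a face $abc$: the triangle $abc$ is replaced by $vab$, $vbc$, $vca$; 2. on an edge $ac$ with the adjacent triangles $abc$ and $acd$, where $a,b,c,d$ are distinct: these two triangles are replaced by $vab$, $vbc$, $vcd$, $vda$; 3. inside a pentagon $abcde$ with five distinct vertices that consists of the triangles $abc$, $acd$, $ade$: the two edges $ac$, $ad$ inside the pentagon are removed and these triangles are replaced by $vab$, $vbc$, $vcd$, $vde$, $vea$. -/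

import Mathlib

namespace SphereTri

section General

variable {V W : Type*}

/-- The geometric realization of an abstract simplicial complex on a finite vertex set `V`: the
points of the standard simplex in `V → ℝ` whose support spans a face. -/
def realization [Fintype V] (K : AbstractSimplicialComplex V) : Set (V → ℝ) :=
  {x | x ∈ stdSimplex ℝ V ∧ ∃ s ∈ K, ∀ v, x v ≠ 0 → v ∈ s}

/-- `K` is a triangulation of the 2-sphere: its geometric realization is homeomorphic to the unit
sphere of Euclidean 3-space. The vertices of `K` are all the elements of `V`. -/
def IsSphereTriangulation [Fintype V] (K : AbstractSimplicialComplex V) : Prop :=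
  Nonempty (realization K ≃ₜ Metric.sphere (0 : EuclideanSpace ℝ (Fin 3)) 1)

/-- Two complexes are isomorphic: there is a bijection of the vertices under which the faces
correspond to each other. -/
def Iso (K : AbstractSimplicialComplex V) (L : AbstractSimplicialComplex W) : Prop :=
  ∃ e : V ≃ W, ∀ s : Finset V, s ∈ K ↔ s.map e.toEmbedding ∈ L

/-- The 1-skeleton of a complex, as a graph. -/
def skeleton [DecidableEq V] (K : AbstractSimplicialComplex V) : SimpleGraph V where
  Adj a b := a ≠ b ∧ ({a, b} : Finset V) ∈ K
  symm := ⟨fun a b h => ⟨h.1.symm, by rw [Finset.pair_comm]; exact h.2⟩⟩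
  loopless := ⟨fun _ h => h.1 rfl⟩

/-- The multiset of the vertex degrees of the 1-skeleton. -/
noncomputable def degrees [Fintype V] [DecidableEq V] (K : AbstractSimplicialComplex V) : Multiset ℕ :=
  Finset.univ.val.map fun v => ((skeleton K).neighborSet v).ncard

/-- The triangles (2-dimensional faces) of a complex. -/
def triangles (K : AbstractSimplicialComplex V) : Set (Finset V) := {s | s ∈ K ∧ s.card = 3}

/-- The complex on `V` generated by the members of a family `T` of sets that covers `V`. -/
def ofTriangles (T : Finset (Finset V)) (hT : ∀ v, ∃ t ∈ T, v ∈ t) :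
    AbstractSimplicialComplex V where
  faces := {s | s.Nonempty ∧ ∃ t ∈ T, s ⊆ t}
  isRelLowerSet_faces := fun _ hs =>
    ⟨hs.1, fun _ hb hne => ⟨hne, hs.2.imp fun _ ht => ⟨ht.1, hb.trans ht.2⟩⟩⟩
  singleton_mem := fun v =>
    ⟨Finset.singleton_nonempty v, (hT v).imp fun _ ht => ⟨ht.1, Finset.singleton_subset_iff.2 ht.2⟩⟩

/-- The triangles of `L`, whose vertices are those of `K` and one new vertex `none`, are obtained
from the triangles of `K` by removing those in `old` and adding those in `new`. -/
def Replaces (K : AbstractSimplicialComplex V) (L : AbstractSimplicialComplex (Option V))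
    (old : Set (Finset V)) (new : Set (Finset (Option V))) : Prop :=
  old ⊆ triangles K ∧
    triangles L = (fun s => s.map Function.Embedding.some) '' (triangles K \ old) ∪ new

/-- The new vertex is put into the face `abc` and joined to `a`, `b`, `c`. -/
def FaceInsertion [DecidableEq V] (K : AbstractSimplicialComplex V)
    (L : AbstractSimplicialComplex (Option V)) : Prop :=
  ∃ a b c : V, [a, b, c].Nodup ∧
    Replaces K L {{a, b, c}}
      {{none, some a, some b}, {none, some b, some c}, {none, some c, some a}}

/-- The new vertex is put on the edge `ac`, which it splits in two, and is joined to the vertices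
`b`, `d` opposite to `ac` in the two adjacent triangles. -/
def EdgeInsertion [DecidableEq V] (K : AbstractSimplicialComplex V)
    (L : AbstractSimplicialComplex (Option V)) : Prop :=
  ∃ a b c d : V, [a, b, c, d].Nodup ∧
    Replaces K L {{a, b, c}, {a, c, d}}
      {{none, some a, some b}, {none, some b, some c}, {none, some c, some d},
        {none, some d, some a}}

/-- In a pentagon `abcde` without interior vertices the two interior edges (two diagonals with a
common end `a`, as in every triangulation of a pentagon by diagonals) are removed; the new vertex
is put into the pentagon and joined to its five vertices. -/
def PentagonInsertion [DecidableEq V] (K : AbstractSimplicialComplex V)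
    (L : AbstractSimplicialComplex (Option V)) : Prop :=
  ∃ a b c d e : V, [a, b, c, d, e].Nodup ∧
    Replaces K L {{a, b, c}, {a, c, d}, {a, d, e}}
      {{none, some a, some b}, {none, some b, some c}, {none, some c, some d},
        {none, some d, some e}, {none, some e, some a}}

theorem Iso.refl (K : AbstractSimplicialComplex V) : Iso K K :=
  ⟨Equiv.refl V, fun s => by simp⟩

theorem Iso.symm {K : AbstractSimplicialComplex V} {L : AbstractSimplicialComplex W}
    (h : Iso K L) : Iso L K := by
  obtain ⟨e, he⟩ := h
  refine ⟨e.symm, fun s => ?_⟩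
  rw [he, Finset.map_map]
  have : e.symm.toEmbedding.trans e.toEmbedding = Function.Embedding.refl W := by
    ext x; simp
  rw [this, Finset.map_refl]

theorem Iso.trans {U : Type*} {K : AbstractSimplicialComplex U}
    {L : AbstractSimplicialComplex V} {M : AbstractSimplicialComplex W}
    (h₁ : Iso K L) (h₂ : Iso L M) : Iso K M := by
  obtain ⟨e, he⟩ := h₁
  obtain ⟨f, hf⟩ := h₂
  refine ⟨e.trans f, fun s => ?_⟩
  rw [he, hf, Finset.map_map]
  rfl

end General

/-- The triangulations of the 2-sphere with the vertices `0, …, n - 1`. -/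
def Triangulation (n : ℕ) : Type :=
  {K : AbstractSimplicialComplex (Fin n) // IsSphereTriangulation K}

/-- Isomorphism of triangulations. -/
def isoSetoid (n : ℕ) : Setoid (Triangulation n) where
  r K L := Iso K.1 L.1
  iseqv := ⟨fun K => Iso.refl K.1, fun h => h.symm, fun h₁ h₂ => h₁.trans h₂⟩

/-- Isomorphism of the 1-skeletons of triangulations. -/
def skeletonSetoid (n : ℕ) : Setoid (Triangulation n) where
  r K L := Nonempty (skeleton K.1 ≃g skeleton L.1)
  iseqv := ⟨fun _ => ⟨SimpleGraph.Iso.refl⟩, fun ⟨e⟩ => ⟨e.symm⟩, fun ⟨e⟩ ⟨f⟩ => ⟨f.comp e⟩⟩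

/-- The number of isomorphism classes of triangulations of the 2-sphere with `n` vertices. -/
noncomputable def mu (n : ℕ) : ℕ := Nat.card (Quotient (isoSetoid n))

/-- The number of isomorphism classes of graphs that are 1-skeletons of triangulations of the
2-sphere with `n` vertices. -/
noncomputable def muGraph (n : ℕ) : ℕ := Nat.card (Quotient (skeletonSetoid n))

/-- `G` lists all triangulations with `n` vertices up to isomorphism, each of them once; even the
1-skeletons of different members of the list are non-isomorphic. -/
def IsCompleteList {n : ℕ} {ι : Type} (G : ι → AbstractSimplicialComplex (Fin n)) : Prop :=
  (∀ i, IsSphereTriangulation (G i)) ∧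
  (∀ K : AbstractSimplicialComplex (Fin n), IsSphereTriangulation K → ∃ i, Iso K (G i)) ∧
  (∀ i j, Nonempty (skeleton (G i) ≃g skeleton (G j)) → i = j)

def G4 : AbstractSimplicialComplex (Fin 4) :=
  ofTriangles {{0, 1, 2}, {0, 1, 3}, {0, 2, 3}, {1, 2, 3}} (by decide)

def G5 : AbstractSimplicialComplex (Fin 5) :=
  ofTriangles {{0, 2, 3}, {0, 2, 4}, {0, 3, 4}, {1, 2, 3}, {1, 2, 4}, {1, 3, 4}} (by decide)

def G6_1 : AbstractSimplicialComplex (Fin 6) :=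
  ofTriangles {{0, 1, 2}, {0, 1, 3}, {0, 2, 4}, {0, 3, 4}, {1, 2, 5}, {1, 3, 5}, {2, 4, 5},
    {3, 4, 5}} (by decide)

def G6_2 : AbstractSimplicialComplex (Fin 6) :=
  ofTriangles {{0, 2, 4}, {0, 2, 5}, {0, 4, 5}, {1, 3, 4}, {1, 3, 5}, {1, 4, 5}, {2, 3, 4},
    {2, 3, 5}} (by decide)

def G7_1 : AbstractSimplicialComplex (Fin 7) :=
  ofTriangles {{0, 4, 5}, {0, 4, 6}, {0, 5, 6}, {1, 2, 3}, {1, 2, 4}, {1, 3, 5}, {1, 4, 5},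
    {2, 3, 6}, {2, 4, 6}, {3, 5, 6}} (by decide)

def G7_2 : AbstractSimplicialComplex (Fin 7) :=
  ofTriangles {{0, 1, 5}, {0, 1, 6}, {0, 2, 5}, {0, 2, 6}, {1, 3, 5}, {1, 3, 6}, {2, 4, 5},
    {2, 4, 6}, {3, 4, 5}, {3, 4, 6}} (by decide)

def G7_3 : AbstractSimplicialComplex (Fin 7) :=
  ofTriangles {{0, 2, 4}, {0, 2, 6}, {0, 4, 6}, {1, 3, 5}, {1, 3, 6}, {1, 5, 6}, {2, 4, 5},
    {2, 5, 6}, {3, 4, 5}, {3, 4, 6}} (by decide)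

def G7_4 : AbstractSimplicialComplex (Fin 7) :=
  ofTriangles {{0, 2, 5}, {0, 2, 6}, {0, 5, 6}, {1, 3, 5}, {1, 3, 6}, {1, 5, 6}, {2, 4, 5},
    {2, 4, 6}, {3, 4, 5}, {3, 4, 6}} (by decide)

def G7_5 : AbstractSimplicialComplex (Fin 7) :=
  ofTriangles {{0, 3, 4}, {0, 3, 6}, {0, 4, 6}, {1, 3, 5}, {1, 3, 6}, {1, 5, 6}, {2, 4, 5},
    {2, 4, 6}, {2, 5, 6}, {3, 4, 5}} (by decide)

def G8_3 : AbstractSimplicialComplex (Fin 8) :=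
  ofTriangles {{0, 4, 5}, {0, 4, 6}, {0, 5, 6}, {1, 4, 5}, {1, 4, 7}, {1, 5, 7}, {2, 4, 6},
    {2, 4, 7}, {2, 6, 7}, {3, 5, 6}, {3, 5, 7}, {3, 6, 7}} (by decide)

def G8_2 : AbstractSimplicialComplex (Fin 8) :=
  ofTriangles {{0, 3, 5}, {0, 3, 6}, {0, 5, 6}, {1, 4, 5}, {1, 4, 7}, {1, 5, 7}, {2, 4, 6},
    {2, 4, 7}, {2, 6, 7}, {3, 5, 7}, {3, 6, 7}, {4, 5, 6}} (by decide)

def G8_1 : AbstractSimplicialComplex (Fin 8) :=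
  ofTriangles {{0, 3, 6}, {0, 3, 7}, {0, 6, 7}, {1, 4, 5}, {1, 4, 7}, {1, 5, 7}, {2, 4, 6},
    {2, 4, 7}, {2, 6, 7}, {3, 5, 6}, {3, 5, 7}, {4, 5, 6}} (by decide)

def G8_14 : AbstractSimplicialComplex (Fin 8) :=
  ofTriangles {{0, 2, 6}, {0, 2, 7}, {0, 6, 7}, {1, 3, 6}, {1, 3, 7}, {1, 6, 7}, {2, 4, 6},
    {2, 4, 7}, {3, 5, 6}, {3, 5, 7}, {4, 5, 6}, {4, 5, 7}} (by decide)

def G8_10 : AbstractSimplicialComplex (Fin 8) :=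
  ofTriangles {{0, 2, 5}, {0, 2, 7}, {0, 5, 7}, {1, 3, 6}, {1, 3, 7}, {1, 6, 7}, {2, 5, 6},
    {2, 6, 7}, {3, 4, 6}, {3, 4, 7}, {4, 5, 6}, {4, 5, 7}} (by decide)

def G8_16 : AbstractSimplicialComplex (Fin 8) :=
  ofTriangles {{0, 2, 4}, {0, 2, 7}, {0, 4, 7}, {1, 3, 5}, {1, 3, 7}, {1, 5, 7}, {2, 4, 6},
    {2, 6, 7}, {3, 5, 6}, {3, 6, 7}, {4, 5, 6}, {4, 5, 7}} (by decide)

def G8_4 : AbstractSimplicialComplex (Fin 8) :=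
  ofTriangles {{0, 4, 6}, {0, 4, 7}, {0, 6, 7}, {1, 5, 6}, {1, 5, 7}, {1, 6, 7}, {2, 3, 4},
    {2, 3, 5}, {2, 4, 6}, {2, 5, 6}, {3, 4, 7}, {3, 5, 7}} (by decide)

def G8_27 : AbstractSimplicialComplex (Fin 8) :=
  ofTriangles {{0, 2, 4}, {0, 2, 6}, {0, 4, 6}, {1, 3, 5}, {1, 3, 7}, {1, 5, 7}, {2, 4, 7},
    {2, 6, 7}, {3, 5, 6}, {3, 6, 7}, {4, 5, 6}, {4, 5, 7}} (by decide)

def G8_9 : AbstractSimplicialComplex (Fin 8) :=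
  ofTriangles {{0, 3, 4}, {0, 3, 7}, {0, 4, 7}, {1, 5, 6}, {1, 5, 7}, {1, 6, 7}, {2, 3, 4},
    {2, 3, 5}, {2, 4, 6}, {2, 5, 6}, {3, 5, 7}, {4, 6, 7}} (by decide)

def G8_39 : AbstractSimplicialComplex (Fin 8) :=
  ofTriangles {{0, 2, 3}, {0, 2, 4}, {0, 3, 4}, {1, 5, 6}, {1, 5, 7}, {1, 6, 7}, {2, 3, 5},
    {2, 4, 6}, {2, 5, 6}, {3, 4, 7}, {3, 5, 7}, {4, 6, 7}} (by decide)

def G8_11 : AbstractSimplicialComplex (Fin 8) :=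
  ofTriangles {{0, 1, 6}, {0, 1, 7}, {0, 6, 7}, {1, 5, 6}, {1, 5, 7}, {2, 3, 4}, {2, 3, 5},
    {2, 4, 6}, {2, 5, 6}, {3, 4, 7}, {3, 5, 7}, {4, 6, 7}} (by decide)

def G8_6 : AbstractSimplicialComplex (Fin 8) :=
  ofTriangles {{0, 4, 5}, {0, 4, 7}, {0, 5, 7}, {1, 2, 6}, {1, 2, 7}, {1, 3, 6}, {1, 3, 7},
    {2, 4, 6}, {2, 4, 7}, {3, 5, 6}, {3, 5, 7}, {4, 5, 6}} (by decide)

def G8_13 : AbstractSimplicialComplex (Fin 8) :=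
  ofTriangles {{0, 1, 6}, {0, 1, 7}, {0, 2, 6}, {0, 2, 7}, {1, 3, 6}, {1, 3, 7}, {2, 4, 6},
    {2, 4, 7}, {3, 5, 6}, {3, 5, 7}, {4, 5, 6}, {4, 5, 7}} (by decide)

def G8_28 : AbstractSimplicialComplex (Fin 8) :=
  ofTriangles {{0, 1, 4}, {0, 1, 5}, {0, 4, 6}, {0, 5, 6}, {1, 4, 7}, {1, 5, 7}, {2, 3, 6},
    {2, 3, 7}, {2, 4, 6}, {2, 4, 7}, {3, 5, 6}, {3, 5, 7}} (by decide)

end SphereTri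

open SphereTri

/-! Four facts about a triangulated sphere with n vertices reduce the classification to a finite
search: every maximal face is a triangle, every edge lies in exactly two triangles, any two
triangles are joined by a chain of triangles with common edges, and there are at most 2n - 4
triangles.

The local facts are detected by continuous logarithms of nonvanishing complex functions. Around a
point of a surface the chart coordinate winds once and has no logarithm, whereas on a punctured ball
of dimension other than 2, or on a star-shaped set, every nonvanishing function has one. Looking at
the barycentre of a maximal face gives `card_of_maximal`. At the midpoint of an edge, a single
triangle would give a half disc, which stays star-shaped when the midpoint is removed
(`exists_ne_triangle`), and three triangles would give three half discs with a common diameter,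
which `not_fold` excludes by comparing winding numbers (`triangle_eq_or_eq`). Connectedness of
punctured discs gives connected links, and with the connectedness of the sphere this gives chains of
triangles (`strongly_connected`).

The bound 2n - 4 is half of Euler's formula and uses that the sphere is simply connected. A cocycle
of signs on the edges defines a double covering of the realization; a section of it exhibits the
cocycle as a coboundary. So the first cohomology modulo 2 vanishes, and counting ranks of the
incidence matrices gives the inequality.

The search (`search`, with its soundness in `CombSphere.listed`) adds triangles to edges that lack
their second triangle, in all possible ways. Vertex links need no attention: other closed surfaces,
and surfaces pinched at vertices, would have more than 2n - 4 triangles. Every complete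
configuration contains an isomorphic copy of a listed complex. That copy already has 2n - 4
triangles, so it is everything (`iso_of_generates`).

Conversely each listed complex is the boundary of an explicit convex polytope around the origin, and
radial projection maps it onto the sphere (`nonempty_homeomorph_sphere`). A numerical invariant
computed from the degrees of adjacent vertices separates the 1-skeletons. Finally, each listed
complex with 5 to 8 vertices has a vertex of degree 3 or 4 whose removal leads back to a smaller
listed complex, so insertions into faces and edges suffice and the pentagon is never needed. -/

namespace SphereTri

/-! ### Continuous logarithms of nonvanishing functions. -/

open Topology unitInterval

/-- `f` has a continuous logarithm on `s`. -/
def HasLogOn {E : Type*} [TopologicalSpace E] (f : E → ℂ) (s : Set E) : Prop :=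
  ∃ g : E → ℂ, ContinuousOn g s ∧ ∀ x ∈ s, Complex.exp (g x) = f x

namespace HasLogOn

variable {E F : Type*} [TopologicalSpace E] [TopologicalSpace F] {f f' : E → ℂ} {s t : Set E}

theorem mul (h : HasLogOn f s) (h' : HasLogOn f' s) : HasLogOn (fun x => f x * f' x) s := by
  obtain ⟨g, hg, hgf⟩ := h
  obtain ⟨g', hg', hgf'⟩ := h'
  exact ⟨fun x => g x + g' x, hg.add hg', fun x hx => by rw [Complex.exp_add, hgf x hx, hgf' x hx]⟩

theorem zpow (h : HasLogOn f s) (n : ℤ) : HasLogOn (fun x => f x ^ n) s := by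
  obtain ⟨g, hg, hgf⟩ := h
  exact ⟨fun x => n * g x, continuousOn_const.mul hg, fun x hx => by
    rw [Complex.exp_int_mul, hgf x hx]⟩

theorem congr (h : HasLogOn f s) (h' : ∀ x ∈ s, f x = f' x) : HasLogOn f' s := by
  obtain ⟨g, hg, hgf⟩ := h
  exact ⟨g, hg, fun x hx => (hgf x hx).trans (h' x hx)⟩

theorem comp (h : HasLogOn f s) {φ : F → E} {u : Set F} (hφ : ContinuousOn φ u)
    (hu : Set.MapsTo φ u s) : HasLogOn (fun y => f (φ y)) u := by
  obtain ⟨g, hg, hgf⟩ := h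
  exact ⟨fun y => g (φ y), hg.comp hφ hu, fun y hy => hgf _ (hu hy)⟩

/-- Two logarithms on open sets with connected intersection can be glued. -/
theorem union (h : HasLogOn f s) (h' : HasLogOn f t) (hs : IsOpen s) (ht : IsOpen t)
    (hst : IsPreconnected (s ∩ t)) : HasLogOn f (s ∪ t) := by
  obtain ⟨g, hg, hgf⟩ := h
  obtain ⟨g', hg', hgf'⟩ := h'
  -- On the connected overlap the logarithms are two lifts of `f` through the exponential covering,
  -- so they differ by one constant period; on an empty overlap the period 0 will do.
  have key : ∃ c : ℂ, Complex.exp c = 1 ∧ ∀ x ∈ s ∩ t, g x = g' x + c := by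
    rcases (s ∩ t).eq_empty_or_nonempty with he | ⟨x₀, hx₀⟩
    · exact ⟨0, Complex.exp_zero, by simp [he]⟩
    · have hc : Complex.exp (g x₀ - g' x₀) = 1 := by
        rw [Complex.exp_sub, hgf _ hx₀.1, hgf' _ hx₀.2, ← hgf _ hx₀.1,
          div_self (Complex.exp_ne_zero _)]
      refine ⟨g x₀ - g' x₀, hc, ?_⟩
      have := Complex.isCoveringMap_exp.eqOn_of_comp_eqOn hst
        (g₁ := g) (g₂ := fun x => g' x + (g x₀ - g' x₀)) (hg.mono Set.inter_subset_left)
        ((hg'.mono Set.inter_subset_right).add continuousOn_const)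
        (fun x hx => Subtype.ext (by
          simp only [Function.comp]
          rw [Complex.exp_add, hc, mul_one, hgf _ hx.1, hgf' _ hx.2])) hx₀ (by simp)
      exact this
  obtain ⟨c, hc, hgc⟩ := key
  classical
  refine ⟨fun x => if x ∈ s then g x else g' x + c, ?_, ?_⟩
  · intro x hx
    apply ContinuousAt.continuousWithinAt
    rcases hx with hx | hx
    · refine (hg.continuousAt (hs.mem_nhds hx)).congr ?_
      filter_upwards [hs.mem_nhds hx] with y hy
      simp [hy]
    · refine ((hg'.continuousAt (ht.mem_nhds hx)).add continuousAt_const).congr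
        (f := fun y => g' y + c) ?_
      filter_upwards [ht.mem_nhds hx] with y hy
      split_ifs with h
      · exact (hgc y ⟨h, hy⟩).symm
      · rfl
  · intro x hx
    dsimp only
    split_ifs with h
    · exact hgf x h
    · rw [Complex.exp_add, hc, mul_one, hgf' x (hx.resolve_left h)]

end HasLogOn

/-- The end of a homotopy that starts at a constant map lifts to every covering. -/
theorem exists_lift_of_homotopy {E X A : Type*} [TopologicalSpace E] [TopologicalSpace X]
    [TopologicalSpace A] {p : E → X} (cov : IsCoveringMap p) (H : C(I × A, X)) (b : E)
    (h : ∀ a, H (0, a) = p b) :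
    ∃ g : C(I × A, E), (∀ x, p (g x) = H x) ∧ ∀ a, g (0, a) = b :=
  ⟨cov.liftHomotopy H (ContinuousMap.const A b) h,
    fun x => congrFun (cov.liftHomotopy_lifts H _ h) x,
    fun a => cov.liftHomotopy_zero H _ h a⟩

/-- Contracting to the centre `q` gives a homotopy from the constant `f q` to `f`; it is lifted
through the covering exp, and the lift at time 1 is the logarithm. -/
theorem hasLogOn_of_starConvex {E : Type*} [AddCommGroup E] [Module ℝ E] [TopologicalSpace E]
    [IsTopologicalAddGroup E] [ContinuousSMul ℝ E] {s : Set E} {q : E} (hs : StarConvex ℝ q s)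
    {f : E → ℂ} (hf : ContinuousOn f s) (h0 : ∀ x ∈ s, f x ≠ 0) : HasLogOn f s := by
  rcases s.eq_empty_or_nonempty with rfl | hne
  · exact ⟨f, hf, by simp⟩
  have hq : q ∈ s := hs.mem hne
  have hmem : ∀ x : I × s, q + (x.1 : ℝ) • ((x.2 : E) - q) ∈ s := fun x =>
    hs.add_smul_sub_mem x.2.2 x.1.2.1 x.1.2.2
  let H : C(I × s, {z : ℂ // z ≠ 0}) :=
    ⟨fun x => ⟨f (q + (x.1 : ℝ) • ((x.2 : E) - q)), h0 _ (hmem x)⟩, by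
      refine Continuous.subtype_mk ?_ _
      exact hf.comp_continuous (by fun_prop) hmem⟩
  obtain ⟨g, hg, -⟩ := exists_lift_of_homotopy Complex.isCoveringMap_exp H (Complex.log (f q))
    (fun a => Subtype.ext (by simp [H, Complex.exp_log (h0 q hq)]))
  classical
  refine ⟨fun x => if hx : x ∈ s then g (1, ⟨x, hx⟩) else 0, ?_, fun x hx => ?_⟩
  · rw [continuousOn_iff_continuous_domRestrict]
    refine (g.continuous.comp (Continuous.prodMk_right (1 : I))).congr fun x => ?_
    simp [Set.domRestrict]
  · have := congrArg Subtype.val (hg (1, ⟨x, hx⟩))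
    simpa [H, hx] using this

section Vector

variable {ι : Type*} [Fintype ι]

/-- The axis is the kernel of the projection to the other coordinates, so its codimension is one
less than the dimension. Codimension above 1 does not separate, and in dimension at most 1 the
complement is empty; dimension 2 is the only case in which the axis separates. -/
theorem isPreconnected_compl_axis [DecidableEq ι] (b : ι) (h : Fintype.card ι ≠ 2) :
    IsPreconnected {x : ι → ℝ | ∀ i, i ≠ b → x i = 0}ᶜ := by
  let r : (ι → ℝ) →ₗ[ℝ] ({i : ι // i ≠ b} → ℝ) := LinearMap.funLeft ℝ ℝ Subtype.val
  have hr : Function.Surjective r := LinearMap.funLeft_surjective_of_injective _ _ _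
    Subtype.val_injective
  have hker : ((LinearMap.ker r : Submodule ℝ (ι → ℝ)) : Set (ι → ℝ)) =
      {x : ι → ℝ | ∀ i, i ≠ b → x i = 0} := by
    ext x
    simp [r, funext_iff, LinearMap.funLeft]
  have hcard : Fintype.card {i : ι // i ≠ b} = Fintype.card ι - 1 := by
    simp [Fintype.card_subtype_compl]
  rw [← hker]
  by_cases h1 : Fintype.card ι ≤ 1
  · have : IsEmpty {i : ι // i ≠ b} := by
      rw [← Fintype.card_eq_zero_iff]; omega
    rw [hker]
    convert isPreconnected_empty
    ext x
    simp only [Set.mem_compl_iff, Set.mem_ofPred_eq, Set.mem_empty_iff_false, iff_false, not_not]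
    exact fun i hi => (this.false ⟨i, hi⟩).elim
  · refine (isConnected_compl_of_one_lt_codim ?_).isPreconnected
    rw [(LinearMap.quotKerEquivOfSurjective r hr).rank_eq, rank_fun', hcard]
    norm_cast
    omega

/-- A nonvanishing function on a punctured space of dimension other than 2 has a logarithm. -/
theorem hasLogOn_compl_zero (h : Fintype.card ι ≠ 2) {f : (ι → ℝ) → ℂ}
    (hf : ContinuousOn f {0}ᶜ) (h0 : ∀ x ∈ ({0}ᶜ : Set (ι → ℝ)), f x ≠ 0) :
    HasLogOn f {0}ᶜ := by
  classical
  rcases isEmpty_or_nonempty ι with he | ⟨⟨b⟩⟩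
  · refine ⟨f, hf, fun x hx => (hx (Subsingleton.elim _ _)).elim⟩
  -- For `ε = ±1` these are the two closed half-axes in direction `b`. The complement of each is
  -- star-shaped about a point of the opposite half-axis, the two complements cover the punctured
  -- space, and they meet in the complement of the axis, where the gluing requires connectedness.
  let R : ℝ → Set (ι → ℝ) := fun ε => {x | 0 ≤ ε * x b ∧ ∀ i, i ≠ b → x i = 0}
  have hR : ∀ ε, IsClosed (R ε) := fun ε => by
    have : R ε = {x | 0 ≤ ε * x b} ∩ ⋂ i, ⋂ _ : i ≠ b, {x | x i = 0} := by
      ext x; simp [R]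
    rw [this]
    refine (isClosed_le continuous_const (by fun_prop)).inter ?_
    exact isClosed_iInter fun i => isClosed_iInter fun _ =>
      isClosed_eq (by fun_prop) continuous_const
  have hstar : ∀ ε : ℝ, ε ^ 2 = 1 → StarConvex ℝ (Pi.single b (-ε)) (R ε)ᶜ := by
    intro ε hε x hx a c ha hc hac hmem
    refine hx ⟨?_, fun i hi => ?_⟩
    · have h1 := hmem.1
      simp only [Pi.add_apply, Pi.smul_apply, Pi.single_eq_same, smul_eq_mul] at h1
      have hc0 : c ≠ 0 := by
        rintro rfl
        nlinarith
      have : 0 < c := lt_of_le_of_ne hc hc0.symm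
      have : 0 ≤ c * (ε * x b) := by nlinarith
      exact nonneg_of_mul_nonneg_right this ‹0 < c›
    · have h1 := hmem.2 i hi
      simp only [Pi.add_apply, Pi.smul_apply, Pi.single_eq_of_ne hi, smul_eq_mul, mul_zero,
        zero_add] at h1
      rcases mul_eq_zero.1 h1 with rfl | h2
      · exfalso
        have h3 := hmem.1
        simp only [Pi.add_apply, Pi.smul_apply, Pi.single_eq_same, smul_eq_mul] at h3
        nlinarith
      · exact h2
  have hRsub : ∀ ε, (R ε)ᶜ ⊆ {0}ᶜ := fun ε => by
    rw [Set.compl_subset_compl]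
    rintro x rfl
    simp [R]
  have hlog : ∀ ε : ℝ, ε ^ 2 = 1 → HasLogOn f (R ε)ᶜ := fun ε hε =>
    hasLogOn_of_starConvex (hstar ε hε) (hf.mono (hRsub ε)) fun x hx => h0 x (hRsub ε hx)
  have hinter : (R 1)ᶜ ∩ (R (-1))ᶜ = {x : ι → ℝ | ∀ i, i ≠ b → x i = 0}ᶜ := by
    ext x
    simp only [R, one_mul, Set.mem_inter_iff, Set.mem_compl_iff, Set.mem_ofPred_eq, not_and]
    constructor
    · rintro ⟨h1, h2⟩ h3
      rcases le_total 0 (x b) with h4 | h4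
      · exact h1 h4 h3
      · exact h2 (by linarith) h3
    · exact fun h => ⟨fun _ => h, fun _ => h⟩
  have hunion : (R 1)ᶜ ∪ (R (-1))ᶜ = {0}ᶜ := by
    rw [← Set.compl_inter, compl_inj_iff]
    ext x
    simp only [R, one_mul, Set.mem_inter_iff, Set.mem_ofPred_eq, Set.mem_singleton_iff]
    constructor
    · rintro ⟨⟨h1, h2⟩, h3, -⟩
      ext i
      by_cases hi : i = b
      · subst hi
        exact le_antisymm (by simpa using h3) h1
      · exact h2 i hi
    · rintro rfl
      simp
  rw [← hunion]
  refine (hlog 1 (by norm_num)).union (hlog (-1) (by norm_num)) (hR _).isOpen_compl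
    (hR _).isOpen_compl ?_
  rw [hinter]
  exact isPreconnected_compl_axis b h

/-- A nonvanishing function on a punctured ball of dimension other than 2 has a logarithm. -/
theorem hasLogOn_punctured_ball (h : Fintype.card ι ≠ 2) {r : ℝ} (hr : 0 < r) {f : (ι → ℝ) → ℂ}
    (hf : ContinuousOn f (Metric.ball 0 r \ {0})) (h0 : ∀ x ∈ Metric.ball 0 r \ {0}, f x ≠ 0) :
    HasLogOn f (Metric.ball 0 r \ {0}) := by
  let e := OpenPartialHomeomorph.univBall (0 : ι → ℝ) r
  have hsymm : Set.MapsTo e.symm (Metric.ball 0 r \ {0}) {0}ᶜ := fun x hx h => hx.2 <| by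
    have h1 : e (e.symm x) = x :=
      e.right_inv (OpenPartialHomeomorph.ball_subset_univBall_target _ _ hx.1)
    rw [← h1, Set.mem_singleton_iff.1 h]
    exact OpenPartialHomeomorph.univBall_apply_zero _ _
  have hmaps : Set.MapsTo e {0}ᶜ (Metric.ball 0 r \ {0}) := fun x hx => by
    refine ⟨?_, fun h => hx ?_⟩
    · rw [← OpenPartialHomeomorph.univBall_target (0 : ι → ℝ) hr]
      exact e.map_source (by simp [e])
    · rw [← e.left_inv (x := x) (by simp [e]), Set.mem_singleton_iff.1 h]
      exact OpenPartialHomeomorph.univBall_symm_apply_center _ _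
  have h1 := hasLogOn_compl_zero h
    (hf.comp (OpenPartialHomeomorph.continuous_univBall (0 : ι → ℝ) r).continuousOn hmaps)
    fun x hx => h0 _ (hmaps hx)
  refine (h1.comp (φ := e.symm) ((OpenPartialHomeomorph.continuousOn_univBall_symm _ _).mono
    Set.sdiff_subset) hsymm).congr fun x hx => ?_
  exact congrArg f (e.right_inv (OpenPartialHomeomorph.ball_subset_univBall_target _ _ hx.1))

end Vector

/-- A power of the coordinate with a logarithm on a punctured disc is constant. -/
theorem eq_zero_of_hasLogOn_zpow {m : ℤ} {r : ℝ} (hr : 0 < r)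
    (h : HasLogOn (fun z : ℂ => z ^ m) (Metric.ball 0 r \ {0})) : m = 0 := by
  obtain ⟨g, hg, hgf⟩ := h
  -- Along this circle a logarithm of `z ^ m` must be `m θ i` up to a constant, by uniqueness of
  -- lifts. The circle closes up at `θ = 2π`, which forces `m = 0`.
  let c : ℝ → ℂ := fun θ => (r / 2 : ℝ) * Complex.exp (θ * Complex.I)
  have hc : ∀ θ, c θ ∈ Metric.ball (0 : ℂ) r \ {0} := fun θ => by
    refine ⟨?_, by simp [c, hr.ne']⟩
    simp [c, Complex.norm_exp, abs_of_pos hr]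
    linarith
  have hcc : Continuous c := by fun_prop
  have hgc : Continuous fun θ => g (c θ) := hg.comp_continuous hcc hc
  have := Complex.isCoveringMap_exp.eq_of_comp_eq (g₁ := fun θ => g (c θ))
    (g₂ := fun θ : ℝ => g (c 0) + m * (θ * Complex.I)) hgc (by fun_prop)
    (funext fun θ => Subtype.ext (by
      simp only [Function.comp]
      rw [Complex.exp_add, hgf _ (hc _), hgf _ (hc _), Complex.exp_int_mul]
      simp [c, mul_zpow])) 0 (by simp)
  have h2 := congrFun this (2 * Real.pi)
  have h3 : c (2 * Real.pi) = c 0 := by simp [c, Complex.exp_two_pi_mul_I]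
  simp only [h3] at h2
  have h4 : (m : ℂ) * ((2 * Real.pi : ℝ) * Complex.I) = 0 := by linear_combination -h2
  have : ((2 * Real.pi : ℝ) : ℂ) ≠ 0 := by
    exact_mod_cast (by positivity : (2 * Real.pi : ℝ) ≠ 0)
  simpa [this, Complex.I_ne_zero, Real.pi_ne_zero] using h4

/-- A nonvanishing function on a punctured disc is a power of the coordinate up to a function with
a logarithm. -/
theorem exists_zpow_hasLogOn {r : ℝ} (hr : 0 < r) {f : ℂ → ℂ}
    (hf : ContinuousOn f (Metric.ball 0 r \ {0})) (h0 : ∀ x ∈ Metric.ball 0 r \ {0}, f x ≠ 0) :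
    ∃ n : ℤ, HasLogOn (fun z => f z / z ^ n) (Metric.ball 0 r \ {0}) := by
  -- The exponential makes this half-plane the universal cover of the punctured disc; being convex,
  -- it carries a logarithm `g` of the pulled back function.
  let P : Set ℂ := {w | w.re < Real.log r}
  have hP : Convex ℝ P := convex_halfSpace_re_lt _
  have hexp : Set.MapsTo Complex.exp P (Metric.ball 0 r \ {0}) := fun w hw => by
    refine ⟨?_, Complex.exp_ne_zero _⟩
    rw [mem_ball_zero_iff, Complex.norm_exp]
    exact (Real.lt_log_iff_exp_lt hr).1 hw
  have hlogP : ∀ z ∈ Metric.ball (0 : ℂ) r \ {0}, Complex.log z ∈ P := fun z hz => by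
    simp only [P, Set.mem_ofPred_eq, Complex.log_re]
    exact Real.log_lt_log (norm_pos_iff.2 hz.2) (mem_ball_zero_iff.1 hz.1)
  have hne : P.Nonempty := ⟨(Real.log r - 1 : ℝ), by simp [P]⟩
  obtain ⟨q, hq⟩ := hne
  obtain ⟨g, hg, hgf⟩ := hasLogOn_of_starConvex (hP.starConvex hq)
    (hf.comp Complex.continuous_exp.continuousOn hexp) fun w hw => h0 _ (hexp hw)
  have hT : ∀ w ∈ P, ∀ k : ℤ, w + k * (2 * Real.pi * Complex.I) ∈ P := fun w hw k => by
    simpa [P] using hw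
  have hq' : q + 2 * Real.pi * Complex.I ∈ P := by simpa using hT q hq 1
  -- This `n` is the winding number of `f`: the increment of `g` under the deck transformation,
  -- divided by `2πi`. Subtracting `n w` from `g` leaves a periodic function, which descends to the
  -- punctured disc.
  obtain ⟨n, hn⟩ : ∃ n : ℤ, g (q + 2 * Real.pi * Complex.I) = g q + n * (2 * Real.pi * Complex.I) := by
    rw [← Complex.exp_eq_exp_iff_exists_int, hgf _ hq', hgf _ hq]
    simp [Complex.exp_add, Complex.exp_two_pi_mul_I]
  have hper : ∀ w ∈ P, g (w + 2 * Real.pi * Complex.I) = g w + n * (2 * Real.pi * Complex.I) := by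
    have := Complex.isCoveringMap_exp.eqOn_of_comp_eqOn hP.isPreconnected
      (g₁ := fun w => g (w + 2 * Real.pi * Complex.I))
      (g₂ := fun w => g w + n * (2 * Real.pi * Complex.I))
      (hg.comp (by fun_prop) fun w hw => by simpa using hT w hw 1) (hg.add continuousOn_const)
      (fun w hw => Subtype.ext (by
        simp only [Function.comp]
        rw [Complex.exp_add, hgf _ hw, hgf _ (by simpa using hT w hw 1)]
        simp [Complex.exp_add, Complex.exp_two_pi_mul_I, Complex.exp_int_mul])) hq hn
    exact this
  let G : ℂ → ℂ := fun w => g w - n * w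
  have hG1 : ∀ w ∈ P, G (w + 2 * Real.pi * Complex.I) = G w := fun w hw => by
    simp only [G, hper w hw]; ring
  have hGk : ∀ k : ℕ, ∀ w ∈ P, G (w + k * (2 * Real.pi * Complex.I)) = G w := by
    intro k
    induction k with
    | zero => simp
    | succ k ih =>
      intro w hw
      have := hG1 (w + k * (2 * Real.pi * Complex.I)) (by exact_mod_cast hT w hw k)
      rw [ih w hw] at this
      rw [← this]
      congr 1
      push_cast
      ring
  have hG : ∀ w ∈ P, ∀ w' ∈ P, Complex.exp w = Complex.exp w' → G w = G w' := by
    intro w hw w' hw' h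
    obtain ⟨k, rfl⟩ := Complex.exp_eq_exp_iff_exists_int.1 h
    rcases Int.eq_nat_or_neg k with ⟨j, rfl | rfl⟩
    · exact_mod_cast hGk j w' hw'
    · rw [← hGk j _ hw]
      congr 1
      push_cast
      ring
  refine ⟨n, fun z => G (Complex.log z), ?_, ?_⟩
  · intro z hz
    have hopen : IsOpen (Metric.ball (0 : ℂ) r \ {0}) := Metric.isOpen_ball.sdiff isClosed_singleton
    apply ContinuousAt.continuousWithinAt
    have hPo : IsOpen P := isOpen_lt Complex.continuous_re continuous_const
    have hGc : ContinuousOn G P := hg.sub (by fun_prop)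
    -- The principal logarithm jumps on the negative axis. After division by `exp c = ±1` the point
    -- avoids the cut, so `log (y / exp c) + c` is a continuous branch near `z`, and periodicity of
    -- `G` makes the choice of branch irrelevant.
    obtain ⟨c, hc, hs⟩ : ∃ c : ℂ, Complex.exp c ≠ 0 ∧ c.re = 0 ∧ z / Complex.exp c ∈ Complex.slitPlane := by
      by_cases h : z ∈ Complex.slitPlane
      · exact ⟨0, by simp, by simp, by simpa using h⟩
      · refine ⟨Real.pi * Complex.I, by simp, by simp, ?_⟩
        rw [Complex.exp_pi_mul_I, div_neg, div_one]
        exact (Complex.mem_slitPlane_or_neg_mem_slitPlane hz.2).resolve_left h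
    have hl : ∀ y ∈ Metric.ball (0 : ℂ) r \ {0}, Complex.log (y / Complex.exp c) + c ∈ P ∧
        Complex.exp (Complex.log (y / Complex.exp c) + c) = y := fun y hy => by
      constructor
      · have : Real.log ‖y‖ < Real.log r := by simpa [P, Complex.log_re] using hlogP y hy
        simpa [P, Complex.log_re, Complex.norm_exp, hs.1] using this
      · rw [Complex.exp_add, Complex.exp_log (div_ne_zero hy.2 hc), div_mul_cancel₀ _ hc]
    have h1 : ContinuousAt (fun y => G (Complex.log (y / Complex.exp c) + c)) z := by
      refine ContinuousAt.comp (g := G) (hGc.continuousAt (hPo.mem_nhds (hl z hz).1)) ?_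
      exact ((continuousAt_id.div_const _).clog hs.2).add continuousAt_const
    refine h1.congr ?_
    filter_upwards [hopen.mem_nhds hz] with y hy
    exact hG _ (hl y hy).1 _ (hlogP y hy) (by rw [(hl y hy).2, Complex.exp_log hy.2])
  · intro z hz
    simp only [G]
    rw [Complex.exp_sub, hgf _ (hlogP z hz), Complex.exp_int_mul, Function.comp,
      Complex.exp_log hz.2]

end SphereTri

/-! ### Charts of the sphere, local obstructions on surfaces, and sections of coverings of the
sphere. -/

namespace SphereTri

open Topology unitInterval

theorem exists_isOpenEmbedding_compl_singleton
    (v : Metric.sphere (0 : EuclideanSpace ℝ (Fin 3)) 1) :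
    ∃ φ : ℂ → Metric.sphere (0 : EuclideanSpace ℝ (Fin 3)) 1,
      IsOpenEmbedding φ ∧ Set.range φ = {v}ᶜ := by
  have : Fact (Module.finrank ℝ (EuclideanSpace ℝ (Fin 3)) = 2 + 1) := ⟨by simp⟩
  let e := (stereographic' 2 v).symm
  let i := Complex.orthonormalBasisOneI.repr.toHomeomorph
  have he : e.source = Set.univ := by simp [e]
  refine ⟨e ∘ i, (e.isOpenEmbedding he).comp i.isOpenEmbedding, ?_⟩
  rw [i.surjective.range_comp, ← Set.image_univ, ← he, e.image_source_eq_target]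
  simp [e]

theorem exists_isOpenEmbedding_sphere (p v : Metric.sphere (0 : EuclideanSpace ℝ (Fin 3)) 1)
    (h : p ≠ v) : ∃ φ : ℂ → Metric.sphere (0 : EuclideanSpace ℝ (Fin 3)) 1,
      IsOpenEmbedding φ ∧ Set.range φ = {v}ᶜ ∧ φ 0 = p := by
  obtain ⟨φ, hφ, hr⟩ := exists_isOpenEmbedding_compl_singleton v
  obtain ⟨z, rfl⟩ : p ∈ Set.range φ := by rw [hr]; exact h
  let i := Homeomorph.addRight z
  exact ⟨φ ∘ i, hφ.comp i.isOpenEmbedding, by rw [i.surjective.range_comp, hr], by simp [i]⟩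

/-- `X` is a topological surface near its point `p`. -/
def IsPlanarAt {E : Type*} [TopologicalSpace E] (X : Set E) (p : E) : Prop :=
  ∃ φ : ℂ → E, IsEmbedding φ ∧ φ 0 = p ∧ Set.range φ ⊆ X ∧ Set.range φ ∈ 𝓝[X] p

theorem isPlanarAt_of_homeomorph {E : Type*} [TopologicalSpace E] {X : Set E}
    (h : X ≃ₜ Metric.sphere (0 : EuclideanSpace ℝ (Fin 3)) 1) {p : E} (hp : p ∈ X) :
    IsPlanarAt X p := by
  have hne : h ⟨p, hp⟩ ≠ -h ⟨p, hp⟩ := ne_neg_of_mem_unit_sphere ℝ _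
  obtain ⟨φ, hφ, -, h0⟩ := exists_isOpenEmbedding_sphere _ _ hne
  have ho : IsOpenEmbedding (h.symm ∘ φ) := h.symm.isOpenEmbedding.comp hφ
  refine ⟨Subtype.val ∘ h.symm ∘ φ, IsEmbedding.subtypeVal.comp ho.isEmbedding, by simp [h0], ?_, ?_⟩
  · rintro _ ⟨z, rfl⟩
    exact Subtype.property _
  · rw [Set.range_comp, nhdsWithin_eq_map_subtype_coe hp]
    refine Filter.image_mem_map (ho.isOpen_range.mem_nhds ⟨0, by simp [h0]⟩)

/-- It is the image of a half-plane under the exponential. -/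
theorem isPreconnected_punctured_ball {r : ℝ} (hr : 0 < r) :
    IsPreconnected (Metric.ball (0 : ℂ) r \ {0}) := by
  have : Metric.ball (0 : ℂ) r \ {0} = Complex.exp '' {w | w.re < Real.log r} := by
    ext z
    constructor
    · intro hz
      refine ⟨Complex.log z, ?_, Complex.exp_log hz.2⟩
      simp only [Set.mem_ofPred_eq, Complex.log_re]
      exact Real.log_lt_log (norm_pos_iff.2 hz.2) (mem_ball_zero_iff.1 hz.1)
    · rintro ⟨w, hw, rfl⟩
      refine ⟨?_, Complex.exp_ne_zero _⟩
      rw [mem_ball_zero_iff, Complex.norm_exp]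
      exact (Real.lt_log_iff_exp_lt hr).1 hw
  rw [this]
  exact (convex_halfSpace_re_lt _).isPreconnected.image _ Complex.continuous_exp.continuousOn

namespace IsPlanarAt

variable {E : Type*} [TopologicalSpace E] {X : Set E} {p : E}

/-- A chart with its inverse. -/
theorem exists_chart (h : IsPlanarAt X p) : ∃ (φ : ℂ → E) (ψ : E → ℂ) (U : Set E), Continuous φ ∧
    ContinuousOn ψ U ∧ (∀ z, φ z ∈ U) ∧ (∀ z, ψ (φ z) = z) ∧ (∀ x ∈ U, φ (ψ x) = x) ∧
      φ 0 = p ∧ U ⊆ X ∧ U ∈ 𝓝[X] p := by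
  obtain ⟨φ, hφ, h0, hX, hU⟩ := h
  let e := hφ.toHomeomorph
  classical
  refine ⟨φ, fun x => if hx : x ∈ Set.range φ then e.symm ⟨x, hx⟩ else 0, Set.range φ,
    hφ.continuous, ?_, fun z => ⟨z, rfl⟩, fun z => ?_, ?_, h0, hX, hU⟩
  · rw [continuousOn_iff_continuous_domRestrict]
    refine e.symm.continuous.congr fun x => ?_
    simp [Set.domRestrict]
  · have : e z = ⟨φ z, z, rfl⟩ := rfl
    simp [← this]
  · rintro _ ⟨z, rfl⟩
    have : e z = ⟨φ z, z, rfl⟩ := rfl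
    simp [← this]

/-- The preimage of a neighborhood under a chart contains a disc, whose image is a neighborhood. -/
theorem exists_ball {φ : ℂ → E} {ψ : E → ℂ} {U : Set E} (hφ : Continuous φ)
    (hψ : ContinuousOn ψ U) (hψφ : ∀ z, ψ (φ z) = z) (hφψ : ∀ x ∈ U, φ (ψ x) = x)
    (hφU : ∀ z, φ z ∈ U) (h0 : φ 0 = p) (hUX : U ⊆ X) (hU : U ∈ 𝓝[X] p) {N : Set E}
    (hN : N ∈ 𝓝[X] p) :
    ∃ r > 0, Set.MapsTo φ (Metric.ball 0 r) N ∧ φ '' Metric.ball 0 r ∈ 𝓝[X] p := by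
  have h1 : φ ⁻¹' N ∈ 𝓝 (0 : ℂ) := by
    have : Filter.Tendsto φ (𝓝 0) (𝓝[X] p) :=
      tendsto_nhdsWithin_iff.2 ⟨h0 ▸ hφ.continuousAt, .of_forall fun z => hUX (hφU z)⟩
    exact this hN
  obtain ⟨r, hr, hrN⟩ := Metric.mem_nhds_iff.1 h1
  refine ⟨r, hr, hrN, ?_⟩
  have hp : p ∈ U := h0 ▸ hφU 0
  have h2 : ψ ⁻¹' Metric.ball 0 r ∈ 𝓝[U] p :=
    (hψ p hp) (Metric.isOpen_ball.mem_nhds (by rw [← h0, hψφ]; simpa using hr))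
  filter_upwards [nhdsWithin_le_of_mem hU h2, hU] with x hx hxU
  exact ⟨ψ x, hx, hφψ x hxU⟩

/-- Near a point of a surface there is a function without logarithm. -/
theorem exists_not_hasLogOn (h : IsPlanarAt X p) : ∃ U ∈ 𝓝[X] p, ∀ N ∈ 𝓝[X] p, N ⊆ U →
    ∃ f : E → ℂ, ContinuousOn f (N \ {p}) ∧ (∀ x ∈ N \ {p}, f x ≠ 0) ∧ ¬ HasLogOn f (N \ {p}) := by
  obtain ⟨φ, ψ, U, hφ, hψ, hφU, hψφ, hφψ, h0, hUX, hU⟩ := h.exists_chart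
  -- The function is the chart coordinate `ψ` itself; read in the chart it becomes `z ^ 1`, which
  -- has no logarithm on any small punctured disc. One `U` serves all smaller neighbourhoods, so
  -- that a neighbourhood of convenient shape can be chosen later.
  refine ⟨U, hU, fun N hN hNU => ⟨ψ, hψ.mono (Set.sdiff_subset.trans hNU), ?_, fun hlog => ?_⟩⟩
  · intro x hx hx0
    apply hx.2
    rw [Set.mem_singleton_iff, ← hφψ x (hNU hx.1), hx0, h0]
  · obtain ⟨r, hr, hrN, -⟩ := exists_ball hφ hψ hψφ hφψ hφU h0 hUX hU hN
    have := hlog.comp (φ := φ) (u := Metric.ball 0 r \ {0}) hφ.continuousOn fun z hz =>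
      ⟨hrN hz.1, fun h1 => hz.2 (by
        rw [Set.mem_singleton_iff] at h1 ⊢
        rw [← hψφ z, h1, ← h0, hψφ])⟩
    simp only [hψφ] at this
    exact one_ne_zero (eq_zero_of_hasLogOn_zpow (m := 1) hr (this.congr fun z _ => by simp))

/-- A surface is not separated locally by one of its points. -/
theorem subset_or_subset (h : IsPlanarAt X p) {N A B : Set E} (hN : N ∈ 𝓝[X] p) (hA : IsOpen A)
    (hB : IsOpen B) (hAB : N ∩ (A ∩ B) = ∅) (hsub : N \ {p} ⊆ A ∪ B) :
    ∃ N' ∈ 𝓝[X] p, N' \ {p} ⊆ A ∨ N' \ {p} ⊆ B := by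
  obtain ⟨φ, ψ, U, hφ, hψ, hφU, hψφ, hφψ, h0, hUX, hU⟩ := h.exists_chart
  obtain ⟨r, hr, hrN, hr'⟩ := exists_ball hφ hψ hψφ hφψ hφU h0 hUX hU hN
  refine ⟨_, hr', ?_⟩
  have himage : φ '' Metric.ball 0 r \ {p} = φ '' (Metric.ball 0 r \ {0}) := by
    rw [Set.image_sdiff (Function.LeftInverse.injective hψφ), Set.image_singleton, h0]
  rw [himage]
  have hsub' : φ '' (Metric.ball 0 r \ {0}) ⊆ N \ {p} := by
    rw [← himage]
    exact Set.sdiff_subset_sdiff_left hrN.image_subset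
  exact isPreconnected_iff_subset_of_disjoint.1
    ((isPreconnected_punctured_ball hr).image _ hφ.continuousOn) A B hA hB (hsub'.trans hsub)
    (Set.subset_empty_iff.1 (hAB ▸ Set.inter_subset_inter_left _ (hsub'.trans Set.sdiff_subset)))

/-- No surface contains three half discs with a common diameter: `f₁` and `f₂` are two ways to fold
the union of the half discs to a disc, and `γ₁`, `γ₂` are discs formed by two of them. -/
theorem not_fold (h : IsPlanarAt X p) {N : Set E} (hN : N ∈ 𝓝[X] p) {f₁ f₂ : E → ℂ}
    (hf₁ : ContinuousOn f₁ N) (hf₂ : ContinuousOn f₂ N) (hf₁0 : ∀ x ∈ N \ {p}, f₁ x ≠ 0)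
    (hf₂0 : ∀ x ∈ N \ {p}, f₂ x ≠ 0) {γ₁ γ₂ : ℂ → E} {r : ℝ} (hr : 0 < r)
    (hγ₁ : Continuous γ₁) (hγ₂ : Continuous γ₂)
    (hγ₁0 : γ₁ 0 = p) (hγ₂0 : γ₂ 0 = p) (hγ₁X : Set.MapsTo γ₁ (Metric.ball 0 r) X)
    (hγ₂X : Set.MapsTo γ₂ (Metric.ball 0 r) X)
    (h11 : ∀ z ∈ Metric.ball 0 r, f₁ (γ₁ z) = z)
    (h21 : ∀ z ∈ Metric.ball 0 r, f₂ (γ₁ z) = z.re + |z.im| * Complex.I)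
    (h22 : ∀ z ∈ Metric.ball 0 r, f₂ (γ₂ z) = z) : False := by
  obtain ⟨φ, ψ, U, hφ, hψ, hφU, hψφ, hφψ, h0, hUX, hU⟩ := h.exists_chart
  obtain ⟨s, hs, hsN, hs'⟩ := exists_ball hφ hψ hψφ hφψ hφU h0 hUX hU hN
  have hφ0 : ∀ z, φ z = p → z = 0 := fun z hz => by rw [← hψφ z, hz, ← h0, hψφ]
  have hmaps : Set.MapsTo φ (Metric.ball 0 s \ {0}) (N \ {p}) := fun z hz =>
    ⟨hsN hz.1, fun h => hz.2 (hφ0 z h)⟩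
  have key : ∀ f : E → ℂ, ContinuousOn f N → (∀ x ∈ N \ {p}, f x ≠ 0) →
      ∃ n : ℤ, HasLogOn (fun z => f (φ z) / z ^ n) (Metric.ball 0 s \ {0}) := fun f hf hf0 =>
    exists_zpow_hasLogOn hs ((hf.mono Set.sdiff_subset).comp hφ.continuousOn hmaps)
      fun z hz => hf0 _ (hmaps hz)
  -- These are the winding numbers of `f₁`, `f₂` in the chart. If `ψ ∘ γ₁` winds `w` times, then `f₁
  -- ∘ γ₁ = z` gives `n₁ w = 1`, while `f₂ ∘ γ₁` stays in a half-plane and gives `n₂ w = 0`; hence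
  -- `n₂ = 0`. But `f₂ ∘ γ₂ = z` winds once, a contradiction. Below, the numbers `w` are avoided by
  -- multiplying powers of functions that have logarithms.
  obtain ⟨n₁, hn₁⟩ := key f₁ hf₁ hf₁0
  obtain ⟨n₂, hn₂⟩ := key f₂ hf₂ hf₂0
  -- shrink the loops into the chart
  have hsmall : ∀ γ : ℂ → E, Continuous γ → γ 0 = p → Set.MapsTo γ (Metric.ball 0 r) X →
      ∃ t > 0, t ≤ r ∧ Set.MapsTo γ (Metric.ball 0 t) (φ '' Metric.ball 0 s) := by
    intro γ hγ hγ0 hγX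
    have : Filter.Tendsto γ (𝓝 0) (𝓝[X] p) :=
      tendsto_nhdsWithin_iff.2 ⟨hγ0 ▸ hγ.continuousAt,
        Filter.mem_of_superset (Metric.ball_mem_nhds 0 hr) fun z hz => hγX hz⟩
    obtain ⟨t, ht, htN⟩ := Metric.mem_nhds_iff.1 (this hs')
    exact ⟨min t r, lt_min ht hr, min_le_right _ _, fun z hz =>
      htN (Metric.ball_subset_ball (min_le_left _ _) hz)⟩
  have hfold : ∀ t : ℝ, HasLogOn (fun z : ℂ => (z.re + |z.im| * Complex.I : ℂ))
      (Metric.ball 0 t \ {0}) := by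
    intro t
    -- The folded point lies in the closed upper half-plane; the factor `-i` turns it to `|im z| - i
    -- re z`, in the closed right half-plane without 0, where the principal logarithm is continuous.
    have hmem : ∀ z : ℂ, z ≠ 0 → -Complex.I * (z.re + |z.im| * Complex.I) ∈ Complex.slitPlane := by
      intro z hz
      rw [Complex.mem_slitPlane_iff]
      by_contra! hcon
      apply hz
      simp at hcon
      exact Complex.ext (by simpa using hcon.2) (by simpa using hcon.1)
    refine ⟨fun z => Complex.log (-Complex.I * (z.re + |z.im| * Complex.I)) +
      Real.pi / 2 * Complex.I, ?_, fun z hz => ?_⟩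
    · refine ContinuousOn.add (ContinuousOn.clog ?_ fun z hz => hmem z hz.2) continuousOn_const
      fun_prop
    · rw [Complex.exp_add, Complex.exp_log (Complex.slitPlane_ne_zero (hmem z hz.2)),
        Complex.exp_pi_div_two_mul_I]
      linear_combination (-(z.re + |z.im| * Complex.I : ℂ)) * Complex.I_mul_I
  -- the logarithms along a loop
  have hloop : ∀ γ : ℂ → E, Continuous γ → ∀ t > 0,
      Set.MapsTo γ (Metric.ball 0 t) (φ '' Metric.ball 0 s) →
      (∀ z ∈ Metric.ball 0 t \ {0}, γ z ≠ p) → 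
      (∀ z ∈ Metric.ball 0 t \ {0}, ψ (γ z) ≠ 0) ∧
      HasLogOn (fun z => f₁ (γ z) / ψ (γ z) ^ n₁) (Metric.ball 0 t \ {0}) ∧
      HasLogOn (fun z => f₂ (γ z) / ψ (γ z) ^ n₂) (Metric.ball 0 t \ {0}) := by
    intro γ hγ t ht hγs hγp
    have hmem : ∀ z ∈ Metric.ball 0 t, γ z ∈ U ∧ ψ (γ z) ∈ Metric.ball 0 s := fun z hz => by
      obtain ⟨w, hw, hw'⟩ := hγs hz
      rw [← hw', hψφ]
      exact ⟨hφU w, hw⟩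
    have hm : Set.MapsTo (fun z => ψ (γ z)) (Metric.ball 0 t \ {0}) (Metric.ball 0 s \ {0}) :=
      fun z hz => ⟨(hmem z hz.1).2, fun h => hγp z hz (by
        rw [← hφψ _ (hmem z hz.1).1]; exact (congrArg φ h).trans h0)⟩
    have hc : ContinuousOn (fun z => ψ (γ z)) (Metric.ball 0 t \ {0}) :=
      hψ.comp hγ.continuousOn fun z hz => (hmem z hz.1).1
    refine ⟨fun z hz => (hm hz).2, (hn₁.comp hc hm).congr fun z hz => ?_,
      (hn₂.comp hc hm).congr fun z hz => ?_⟩ <;> rw [hφψ _ (hmem z hz.1).1]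
  have hf0 : ∀ f : E → ℂ, ∀ γ : ℂ → E, f p = 0 → ∀ z ∈ Metric.ball 0 r \ {0}, f (γ z) = z →
      γ z ≠ p := fun f γ hf z hz hfz hcon => hz.2 (by rw [← hfz, hcon, hf]; rfl)
  have hf₁p : f₁ p = 0 := by rw [← hγ₁0, h11 0 (by simpa)]
  have hf₂p : f₂ p = 0 := by rw [← hγ₂0, h22 0 (by simpa)]
  obtain ⟨t₁, ht₁, ht₁r, hγt₁⟩ := hsmall γ₁ hγ₁ hγ₁0 hγ₁X
  obtain ⟨t₂, ht₂, ht₂r, hγt₂⟩ := hsmall γ₂ hγ₂ hγ₂0 hγ₂X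
  have hsub : ∀ t ≤ r, ∀ z ∈ Metric.ball (0 : ℂ) t \ {0}, z ∈ Metric.ball 0 r \ {0} :=
    fun t ht z hz => ⟨Metric.ball_subset_ball ht hz.1, hz.2⟩
  obtain ⟨a0, a1, a2⟩ := hloop γ₁ hγ₁ t₁ ht₁ hγt₁ fun z hz =>
    hf0 f₁ γ₁ hf₁p z (hsub _ ht₁r z hz) (h11 z (hsub _ ht₁r z hz).1)
  obtain ⟨b0, b1, b2⟩ := hloop γ₂ hγ₂ t₂ ht₂ hγt₂ fun z hz =>
    hf0 f₂ γ₂ hf₂p z (hsub _ ht₂r z hz) (h22 z (hsub _ ht₂r z hz).1)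
  have hfold0 : ∀ z : ℂ, z ≠ 0 → (z.re + |z.im| * Complex.I : ℂ) ≠ 0 := by
    intro z hz hcon
    obtain ⟨g, -, hg⟩ := hfold (‖z‖ + 1)
    exact Complex.exp_ne_zero _ ((hg z ⟨by simp, hz⟩).trans hcon)
  have hn₂0 : n₂ = 0 := by
    -- `ψ ^ n₂` has a logarithm along `γ₁`
    have c1 := (((a2.zpow (-1)).mul (hfold t₁)).zpow n₁).mul (a1.zpow n₂)
    refine eq_zero_of_hasLogOn_zpow ht₁ (c1.congr fun z hz => ?_)
    have hz' := (hsub _ ht₁r z hz).1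
    rw [h11 z hz', h21 z hz']
    have e1 := hfold0 z hz.2
    have e2 := a0 z hz
    rw [zpow_neg_one, inv_div, div_mul_cancel₀ _ e1, div_zpow, ← zpow_mul, ← zpow_mul, mul_comm n₂ n₁,
      mul_div_cancel₀ _ (zpow_ne_zero _ e2)]
  refine one_ne_zero (eq_zero_of_hasLogOn_zpow (m := 1) ht₂ (b2.congr fun z hz => ?_))
  rw [h22 z (hsub _ ht₂r z hz).1, hn₂0]
  simp

end IsPlanarAt

/-- The sphere is simply connected: its coverings have sections. -/
theorem exists_section_of_homeomorph {E X : Type*} [TopologicalSpace E] [TopologicalSpace X]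
    (h : X ≃ₜ Metric.sphere (0 : EuclideanSpace ℝ (Fin 3)) 1) {p : E → X} (cov : IsCoveringMap p)
    (hp : Function.Surjective p) : ∃ s : X → E, Continuous s ∧ ∀ x, p (s x) = x := by
  have : T2Space X := h.isEmbedding.t2Space
  obtain ⟨v, hv⟩ : (Metric.sphere (0 : EuclideanSpace ℝ (Fin 3)) 1).Nonempty :=
    NormedSpace.sphere_nonempty.2 zero_le_one
  let u : Metric.sphere (0 : EuclideanSpace ℝ (Fin 3)) 1 := ⟨v, hv⟩
  have hu : u ≠ -u := ne_neg_of_mem_unit_sphere ℝ _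
  -- lifts of the two charts
  have lift : ∀ φ : ℂ → X, Continuous φ → ∀ e, p e = φ 0 →
      ∃ g : ℂ → E, Continuous g ∧ (∀ z, p (g z) = φ z) ∧ g 0 = e := by
    intro φ hφ e he
    -- The plane is contracted to 0, so a chart lifts just as a homotopy starting at a constant map.
    let H : C(I × ℂ, X) := ⟨fun x => φ ((x.1 : ℝ) * x.2), by fun_prop⟩
    obtain ⟨g, hg, hg0⟩ := exists_lift_of_homotopy cov H e (fun a => by simp [H, he])
    refine ⟨fun z => g (1, z), by fun_prop, fun z => by simp [hg, H], ?_⟩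
    -- The homotopy fixes 0, so the lift is constant over it; this is what gives the lifted chart
    -- the prescribed value at 0.
    have h1 : ∀ t : I, g (t, 0) = g (0, 0) := fun t => by
      have hconst : IsPreconnected (Set.univ : Set I) := isPreconnected_univ
      exact cov.constOn_of_comp hconst (g := fun t => g (t, 0)) (by fun_prop)
        (fun a _ b _ => by simp [hg, H]) (Set.mem_univ t) (Set.mem_univ 0)
    exact (h1 1).trans (hg0 0)
  have chart : ∀ v w : Metric.sphere (0 : EuclideanSpace ℝ (Fin 3)) 1, w ≠ v → ∃ φ : ℂ → X,
      IsOpenEmbedding φ ∧ Set.range φ = {h.symm v}ᶜ ∧ φ 0 = h.symm w := by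
    intro v w hvw
    obtain ⟨φ, hφ, hr, h0⟩ := exists_isOpenEmbedding_sphere w v hvw
    refine ⟨h.symm ∘ φ, h.symm.isOpenEmbedding.comp hφ, ?_, by simp [h0]⟩
    rw [Set.range_comp, hr, Set.image_compl_eq h.symm.bijective, Set.image_singleton]
  -- local sections over the complements of points
  have sec : ∀ v w : Metric.sphere (0 : EuclideanSpace ℝ (Fin 3)) 1, w ≠ v → ∀ e,
      p e = h.symm w → ∃ s : X → E, ContinuousOn s {h.symm v}ᶜ ∧
        (∀ x ∈ ({h.symm v}ᶜ : Set X), p (s x) = x) ∧ s (h.symm w) = e := by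
    intro v w hvw e he
    obtain ⟨φ, hφ, hr, h0⟩ := chart v w hvw
    obtain ⟨g, hg, hpg, hg0⟩ := lift φ hφ.continuous e (by rw [he, h0])
    refine ⟨g ∘ (hφ.toOpenPartialHomeomorph φ).symm, ?_, ?_, ?_⟩
    · rw [← hr]
      exact hg.comp_continuousOn (by
        simpa using (hφ.toOpenPartialHomeomorph φ).continuousOn_symm)
    · rw [← hr]
      rintro _ ⟨z, rfl⟩
      simp [hpg, hφ.toOpenPartialHomeomorph_left_inv]
    · rw [← h0]
      simp [hg0, hφ.toOpenPartialHomeomorph_left_inv]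
  -- a third point
  obtain ⟨w, hw⟩ : ∃ w, w ∉ ({u, -u} : Set (Metric.sphere (0 : EuclideanSpace ℝ (Fin 3)) 1)) := by
    obtain ⟨φ, hφ, hr, h0⟩ := exists_isOpenEmbedding_sphere (-u) u hu.symm
    refine ⟨φ 1, ?_⟩
    have h1 : φ 1 ∈ Set.range φ := ⟨1, rfl⟩
    rw [hr] at h1
    rintro (h2 | h2)
    · exact h1 h2
    · exact one_ne_zero (hφ.injective (h2.trans h0.symm))
  simp only [Set.mem_insert_iff, Set.mem_singleton_iff, not_or] at hw
  have hpre : IsPreconnected ({h.symm u}ᶜ ∩ {h.symm (-u)}ᶜ : Set X) := by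
    obtain ⟨φ, hφ, hr, h0⟩ := chart u (-u) hu.symm
    have : ({h.symm u}ᶜ ∩ {h.symm (-u)}ᶜ : Set X) = φ '' {0}ᶜ := by
      rw [← hr, ← h0, Set.image_compl_eq_range_sdiff_image hφ.injective, Set.image_singleton]
      rfl
    rw [this]
    refine IsPreconnected.image ?_ _ hφ.continuous.continuousOn
    exact (isConnected_compl_singleton_of_one_lt_rank (by
      rw [Complex.rank_real_complex]; norm_num) 0).isPreconnected
  obtain ⟨e, he⟩ := hp (h.symm w)
  obtain ⟨s, hs, hps, hsw⟩ := sec u w hw.1 e he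
  obtain ⟨s', hs', hps', hsw'⟩ := sec (-u) w hw.2 e he
  -- Both sections take the value `e` at `w`, and the twice punctured sphere is connected, so they
  -- agree there and glue to a global section.
  have heq : Set.EqOn s s' ({h.symm u}ᶜ ∩ {h.symm (-u)}ᶜ) :=
    cov.eqOn_of_comp_eqOn hpre (hs.mono Set.inter_subset_left) (hs'.mono Set.inter_subset_right)
      (fun x hx => (hps x hx.1).trans (hps' x hx.2).symm) (a := h.symm w)
      ⟨by simpa using hw.1, by simpa using hw.2⟩ (hsw.trans hsw'.symm)
  classical
  refine ⟨fun x => if x = h.symm u then s' x else s x, ?_, fun x => ?_⟩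
  · rw [continuous_iff_continuousAt]
    intro x
    by_cases hx : x = h.symm u
    · have hx' : x ∈ ({h.symm (-u)}ᶜ : Set X) := by
        rw [hx]
        simpa using hu
      refine (hs'.continuousAt (isOpen_compl_singleton.mem_nhds hx')).congr ?_
      filter_upwards [isOpen_compl_singleton.mem_nhds hx'] with y hy
      split_ifs with h1
      · rfl
      · exact (heq ⟨h1, hy⟩).symm
    · refine (hs.continuousAt (isOpen_compl_singleton.mem_nhds hx)).congr ?_
      filter_upwards [isOpen_compl_singleton.mem_nhds hx] with y hy
      exact (if_neg hy).symm
  · dsimp only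
    split_ifs with h1
    · exact hps' x (by rw [h1]; simpa using hu)
    · exact hps x h1

end SphereTri

/-! ### Local structure of a triangulated sphere: maximal faces, edges, links, connectedness. -/

namespace SphereTri

open Topology

section Realization

variable {V : Type*} {K : AbstractSimplicialComplex V}

theorem face_mono {s t : Finset V} (hs : s ∈ K) (hts : t ⊆ s) (ht : t.Nonempty) : t ∈ K :=
  (K.isRelLowerSet_faces hs).2 hts ht

theorem face_nonempty {s : Finset V} (hs : s ∈ K) : s.Nonempty :=
  (K.isRelLowerSet_faces hs).1

variable [Fintype V]

theorem mem_realization {x : V → ℝ} : x ∈ realization K ↔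
    (∀ v, 0 ≤ x v) ∧ ∑ v, x v = 1 ∧ ∃ s ∈ K, ∀ v, x v ≠ 0 → v ∈ s := by
  simp [realization, stdSimplex, and_assoc]

theorem face_of_ne_zero {x : V → ℝ} (hx : x ∈ realization K) {t : Finset V} (ht : t.Nonempty)
    (h : ∀ v ∈ t, x v ≠ 0) : t ∈ K := by
  obtain ⟨-, -, s, hs, hxs⟩ := mem_realization.1 hx
  exact face_mono hs (fun v hv => hxs v (h v hv)) ht

theorem IsSphereTriangulation.isPlanarAt (hK : IsSphereTriangulation K) {p : V → ℝ}
    (hp : p ∈ realization K) : IsPlanarAt (realization K) p :=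
  isPlanarAt_of_homeomorph hK.some hp

variable [DecidableEq V]

/-- Near the barycentre of a maximal face only that face is present, so the realization looks there
like a ball of dimension `s.card - 1`. If this is not 2, every nonvanishing function on the
punctured ball has a logarithm, contrary to `exists_not_hasLogOn`. -/
theorem IsSphereTriangulation.card_of_maximal (hK : IsSphereTriangulation K) {s : Finset V}
    (hs : s ∈ K) (hmax : ∀ t ∈ K, s ⊆ t → t = s) : s.card = 3 := by
  by_contra hcard
  obtain ⟨a, ha⟩ := face_nonempty hs
  let ι := {v : V // v ∈ s.erase a}
  have hm : 0 < (s.card : ℝ) := by exact_mod_cast Finset.card_pos.2 ⟨a, ha⟩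
  have hι : Fintype.card ι = s.card - 1 := by
    rw [Fintype.card_coe, Finset.card_erase_of_mem ha]
  have hι' : (Fintype.card ι : ℝ) = s.card - 1 := by
    rw [hι, Nat.cast_sub (Finset.card_pos.2 ⟨a, ha⟩)]; simp
  let q : ℝ := 1 / s.card
  have hq : 0 < q := by positivity
  let p : V → ℝ := fun v => if v ∈ s then q else 0
  -- the coordinates and their inverse
  let c : (V → ℝ) → ι → ℝ := fun x i => x i - q
  let ψ : (ι → ℝ) → V → ℝ := fun y v =>
    if h : v ∈ s.erase a then q + y ⟨v, h⟩ else if v = a then q - ∑ i, y i else 0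
  have hψ : Continuous ψ := by
    refine continuous_pi fun v => ?_
    by_cases h : v ∈ s.erase a
    · simp only [ψ, h, dite_true]; fun_prop
    · by_cases h' : v = a
      · simp only [ψ, dif_neg h, if_pos h']; fun_prop
      · simp only [ψ, h, dite_false, h', if_false]; fun_prop
  have hsum : ∀ x : V → ℝ, (∀ v ∉ s, x v = 0) → ∑ v, x v = x a + ∑ i : ι, x i := by
    intro x hx
    rw [← Finset.sum_subset (Finset.subset_univ s) fun v _ hv => hx v hv,
      ← Finset.add_sum_erase _ _ ha, Finset.sum_coe_sort (s.erase a) x]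
  have hψs : ∀ y, ∀ v ∉ s, ψ y v = 0 := by
    intro y v hv
    have h1 : v ∉ s.erase a := fun h => hv (Finset.mem_of_mem_erase h)
    have h2 : v ≠ a := fun h => hv (h ▸ ha)
    exact (dif_neg h1).trans (if_neg h2)
  have hψa : ∀ y, ψ y a = q - ∑ i, y i := fun y => by simp [ψ]
  have hψi : ∀ y, ∀ i : ι, ψ y i = q + y i := fun y i => dif_pos i.2
  have hq1 : (Fintype.card ι : ℝ) * q = 1 - q := by
    rw [hι']; simp only [q]; field_simp
  have hψsum : ∀ y, ∑ v, ψ y v = 1 := by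
    intro y
    rw [hsum _ (hψs y), hψa]
    simp only [hψi, Finset.sum_add_distrib, Finset.sum_const, Finset.card_univ, nsmul_eq_mul, hq1]
    ring
  have hψ0 : ψ 0 = p := by
    ext v
    by_cases h : v ∈ s.erase a
    · exact ((dif_pos h).trans (add_zero q)).trans (if_pos (Finset.mem_of_mem_erase h)).symm
    · by_cases h' : v = a
      · subst h'; simp [ψ, p, ha]
      · have : v ∉ s := fun hv => h (Finset.mem_erase.2 ⟨h', hv⟩)
        simp [ψ, p, this, h']
  have hp : p ∈ realization K := by
    rw [mem_realization]
    refine ⟨fun v => ?_, by rw [← hψ0, hψsum], s, hs, fun v hv => ?_⟩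
    · simp only [p]; split_ifs <;> positivity
    · by_contra h; simp [p, h] at hv
  obtain ⟨U, hU, hno⟩ := (hK.isPlanarAt hp).exists_not_hasLogOn
  obtain ⟨ε, hε, hεU⟩ := Metric.mem_nhdsWithin_iff.1 hU
  -- The coordinate at `a` is recovered from the total 1, so it may move by as much as `(s.card - 1)
  -- r`. This must stay below `q`, to keep the coordinate positive, and below `ε`, to stay inside
  -- `U`.
  let r : ℝ := min (q / s.card) (ε / s.card)
  have hr : 0 < r := by positivity
  have hr1 : Fintype.card ι * r < q := by
    have h1 : s.card * r ≤ q := by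
      rw [mul_comm, ← le_div_iff₀ hm]; exact min_le_left _ _
    rw [hι']; linarith
  have hr2 : Fintype.card ι * r < ε := by
    have h1 : s.card * r ≤ ε := by
      rw [mul_comm, ← le_div_iff₀ hm]; exact min_le_right _ _
    rw [hι']; linarith
  have hscard : (1 : ℝ) ≤ s.card := by exact_mod_cast Finset.card_pos.2 ⟨a, ha⟩
  have hrq : r ≤ q := (min_le_left _ _).trans (div_le_self hq.le hscard)
  have hrε : r ≤ ε := (min_le_right _ _).trans (div_le_self hε.le hscard)
  -- All coordinates in `s` are positive on `N`, so by maximality of `s` the others vanish there and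
  -- need no condition.
  let N : Set (V → ℝ) := {x | x ∈ realization K ∧ 0 < x a ∧ c x ∈ Metric.ball 0 r}
  have hball : ∀ y : ι → ℝ, y ∈ Metric.ball 0 r ↔ ∀ i, |y i| < r := fun y => by
    rw [mem_ball_zero_iff, pi_norm_lt_iff hr]; rfl
  have hcc : Continuous c := by fun_prop
  have hca : ∀ i, c p i = 0 := fun i => by simp [c, p, Finset.mem_of_mem_erase i.2]
  have hNN : N ∈ 𝓝[realization K] p := by
    rw [mem_nhdsWithin]
    refine ⟨{x | 0 < x a} ∩ c ⁻¹' Metric.ball 0 r,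
      (isOpen_lt continuous_const (continuous_apply a)).inter (Metric.isOpen_ball.preimage hcc),
      ⟨by simp [p, ha, hq], ?_⟩, fun x hx => ⟨hx.2, hx.1.1, hx.1.2⟩⟩
    rw [Set.mem_preimage, hball]
    intro i
    rw [hca, abs_zero]
    exact hr
  -- points of `N` lie in the open simplex `s`
  have hNs : ∀ x ∈ N, ∀ v ∉ s, x v = 0 := by
    intro x hx v hv
    by_contra h
    have hpos : ∀ w ∈ insert v s, x w ≠ 0 := by
      intro w hw
      rw [Finset.mem_insert] at hw
      rcases hw with rfl | hw
      · exact h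
      by_cases hwa : w = a
      · rw [hwa]; exact hx.2.1.ne'
      · have h2 := (hball _).1 hx.2.2 ⟨w, Finset.mem_erase.2 ⟨hwa, hw⟩⟩
        have h3 := (abs_lt.1 h2).1
        simp only [c] at h3
        intro h4
        rw [h4] at h3
        linarith
    have h1 := hmax _ (face_of_ne_zero hx.1 (Finset.insert_nonempty v s) hpos)
      (Finset.subset_insert v s)
    exact hv (h1 ▸ Finset.mem_insert_self v s)
  have hψc : ∀ x ∈ N, ψ (c x) = x := by
    intro x hx
    ext v
    by_cases hv : v ∈ s
    · by_cases hva : v = a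
      · subst hva
        have h1 := (mem_realization.1 hx.1).2.1
        rw [hsum x (hNs x hx)] at h1
        rw [hψa]
        simp only [c, Finset.sum_sub_distrib, Finset.sum_const, Finset.card_univ, nsmul_eq_mul, hq1]
        linarith
      · have := hψi (c x) ⟨v, Finset.mem_erase.2 ⟨hva, hv⟩⟩
        rw [this]; simp [c]
    · rw [hψs _ v hv, hNs x hx v hv]
  have hcψ : ∀ y, c (ψ y) = y := fun y => by ext i; simp [c, hψi]
  have habs : ∀ y : ι → ℝ, y ∈ Metric.ball 0 r → |∑ i, y i| ≤ Fintype.card ι * r := by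
    intro y hy
    refine (Finset.abs_sum_le_sum_abs _ _).trans ?_
    refine (Finset.sum_le_card_nsmul _ _ r fun i _ => ((hball y).1 hy i).le).trans ?_
    simp
  have hψN : ∀ y ∈ Metric.ball 0 r, ψ y ∈ N := by
    intro y hy
    have h0 : 0 < ψ y a := by
      rw [hψa]; have := (abs_le.1 (habs y hy)).2; linarith
    refine ⟨mem_realization.2 ⟨fun v => ?_, hψsum y, s, hs, fun v hv => ?_⟩, h0, by rwa [hcψ]⟩
    · by_cases hv : v ∈ s
      · by_cases hva : v = a
        · rw [hva]; exact h0.le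
        · have := hψi y ⟨v, Finset.mem_erase.2 ⟨hva, hv⟩⟩
          rw [this]
          have := (abs_lt.1 ((hball y).1 hy ⟨v, Finset.mem_erase.2 ⟨hva, hv⟩⟩)).1
          linarith
      · rw [hψs y v hv]
    · by_contra h; exact hv (hψs y v h)
  have hNU : N ⊆ U := by
    intro x hx
    refine hεU ⟨?_, hx.1⟩
    rw [Metric.mem_ball, dist_pi_lt_iff hε]
    intro v
    rw [Real.dist_eq]
    by_cases hv : v ∈ s
    · by_cases hva : v = a
      · subst hva
        rw [← hψc x hx, hψa]
        simp only [p, ha, if_true]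
        have := habs _ hx.2.2
        rw [← abs_neg]
        simp only [neg_sub]
        rw [sub_sub_cancel]
        linarith
      · have := (hball _).1 hx.2.2 ⟨v, Finset.mem_erase.2 ⟨hva, hv⟩⟩
        simp only [c] at this
        simp only [p, hv, if_true]
        linarith
    · rw [hNs x hx v hv]; simp [p, hv, hε]
  obtain ⟨f, hf, hf0, hlog⟩ := hno N hNN hNU
  apply hlog
  have hmaps : Set.MapsTo ψ (Metric.ball 0 r \ {0}) (N \ {p}) := fun y hy =>
    ⟨hψN y hy.1, fun h => hy.2 (by
      rw [Set.mem_singleton_iff] at h ⊢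
      rw [← hcψ y, h, ← hψ0, hcψ])⟩
  have hmaps' : Set.MapsTo c (N \ {p}) (Metric.ball 0 r \ {0}) := fun x hx =>
    ⟨hx.1.2.2, fun h => hx.2 (by
      rw [Set.mem_singleton_iff] at h ⊢
      rw [← hψc x hx.1, h, hψ0])⟩
  have := hasLogOn_punctured_ball (ι := ι) (by omega) hr (hf.comp hψ.continuousOn hmaps)
    fun y hy => hf0 _ (hmaps hy)
  exact (this.comp (φ := c) hcc.continuousOn hmaps').congr fun x hx => by
    simp [hψc x hx.1]

theorem IsSphereTriangulation.exists_triangle (hK : IsSphereTriangulation K) {s : Finset V}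
    (hs : s ∈ K) : ∃ t ∈ K, s ⊆ t ∧ t.card = 3 := by
  have hfin : {t | t ∈ K ∧ s ⊆ t}.Finite := Set.toFinite _
  obtain ⟨t, hst, ht⟩ := hfin.exists_le_maximal (a := s) ⟨hs, subset_rfl⟩
  exact ⟨t, ht.prop.1, hst, hK.card_of_maximal ht.prop.1 fun u hu htu =>
    (ht.le_of_ge ⟨hu, hst.trans htu⟩ htu).antisymm htu⟩

theorem IsSphereTriangulation.card_le (hK : IsSphereTriangulation K) {s : Finset V}
    (hs : s ∈ K) : s.card ≤ 3 := by
  obtain ⟨t, -, hst, ht⟩ := hK.exists_triangle hs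
  exact ht ▸ Finset.card_le_card hst

/-- The midpoint of an edge. -/
theorem midpoint_mem_realization {a b : V} (h : ({a, b} : Finset V) ∈ K) :
    (Pi.single a (1 / 2) + Pi.single b (1 / 2) : V → ℝ) ∈ realization K := by
  refine mem_realization.2 ⟨fun v => ?_, ?_, _, h, fun v hv => ?_⟩
  · simp only [Pi.add_apply, Pi.single_apply]
    split_ifs <;> norm_num
  · simp [Finset.sum_add_distrib]
    norm_num
  · by_contra hcon
    simp only [Finset.mem_insert, Finset.mem_singleton, not_or] at hcon
    simp [hcon.1, hcon.2] at hv

/-- If `abc` were the only triangle on `ab`, the realization near the midpoint of `ab` would be a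
half disc with the midpoint on its diameter. Removing the midpoint leaves it star-shaped about an
interior point, so all nonvanishing functions there would have logarithms. -/
theorem IsSphereTriangulation.exists_ne_triangle (hK : IsSphereTriangulation K) {a b c : V}
    (hab : a ≠ b) (hac : a ≠ c) (hbc : b ≠ c) (h : ({a, b, c} : Finset V) ∈ K) :
    ∃ d, d ≠ a ∧ d ≠ b ∧ d ≠ c ∧ ({a, b, d} : Finset V) ∈ K := by
  by_contra! hno
  have hedge : ({a, b} : Finset V) ∈ K := face_mono h (by
    intro v; simp only [Finset.mem_insert, Finset.mem_singleton]; tauto) (by simp)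
  let p : V → ℝ := Pi.single a (1 / 2) + Pi.single b (1 / 2)
  have hp := midpoint_mem_realization hedge
  change p ∈ _ at hp
  have hpa : p a = 1 / 2 := by simp [p, hab]
  have hpb : p b = 1 / 2 := by simp [p, hab.symm]
  have hpc : p c = 0 := by simp [p, hac.symm, hbc.symm]
  obtain ⟨U, hU, hnot⟩ := (hK.isPlanarAt hp).exists_not_hasLogOn
  obtain ⟨ε, hε, hεU⟩ := Metric.mem_nhdsWithin_iff.1 hU
  -- With `r ≤ 1 / 2` the coordinates at `a` and `b` stay positive, so any further nonzero
  -- coordinate `d` yields a face `abd`.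
  let r := min ε (1 / 2)
  have hr : 0 < r := by positivity
  have hr2 : r ≤ 1 / 2 := min_le_right _ _
  let S : Set (V → ℝ) := {x | (∀ v, 0 ≤ x v) ∧ ∑ v, x v = 1 ∧
    ∀ v, v ∉ ({a, b, c} : Finset V) → x v = 0}
  have hball : ∀ x : V → ℝ, x ∈ Metric.ball p r ↔ ∀ v, |x v - p v| < r := fun x => by
    rw [Metric.mem_ball, dist_pi_lt_iff hr]; rfl
  have hS : realization K ∩ Metric.ball p r = S ∩ Metric.ball p r := by
    ext x
    refine and_congr_left fun hxb => ?_
    rw [hball] at hxb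
    constructor
    · intro hx
      obtain ⟨h1, h2, -⟩ := mem_realization.1 hx
      refine ⟨h1, h2, fun v hv => ?_⟩
      by_contra hv0
      simp only [Finset.mem_insert, Finset.mem_singleton, not_or] at hv
      refine hno v hv.1 hv.2.1 hv.2.2 (face_of_ne_zero hx (by simp) fun w hw => ?_)
      simp only [Finset.mem_insert, Finset.mem_singleton] at hw
      rcases hw with rfl | rfl | rfl
      · have := (abs_lt.1 (hxb w)).1; rw [hpa] at this; intro h; linarith
      · have := (abs_lt.1 (hxb w)).1; rw [hpb] at this; intro h; linarith
      · exact hv0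
    · rintro ⟨h1, h2, h3⟩
      exact mem_realization.2 ⟨h1, h2, _, h, fun v hv => by
        by_contra h4; exact hv (h3 v h4)⟩
  have hconv : Convex ℝ (S ∩ Metric.ball p r) := by
    refine Convex.inter ?_ (convex_ball p r)
    intro x hx y hy α β hα hβ hαβ
    refine ⟨fun v => ?_, ?_, fun v hv => ?_⟩
    · have := hx.1 v; have := hy.1 v
      simp only [Pi.add_apply, Pi.smul_apply, smul_eq_mul]; positivity
    · simp only [Pi.add_apply, Pi.smul_apply, smul_eq_mul, Finset.sum_add_distrib,
        ← Finset.mul_sum, hx.2.1, hy.2.1, mul_one, hαβ]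
    · simp [hx.2.2 v hv, hy.2.2 v hv]
  obtain ⟨f, hf, hf0, hlog⟩ := hnot (realization K ∩ Metric.ball p r)
    (Filter.inter_mem self_mem_nhdsWithin (mem_nhdsWithin_of_mem_nhds (Metric.ball_mem_nhds p hr)))
    (fun x hx => hεU ⟨Metric.ball_subset_ball (min_le_left _ _) hx.2, hx.1⟩)
  apply hlog
  -- The centre arises from the midpoint by shifting the weight `r / 2` to `c`, taken equally from
  -- `a` and `b`, so no coordinate moves by `r`.
  let q : V → ℝ := Pi.single a ((1 - r / 2) / 2) + Pi.single b ((1 - r / 2) / 2) +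
    Pi.single c (r / 2)
  have hq : q ∈ S ∩ Metric.ball p r := by
    refine ⟨⟨fun v => ?_, ?_, fun v hv => ?_⟩, (hball q).2 fun v => ?_⟩
    · simp only [q, Pi.add_apply, Pi.single_apply]
      split_ifs <;> linarith
    · simp only [q, Pi.add_apply, Finset.sum_add_distrib, Finset.sum_pi_single', Finset.mem_univ,
        if_true]
      ring
    · simp only [Finset.mem_insert, Finset.mem_singleton, not_or] at hv
      simp [q, hv.1, hv.2.1, hv.2.2]
    · rw [abs_lt]
      simp only [q, p, Pi.add_apply, Pi.single_apply]
      constructor <;> split_ifs <;> linarith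
  have hqc : q c = r / 2 := by simp [q, hac.symm, hbc.symm]
  refine hasLogOn_of_starConvex (q := q) ?_ hf hf0
  rw [hS]
  intro x hx α β hα hβ hαβ
  refine ⟨hconv hq hx.1 hα hβ hαβ, fun hcon => hx.2 ?_⟩
  -- The coordinate at `c` vanishes at `p` and is positive at `q`; a segment from `q` can therefore
  -- reach `p` only at its other end.
  have h1 := congrFun (Set.mem_singleton_iff.1 hcon) c
  simp only [Pi.add_apply, Pi.smul_apply, smul_eq_mul, hqc, hpc] at h1
  have h2 : 0 ≤ β * x c := mul_nonneg hβ (hx.1.1.1 c)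
  have h3 : α = 0 := by
    by_contra h
    have : 0 < α * (r / 2) := mul_pos (lt_of_le_of_ne hα (Ne.symm h)) (by linarith)
    linarith
  have h4 : β = 1 := by linarith
  rw [h3, h4] at hcon
  simpa using hcon

/-- Three triangles on one edge contain three half discs with a common diameter. Folding along this
diameter in two ways provides the functions and discs for `not_fold`. -/
theorem IsSphereTriangulation.triangle_eq_or_eq (hK : IsSphereTriangulation K) {a b c₁ c₂ c₃ : V}
    (hab : a ≠ b) (ha₁ : a ≠ c₁) (ha₂ : a ≠ c₂) (ha₃ : a ≠ c₃) (hb₁ : b ≠ c₁) (hb₂ : b ≠ c₂)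
    (hb₃ : b ≠ c₃) (h₁ : ({a, b, c₁} : Finset V) ∈ K) (h₂ : ({a, b, c₂} : Finset V) ∈ K)
    (h₃ : ({a, b, c₃} : Finset V) ∈ K) (h12 : c₁ ≠ c₂) : c₃ = c₁ ∨ c₃ = c₂ := by
  by_contra! hne
  have hedge : ({a, b} : Finset V) ∈ K := face_mono h₁ (by
    intro v; simp only [Finset.mem_insert, Finset.mem_singleton]; tauto) (by simp)
  let p : V → ℝ := Pi.single a (1 / 2) + Pi.single b (1 / 2)
  have hp := midpoint_mem_realization hedge
  change p ∈ _ at hp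
  have hpa : p a = 1 / 2 := by simp [p, hab]
  have hpb : p b = 1 / 2 := by simp [p, hab.symm]
  let N : Set (V → ℝ) := {x | x ∈ realization K ∧ 0 < x a ∧ 0 < x b}
  have hN : N ∈ 𝓝[realization K] p := by
    rw [mem_nhdsWithin]
    refine ⟨{x | 0 < x a} ∩ {x | 0 < x b}, (isOpen_lt continuous_const (continuous_apply a)).inter
      (isOpen_lt continuous_const (continuous_apply b)), ⟨by simp [hpa], by simp [hpb]⟩,
      fun x hx => ⟨hx.2, hx.1.1, hx.1.2⟩⟩
  -- The real part runs along the edge. The imaginary part is the total weight off the edge minus `2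
  -- x c`: it is `-x c` on the triangle `abc` and `x d` on another triangle `abd`. So `f c` folds
  -- `abc` to the lower half-plane and all other triangles on `ab` to the upper one.
  let f : V → (V → ℝ) → ℂ := fun c x =>
    ((x a - x b : ℝ) : ℂ) + ((1 - x a - x b - 2 * x c : ℝ) : ℂ) * Complex.I
  have hfc : ∀ c, ContinuousOn (f c) N := fun c => by
    apply Continuous.continuousOn
    fun_prop
  have hf0 : ∀ c, a ≠ c → b ≠ c → ∀ x ∈ N \ {p}, f c x ≠ 0 := by
    intro c hac hbc x hx h0
    have hre := congrArg Complex.re h0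
    have him := congrArg Complex.im h0
    simp [f] at hre him
    obtain ⟨hx0, hx1, -⟩ := mem_realization.1 hx.1.1
    have hxa := hx.1.2.1
    have hxb := hx.1.2.2
    have hsum : ∑ v, x v = x a + x b + ∑ v ∈ (Finset.univ.erase a).erase b, x v := by
      rw [← Finset.add_sum_erase _ _ (Finset.mem_univ a),
        ← Finset.add_sum_erase (Finset.univ.erase a) _ (Finset.mem_erase.2 ⟨hab.symm, Finset.mem_univ b⟩)]
      ring
    rw [hx1] at hsum
    by_cases hc : x c = 0
    · apply hx.2
      rw [Set.mem_singleton_iff]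
      have hrest : ∑ v ∈ (Finset.univ.erase a).erase b, x v = 0 := by rw [hc] at him; linarith
      rw [Finset.sum_eq_zero_iff_of_nonneg fun v _ => hx0 v] at hrest
      have hxa' : x a = 1 / 2 := by rw [hc] at him; linarith
      ext v
      by_cases hva : v = a
      · subst hva; rw [hpa, hxa']
      by_cases hvb : v = b
      · subst hvb; rw [hpb]; linarith
      rw [hrest v (by simp [hva, hvb])]
      simp [p, hva, hvb]
    -- No face has four vertices, so if `x c ≠ 0` then `c` carries all the weight off the edge; a
    -- vanishing imaginary part would then read `x c = 2 x c`.
    · have hrest : ∑ v ∈ (Finset.univ.erase a).erase b, x v = x c := by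
        refine Finset.sum_eq_single_of_mem c (by simp [hac.symm, hbc.symm]) fun v hv hvc => ?_
        by_contra hv0
        simp only [Finset.mem_erase, Finset.mem_univ, and_true] at hv
        have := hK.card_le (face_of_ne_zero hx.1.1 (t := {a, b, c, v}) (by simp) (by
          simp only [Finset.mem_insert, Finset.mem_singleton]
          rintro w (rfl | rfl | rfl | rfl)
          exacts [hxa.ne', hxb.ne', hc, hv0]))
        rw [Finset.card_insert_of_notMem, Finset.card_insert_of_notMem,
          Finset.card_pair hvc.symm] at this
        · omega
        · simp [hbc, Ne.symm hv.1]
        · simp [hab, hac, Ne.symm hv.2]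
      rw [hrest] at hsum
      apply hc
      linarith
  -- the disc formed by the half discs in two triangles
  let γ : V → ℂ → V → ℝ := fun c z => Pi.single a ((1 - |z.im| + z.re) / 2) +
    Pi.single b ((1 - |z.im| - z.re) / 2) + Pi.single c (max (-z.im) 0) +
    Pi.single c₃ (max z.im 0)
  have hmax : ∀ y : ℝ, max (-y) 0 + max y 0 = |y| := fun y => by
    rcases le_total 0 y with h | h
    · rw [max_eq_right (by linarith), max_eq_left h, abs_of_nonneg h, zero_add]
    · rw [max_eq_left (by linarith), max_eq_right h, abs_of_nonpos h, add_zero]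
  have hmax' : ∀ y : ℝ, max y 0 - max (-y) 0 = y := fun y => by
    rcases le_total 0 y with h | h
    · rw [max_eq_right (by linarith : -y ≤ 0), max_eq_left h, sub_zero]
    · rw [max_eq_left (by linarith : 0 ≤ -y), max_eq_right h]; ring
  have hγc : ∀ c, Continuous (γ c) := fun c => by
    refine continuous_pi fun v => ?_
    simp only [γ, Pi.add_apply, Pi.single_apply]
    refine ((Continuous.add ?_ ?_).add ?_).add ?_ <;> split_ifs <;> fun_prop
  have hγ0 : ∀ c, γ c 0 = p := fun c => by
    simp [γ, p]
  have hγX : ∀ c, ({a, b, c} : Finset V) ∈ K →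
      Set.MapsTo (γ c) (Metric.ball 0 (1 / 2)) (realization K) := by
    intro c hc z hz
    have hz' : ‖z‖ < 1 / 2 := mem_ball_zero_iff.1 hz
    have hre := (abs_le.1 (Complex.abs_re_le_norm z))
    have him := Complex.abs_im_le_norm z
    refine mem_realization.2 ⟨fun v => ?_, ?_, ?_⟩
    · simp only [γ, Pi.add_apply, Pi.single_apply]
      refine add_nonneg (add_nonneg (add_nonneg ?_ ?_) ?_) ?_ <;> split_ifs <;>
        first
        | exact le_rfl
        | exact le_max_right _ _
        | linarith
    · simp only [γ, Pi.add_apply, Finset.sum_add_distrib, Finset.sum_pi_single', Finset.mem_univ,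
        if_true]
      linarith [hmax z.im]
    · rcases le_total 0 z.im with h | h
      · refine ⟨_, h₃, fun v hv => ?_⟩
        by_contra hcon
        simp only [Finset.mem_insert, Finset.mem_singleton, not_or] at hcon
        simp [γ, hcon.1, hcon.2.1, hcon.2.2, h] at hv
      · refine ⟨_, hc, fun v hv => ?_⟩
        by_contra hcon
        simp only [Finset.mem_insert, Finset.mem_singleton, not_or] at hcon
        simp [γ, Pi.single_apply, hcon.1, hcon.2.1, hcon.2.2, h] at hv
  have hγa : ∀ c z, a ≠ c → γ c z a = (1 - |z.im| + z.re) / 2 := fun c z hc => by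
    simp [γ, hab, hc, ha₃]
  have hγb : ∀ c z, b ≠ c → γ c z b = (1 - |z.im| - z.re) / 2 := fun c z hc => by
    simp [γ, hab.symm, hc, hb₃]
  have hγγ : ∀ c z, a ≠ c → b ≠ c → c ≠ c₃ → γ c z c = max (-z.im) 0 := fun c z h h' h'' => by
    simp [γ, h.symm, h'.symm, h'']
  refine (hK.isPlanarAt hp).not_fold hN (hfc c₁) (hfc c₂) (hf0 c₁ ha₁ hb₁) (hf0 c₂ ha₂ hb₂)
    (γ₁ := γ c₁) (γ₂ := γ c₂) (r := 1 / 2) (by norm_num) (hγc _) (hγc _) (hγ0 _) (hγ0 _)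
    (hγX _ h₁) (hγX _ h₂) ?_ ?_ ?_
  · intro z _
    simp only [f, hγa _ _ ha₁, hγb _ _ hb₁, hγγ _ _ ha₁ hb₁ hne.1.symm]
    apply Complex.ext
    · simp; ring
    · simp only [Complex.add_im, Complex.ofReal_im, Complex.mul_im, Complex.ofReal_re,
        Complex.I_im, Complex.I_re, mul_one, mul_zero, add_zero, zero_add]
      linarith [hmax z.im, hmax' z.im]
  · intro z _
    have : γ c₁ z c₂ = 0 := by
      simp [γ, ha₂.symm, hb₂.symm, h12.symm, hne.2.symm]
    simp only [f, hγa _ _ ha₁, hγb _ _ hb₁, this]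
    apply Complex.ext <;> simp <;> ring
  · intro z _
    simp only [f, hγa _ _ ha₂, hγb _ _ hb₂, hγγ _ _ ha₂ hb₂ hne.2.symm]
    apply Complex.ext
    · simp; ring
    · simp only [Complex.add_im, Complex.ofReal_im, Complex.mul_im, Complex.ofReal_re,
        Complex.I_im, Complex.I_re, mul_one, mul_zero, add_zero, zero_add]
      linarith [hmax z.im, hmax' z.im]

theorem single_mem_realization (v : V) : (Pi.single v 1 : V → ℝ) ∈ realization K := by
  refine mem_realization.2 ⟨fun w => ?_, by simp, _, K.singleton_mem v, fun w hw => ?_⟩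
  · rw [Pi.single_apply]; split_ifs <;> norm_num
  · by_contra h
    simp only [Finset.mem_singleton] at h
    simp [h] at hw

/-- If `b` were outside `A`, the two conditions of having a nonzero coordinate in `A`, respectively
outside `A`, at a vertex other than `v` would separate the punctured star of `v` into open sets. A
surface is not separated locally by a point, yet points near `v` on the edges `va` and `vb` lie on
different sides. -/
theorem IsSphereTriangulation.link_connected (hK : IsSphereTriangulation K) (v : V) (A : Set V)
    (hne : ∃ a ∈ A, a ≠ v ∧ ({v, a} : Finset V) ∈ K)
    (hA : ∀ a ∈ A, ∀ b, a ≠ v → b ≠ v → ({v, a, b} : Finset V) ∈ K → b ∈ A) (b : V) (hbv : b ≠ v)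
    (hb : ({v, b} : Finset V) ∈ K) : b ∈ A := by
  classical
  by_contra hbA
  obtain ⟨a, haA, hav, ha⟩ := hne
  let p : V → ℝ := Pi.single v 1
  let N : Set (V → ℝ) := {x | x ∈ realization K ∧ 0 < x v}
  have hN : N ∈ 𝓝[realization K] p := by
    rw [mem_nhdsWithin]
    exact ⟨{x | 0 < x v}, isOpen_lt continuous_const (continuous_apply v), by simp [p],
      fun x hx => ⟨hx.2, hx.1⟩⟩
  let O : Set V → Set (V → ℝ) := fun B => ⋃ w ∈ B, {x | x w ≠ 0}
  have hO : ∀ B, IsOpen (O B) := fun B => isOpen_biUnion fun w _ =>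
    isOpen_ne_fun (continuous_apply w) continuous_const
  have hmem : ∀ B x, x ∈ O B ↔ ∃ w ∈ B, x w ≠ 0 := fun B x => by simp [O]
  have hdisj : N ∩ (O (A \ {v}) ∩ O (Aᶜ \ {v})) = ∅ := by
    ext x
    simp only [Set.mem_inter_iff, hmem, Set.mem_empty_iff_false, iff_false]
    rintro ⟨hx, ⟨c, hc, hc0⟩, d, hd, hd0⟩
    refine hd.1 (hA c hc.1 d hc.2 hd.2 (face_of_ne_zero hx.1 (by simp) ?_))
    simp only [Finset.mem_insert, Finset.mem_singleton]
    rintro w (rfl | rfl | rfl)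
    exacts [hx.2.ne', hc0, hd0]
  have hcover : N \ {p} ⊆ O (A \ {v}) ∪ O (Aᶜ \ {v}) := by
    intro x hx
    by_contra hcon
    simp only [Set.mem_union, hmem, not_or, not_exists, not_and, not_not] at hcon
    apply hx.2
    have h0 : ∀ w, w ≠ v → x w = 0 := fun w hw => by
      by_cases hwA : w ∈ A
      · exact hcon.1 w ⟨hwA, hw⟩
      · exact hcon.2 w ⟨hwA, hw⟩
    have h1 := (mem_realization.1 hx.1.1).2.1
    rw [Finset.sum_eq_single_of_mem v (Finset.mem_univ v) fun w _ hw => h0 w hw] at h1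
    rw [Set.mem_singleton_iff]
    ext w
    by_cases hw : w = v
    · subst hw; simp [p, h1]
    · simp [p, hw, h0 w hw]
  obtain ⟨N', hN', hN''⟩ := (hK.isPlanarAt (single_mem_realization v)).subset_or_subset hN
    (hO (A \ {v})) (hO (Aᶜ \ {v})) hdisj hcover
  -- points near `v` on an edge
  have hpt : ∀ w, w ≠ v → ({v, w} : Finset V) ∈ K →
      ∃ x ∈ N' \ {p}, ∀ u, u ≠ v → u ≠ w → x u = 0 := by
    intro w hwv hw
    let x : ℝ → V → ℝ := fun t => Pi.single v (1 - t) + Pi.single w t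
    have hx : Filter.Tendsto x (𝓝[Set.Ioo 0 1] 0) (𝓝[realization K] p) := by
      refine tendsto_nhdsWithin_iff.2 ⟨?_, ?_⟩
      · have : Continuous x := by
          refine continuous_pi fun u => ?_
          simp only [x, Pi.add_apply, Pi.single_apply]
          refine Continuous.add ?_ ?_ <;> split_ifs <;> fun_prop
        have h0 : x 0 = p := by simp [x, p]
        exact h0 ▸ this.continuousAt.mono_left nhdsWithin_le_nhds
      · filter_upwards [self_mem_nhdsWithin] with t ht
        refine mem_realization.2 ⟨fun u => ?_, ?_, _, hw, fun u hu => ?_⟩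
        · simp only [x, Pi.add_apply, Pi.single_apply]
          have := ht.1; have := ht.2
          split_ifs <;> linarith
        · simp [x, Finset.sum_add_distrib]
        · by_contra hcon
          simp only [Finset.mem_insert, Finset.mem_singleton, not_or] at hcon
          simp [x, hcon.1, hcon.2] at hu
    have hne : (𝓝[Set.Ioo (0 : ℝ) 1] 0).NeBot := by
      rw [nhdsWithin_Ioo_eq_nhdsGT zero_lt_one]; infer_instance
    obtain ⟨t, ht, ht'⟩ := ((hx.eventually hN').and self_mem_nhdsWithin).exists
    refine ⟨x t, ⟨ht, fun h => ?_⟩, fun u hu hu' => by simp [x, hu, hu']⟩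
    have := congrFun (Set.mem_singleton_iff.1 h) w
    simp [x, p, hwv] at this
    exact ht'.1.ne' this
  rcases hN'' with h | h
  · obtain ⟨x, hx, hx0⟩ := hpt b hbv hb
    obtain ⟨w, hw, hw0⟩ := (hmem _ _).1 (h hx)
    exact hw0 (hx0 w hw.2 (fun h => hbA (h ▸ hw.1)))
  · obtain ⟨x, hx, hx0⟩ := hpt a hav ha
    obtain ⟨w, hw, hw0⟩ := (hmem _ _).1 (h hx)
    exact hw0 (hx0 w hw.2 (fun h => hw.1 (h ▸ haA)))

/-- The separation argument for links, now applied globally: if no edge leaves `A`, the points with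
support meeting `A` and those with support meeting the complement separate the realization, but the
sphere is connected. -/
theorem IsSphereTriangulation.connected (hK : IsSphereTriangulation K) (A : Set V)
    (hne : A.Nonempty) (hA : ∀ a ∈ A, ∀ b, a ≠ b → ({a, b} : Finset V) ∈ K → b ∈ A) (b : V) :
    b ∈ A := by
  by_contra hb
  obtain ⟨a, ha⟩ := hne
  let O : Set V → Set (V → ℝ) := fun B => ⋃ w ∈ B, {x | x w ≠ 0}
  have hO : ∀ B, IsOpen (O B) := fun B => isOpen_biUnion fun w _ =>
    isOpen_ne_fun (continuous_apply w) continuous_const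
  have hmem : ∀ B x, x ∈ O B ↔ ∃ w ∈ B, x w ≠ 0 := fun B x => by simp [O]
  have hconn : IsPreconnected (realization K) := by
    have h1 : IsPreconnected (Metric.sphere (0 : EuclideanSpace ℝ (Fin 3)) 1) :=
      (isConnected_sphere (by simp [← Module.finrank_eq_rank]) 0 zero_le_one).isPreconnected
    have : PreconnectedSpace (Metric.sphere (0 : EuclideanSpace ℝ (Fin 3)) 1) :=
      isPreconnected_iff_preconnectedSpace.1 h1
    have h2 := isPreconnected_range (continuous_subtype_val.comp hK.some.symm.continuous)
    rwa [hK.some.symm.surjective.range_comp, Subtype.range_coe] at h2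
  obtain ⟨x, hx, hx1, hx2⟩ := hconn (O A) (O Aᶜ) (hO _) (hO _) (fun x hx => by
      by_contra hcon
      simp only [Set.mem_union, hmem, not_or, not_exists, not_and, not_not] at hcon
      have h1 := (mem_realization.1 hx).2.1
      rw [Finset.sum_eq_zero fun w _ => ?_] at h1
      · exact zero_ne_one h1
      · by_cases hwA : w ∈ A
        · exact hcon.1 w hwA
        · exact hcon.2 w hwA)
    ⟨_, single_mem_realization a, (hmem _ _).2 ⟨a, ha, by simp⟩⟩
    ⟨_, single_mem_realization b, (hmem _ _).2 ⟨b, hb, by simp⟩⟩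
  obtain ⟨c, hc, hc0⟩ := (hmem _ _).1 hx1
  obtain ⟨d, hd, hd0⟩ := (hmem _ _).1 hx2
  refine hd (hA c hc d (fun h => hd (h ▸ hc)) (face_of_ne_zero hx (by simp) ?_))
  simp only [Finset.mem_insert, Finset.mem_singleton]
  rintro w (rfl | rfl)
  exacts [hc0, hd0]

end Realization

end SphereTri

/-! ### Double coverings, and sign cocycles on the edges as coboundaries. -/

namespace SphereTri

open Topology

section DoubleCover

variable {V : Type*} [Fintype V]

/-- The double cover of the realization of `K` given by signs `ε` on the edges. -/
def doubleCover (K : AbstractSimplicialComplex V) (ε : V → V → ℝ) : SubMulAction ℤˣ (V → ℝ) where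
  carrier := {y | (fun v => |y v|) ∈ realization K ∧ ∀ v w, 0 ≤ ε v w * (y v * y w)}
  smul_mem' u y hy := by
    rcases Int.units_eq_one_or u with rfl | rfl
    · simpa using hy
    · simpa using hy

variable {K : AbstractSimplicialComplex V} {ε : V → V → ℝ}

theorem mem_doubleCover {y : V → ℝ} : y ∈ doubleCover K ε ↔
    (fun v => |y v|) ∈ realization K ∧ ∀ v w, 0 ≤ ε v w * (y v * y w) := Iff.rfl

/-- The projection of the double cover. -/
def doubleCoverProj (K : AbstractSimplicialComplex V) (ε : V → V → ℝ) (y : doubleCover K ε) :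
    realization K := ⟨fun v => |(y : V → ℝ) v|, y.2.1⟩

theorem continuous_doubleCoverProj : Continuous (doubleCoverProj K ε) :=
  Continuous.subtype_mk (continuous_pi fun v =>
    ((continuous_apply v).comp continuous_subtype_val).abs) _

/-- Signs over a point are chosen by comparison with one vertex `v` of its support; the cocycle
condition on the triangle `v, w, u` makes the signs at `w` and `u` compatible. -/
theorem surjective_doubleCoverProj [DecidableEq V] (hε : ∀ v w, ε v w = 1 ∨ ε v w = -1)
    (hc : ∀ a b c, ({a, b, c} : Finset V) ∈ K → ε a b * ε a c * ε b c = 1) :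
    Function.Surjective (doubleCoverProj K ε) := by
  rintro ⟨x, hx⟩
  obtain ⟨hx0, hx1, -⟩ := mem_realization.1 hx
  obtain ⟨v, -, hv⟩ := Finset.exists_ne_zero_of_sum_ne_zero (hx1.trans_ne one_ne_zero)
  have habs : (fun w => |ε v w * x w|) = x := by
    ext w
    rw [abs_mul, abs_of_nonneg (hx0 w)]
    rcases hε v w with h | h <;> simp [h]
  refine ⟨⟨fun w => ε v w * x w, mem_doubleCover.2 ⟨by rwa [habs], fun w u => ?_⟩⟩, Subtype.ext habs⟩
  by_cases hw : x w = 0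
  · simp [hw]
  by_cases hu : x u = 0
  · simp [hu]
  have h1 := hc v w u (face_of_ne_zero hx (by simp) (by
    simp only [Finset.mem_insert, Finset.mem_singleton]
    rintro z (rfl | rfl | rfl)
    exacts [hv, hw, hu]))
  have h2 : ε w u * (ε v w * x w * (ε v u * x u)) = (ε v w * ε v u * ε w u) * (x w * x u) := by ring
  rw [h2, h1, one_mul]
  exact mul_nonneg (hx0 w) (hx0 u)

/-- The sign constraints between one vertex of the support and all others determine every sign from
the sign at that vertex. Only a global change of sign remains. -/
theorem doubleCoverProj_eq_iff (hε : ∀ v w, ε v w = 1 ∨ ε v w = -1) {y z : doubleCover K ε} :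
    doubleCoverProj K ε y = doubleCoverProj K ε z ↔ y ∈ MulAction.orbit ℤˣ z := by
  constructor
  · intro h
    have habs : ∀ v, |(y : V → ℝ) v| = |(z : V → ℝ) v| := fun v =>
      congrFun (congrArg Subtype.val h) v
    obtain ⟨hy, hy'⟩ := mem_doubleCover.1 y.2
    obtain ⟨hz, hz'⟩ := mem_doubleCover.1 z.2
    obtain ⟨v, -, hv⟩ := Finset.exists_ne_zero_of_sum_ne_zero
      ((mem_realization.1 hy).2.1.trans_ne one_ne_zero)
    have hv' : (y : V → ℝ) v ≠ 0 := by simpa using hv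
    have key : ∀ u : ℝ, (u = 1 ∨ u = -1) → (y : V → ℝ) v = u * (z : V → ℝ) v →
        ∀ w, (y : V → ℝ) w = u * (z : V → ℝ) w := by
      intro u hu huv w
      have hu2 : u * u = 1 := by rcases hu with rfl | rfl <;> norm_num
      rcases abs_eq_abs.1 (habs w) with h1 | h1 <;> rcases hu with rfl | rfl
      · simpa using h1
      -- The relative signs at `v` and `w` differ, so the constraints for `y` and `z` give the same
      -- product opposite signs; it vanishes, and with it `z w`.
      · have h2 := hy' v w
        have h3 := hz' v w
        rw [huv, h1] at h2
        have h4 : ε v w * ((z : V → ℝ) v * (z : V → ℝ) w) = 0 := by linarith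
        have h5 : ε v w ≠ 0 := by rcases hε v w with h | h <;> simp [h]
        have h6 : (z : V → ℝ) v ≠ 0 := fun h => hv' (by rw [huv, h, mul_zero])
        have h7 : (z : V → ℝ) w = 0 := by simpa [h5, h6] using h4
        rw [h1, h7, mul_zero]
      · have h2 := hy' v w
        have h3 := hz' v w
        rw [huv, h1] at h2
        have h4 : ε v w * ((z : V → ℝ) v * (z : V → ℝ) w) = 0 := by linarith
        have h5 : ε v w ≠ 0 := by rcases hε v w with h | h <;> simp [h]
        have h6 : (z : V → ℝ) v ≠ 0 := fun h => hv' (by rw [huv, h, mul_zero])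
        have h7 : (z : V → ℝ) w = 0 := by simpa [h5, h6] using h4
        rw [h1, h7]
        simp
      · rw [h1]; ring
    rcases abs_eq_abs.1 (habs v) with h1 | h1
    · refine ⟨1, Subtype.ext (funext fun w => ?_)⟩
      simp [key 1 (Or.inl rfl) (by rw [h1, one_mul]) w]
    · refine ⟨-1, Subtype.ext (funext fun w => ?_)⟩
      simp [key (-1) (Or.inr rfl) (by rw [h1]; ring) w]
  · rintro ⟨u, rfl⟩
    refine Subtype.ext (funext fun v => ?_)
    rcases Int.units_eq_one_or u with rfl | rfl <;> simp [doubleCoverProj]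

variable [DecidableEq V]

/-- The projection from a compact space is closed, hence a quotient map, and its fibres are the
orbits of the free action of the finite group of signs. -/
theorem isCoveringMap_doubleCoverProj [CompactSpace (realization K)]
    (hε : ∀ v w, ε v w = 1 ∨ ε v w = -1)
    (hc : ∀ a b c, ({a, b, c} : Finset V) ∈ K → ε a b * ε a c * ε b c = 1) :
    IsCoveringMap (doubleCoverProj K ε) := by
  have hX : IsClosed (realization K) := (isCompact_iff_compactSpace.2 ‹_›).isClosed
  have hclosed : IsClosed (doubleCover K ε : Set (V → ℝ)) := by
    have : (doubleCover K ε : Set (V → ℝ)) = (fun y : V → ℝ => fun v => |y v|) ⁻¹' realization K ∩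
        ⋂ v, ⋂ w, {y | 0 ≤ ε v w * (y v * y w)} := by
      ext y
      simp [mem_doubleCover]
    rw [this]
    refine (hX.preimage (by fun_prop)).inter ?_
    exact isClosed_iInter fun v => isClosed_iInter fun w => isClosed_le (by fun_prop) (by fun_prop)
  have hcompact : CompactSpace (doubleCover K ε) := by
    refine isCompact_iff_compactSpace.1 (Metric.isCompact_of_isClosed_isBounded hclosed ?_)
    refine (Metric.isBounded_closedBall (x := (0 : V → ℝ)) (r := 1)).subset fun y hy => ?_
    obtain ⟨h0, h1, -⟩ := mem_realization.1 (mem_doubleCover.1 hy).1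
    rw [mem_closedBall_zero_iff, pi_norm_le_iff_of_nonneg zero_le_one]
    intro v
    rw [Real.norm_eq_abs, ← h1]
    exact Finset.single_le_sum (fun w _ => h0 w) (Finset.mem_univ v)
  have hquot : IsQuotientMap (doubleCoverProj K ε) :=
    continuous_doubleCoverProj.isClosedMap.isQuotientMap continuous_doubleCoverProj
      (surjective_doubleCoverProj hε hc)
  have : ContinuousConstSMul ℤˣ (doubleCover K ε) := ⟨fun u => by
    rcases Int.units_eq_one_or u with rfl | rfl
    · simp only [one_smul]
      exact continuous_id
    · refine Continuous.subtype_mk (f := fun y : doubleCover K ε => (-1 : ℤˣ) • (y : V → ℝ)) ?_ _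
      simp only [Units.neg_smul, one_smul]
      exact continuous_subtype_val.neg⟩
  have : IsCancelSMul ℤˣ (doubleCover K ε) := by
    rw [isCancelSMul_iff_eq_one_of_smul_eq]
    intro u y hy
    rcases Int.units_eq_one_or u with rfl | rfl
    · rfl
    · exfalso
      obtain ⟨v, -, hv⟩ := Finset.exists_ne_zero_of_sum_ne_zero
        ((mem_realization.1 (mem_doubleCover.1 y.2).1).2.1.trans_ne one_ne_zero)
      have h1 := congrFun (congrArg Subtype.val hy) v
      simp at h1 hv
      exact hv (by linarith)
  exact (hquot.isQuotientCoveringMap_of_properlyDiscontinuousSMul (G := ℤˣ)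
    (doubleCoverProj_eq_iff hε)).isCoveringMap

theorem edge_mem_realization {a b : V} (h : ({a, b} : Finset V) ∈ K) {t : ℝ} (ht : 0 ≤ t)
    (ht' : t ≤ 1) : (Pi.single a (1 - t) + Pi.single b t : V → ℝ) ∈ realization K := by
  refine mem_realization.2 ⟨fun v => ?_, ?_, _, h, fun v hv => ?_⟩
  · simp only [Pi.add_apply, Pi.single_apply]
    split_ifs <;> linarith
  · simp [Finset.sum_add_distrib]
  · by_contra hcon
    simp only [Finset.mem_insert, Finset.mem_singleton, not_or] at hcon
    simp [hcon.1, hcon.2] at hv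

omit [Fintype V] [DecidableEq V] in
theorem sign_eq_mul {e s t p q : ℝ} (he : e = 1 ∨ e = -1) (hs : s = 1 ∨ s = -1)
    (ht : t = 1 ∨ t = -1) (hp : 0 < s * p) (hq : 0 < t * q) (h : 0 ≤ e * (p * q)) : e = s * t := by
  have hpq := mul_pos hp hq
  rcases he with rfl | rfl <;> rcases hs with rfl | rfl <;> rcases ht with rfl | rfl <;>
    first
    | (exfalso; linarith)
    | norm_num

/-- On a triangulated sphere every cocycle with values in `±1` is a coboundary. -/
theorem IsSphereTriangulation.coboundary (hK : IsSphereTriangulation K)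
    (hε : ∀ v w, ε v w = 1 ∨ ε v w = -1)
    (hc : ∀ a b c, ({a, b, c} : Finset V) ∈ K → ε a b * ε a c * ε b c = 1) :
    ∃ s : V → ℝ, (∀ v, s v = 1 ∨ s v = -1) ∧
      ∀ a b, a ≠ b → ({a, b} : Finset V) ∈ K → ε a b = s a * s b := by
  have : CompactSpace (realization K) := hK.some.symm.compactSpace
  -- A section lifts each vertex `v` to a signed vertex, whose sign is the required `s v`.
  obtain ⟨σ, hσ, hpσ⟩ := exists_section_of_homeomorph hK.some
    (isCoveringMap_doubleCoverProj hε hc) (surjective_doubleCoverProj hε hc)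
  have habs : ∀ x v, |(σ x : V → ℝ) v| = (x : V → ℝ) v := fun x v =>
    congrFun (congrArg Subtype.val (hpσ x)) v
  let e : V → realization K := fun v => ⟨Pi.single v 1, single_mem_realization v⟩
  have hs : ∀ v, (σ (e v) : V → ℝ) v = 1 ∨ (σ (e v) : V → ℝ) v = -1 := fun v => by
    have := habs (e v) v
    simpa [e, abs_eq] using this
  refine ⟨fun v => (σ (e v) : V → ℝ) v, hs, fun a b hab h => ?_⟩
  have hmid := edge_mem_realization h (t := 1 / 2) (by norm_num) (by norm_num)
  -- From `a` to the midpoint of `ab` the coordinate at `a` is nonzero, so in the lift it keeps its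
  -- sign. The same holds from `b`, and at the midpoint the constraint of the covering compares the
  -- two signs with `ε a b`. The midpoint is a variable `m` because its two descriptions, from `a`
  -- and from `b`, are only propositionally equal.
  have key : ∀ a b, a ≠ b → ({a, b} : Finset V) ∈ K →
      ∀ m : realization K, (m : V → ℝ) = Pi.single a (1 - 1 / 2) + Pi.single b (1 / 2) →
      0 < (σ (e a) : V → ℝ) a * (σ m : V → ℝ) a := by
    intro a b hab h m hm
    let γ : Set.Icc (0 : ℝ) (1 / 2) → realization K := fun t =>
      ⟨_, edge_mem_realization h (t := t) t.2.1 (t.2.2.trans (by norm_num))⟩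
    have hγ : Continuous γ := by
      refine Continuous.subtype_mk (continuous_pi fun u => ?_) _
      simp only [Pi.add_apply, Pi.single_apply]
      refine Continuous.add ?_ ?_ <;> split_ifs <;> fun_prop
    have h0 : γ ⟨0, by norm_num⟩ = e a := Subtype.ext (by simp [γ, e])
    have h1 : γ ⟨1 / 2, by norm_num⟩ = m := Subtype.ext hm.symm
    have hf : Continuous fun t => (σ (γ t) : V → ℝ) a :=
      (continuous_apply a).comp (continuous_subtype_val.comp (hσ.comp hγ))
    have hne : ∀ t, (σ (γ t) : V → ℝ) a ≠ 0 := by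
      intro t ht
      have := habs (γ t) a
      rw [ht] at this
      simp [γ, hab] at this
      linarith [t.2.2]
    by_contra! hcon
    rw [← h0, ← h1] at hcon
    have : PreconnectedSpace (Set.Icc (0 : ℝ) (1 / 2)) :=
      isPreconnected_iff_preconnectedSpace.1 isPreconnected_Icc
    have hz : (0 : ℝ) ∈ Set.range fun t => (σ (γ t) : V → ℝ) a := by
      rcases mul_nonpos_iff.1 hcon with ⟨h2, h3⟩ | ⟨h2, h3⟩
      · exact mem_range_of_exists_le_of_exists_ge hf ⟨_, h3⟩ ⟨_, h2⟩
      · exact mem_range_of_exists_le_of_exists_ge hf ⟨_, h2⟩ ⟨_, h3⟩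
    obtain ⟨t, ht⟩ := hz
    exact hne t ht
  have k1 := key a b hab h ⟨_, hmid⟩ rfl
  have k2 := key b a hab.symm (by rwa [Finset.pair_comm]) ⟨_, hmid⟩ (by
    ext v
    simp only [Pi.add_apply]
    norm_num [add_comm])
  have k3 := (mem_doubleCover.1 (σ ⟨_, hmid⟩).2).2 a b
  exact sign_eq_mul (hε a b) (hs a) (hs b) k1 k2 k3

end DoubleCover

end SphereTri

/-! ### Combinatorial spheres and the Euler inequality. -/

namespace SphereTri

/-- The combinatorial properties of the set of triangles of a triangulated sphere that determine
the triangulations with few vertices. -/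
structure CombSphere {V : Type*} [Fintype V] [DecidableEq V] (T : Finset (Finset V)) : Prop where
  card_eq : ∀ t ∈ T, t.card = 3
  edge : ∀ a b c, {a, b, c} ∈ T → ∃ d, d ≠ c ∧ {a, b, d} ∈ T ∧ ∀ e, {a, b, e} ∈ T → e = c ∨ e = d
  connected : ∀ S ⊆ T, S.Nonempty →
    (∀ a b c d, {a, b, c} ∈ S → {a, b, d} ∈ T → {a, b, d} ∈ S) → S = T
  cover : ∀ v, ∃ t ∈ T, v ∈ t
  card_le : T.card + 4 ≤ 2 * Fintype.card V

section

variable {V : Type*} [Fintype V] [DecidableEq V] {K : AbstractSimplicialComplex V}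

omit [Fintype V] in
theorem ne_of_card_eq_three {a b c : V} (h : ({a, b, c} : Finset V).card = 3) :
    a ≠ b ∧ a ≠ c ∧ b ≠ c := by
  refine ⟨?_, ?_, ?_⟩ <;> rintro rfl
  · have := Finset.card_le_two (a := a) (b := c)
    simp at h; omega
  · have := Finset.card_le_two (a := a) (b := b)
    rw [show ({a, b, a} : Finset V) = {a, b} by ext; simp; tauto] at h; omega
  · have := Finset.card_le_two (a := a) (b := b)
    simp at h; omega

open Classical in
/-- The triangles of a complex as a finset. -/
noncomputable def triangleFinset (K : AbstractSimplicialComplex V) : Finset (Finset V) :=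
  {s | s ∈ K ∧ s.card = 3}

open Classical in
/-- The edges of a complex as a finset. -/
noncomputable def edgeFinset (K : AbstractSimplicialComplex V) : Finset (Finset V) :=
  {s | s ∈ K ∧ s.card = 2}

omit [DecidableEq V] in
theorem mem_triangleFinset {s : Finset V} : s ∈ triangleFinset K ↔ s ∈ K ∧ s.card = 3 := by
  simp [triangleFinset]

omit [DecidableEq V] in
theorem mem_edgeFinset {s : Finset V} : s ∈ edgeFinset K ↔ s ∈ K ∧ s.card = 2 := by
  simp [edgeFinset]

theorem IsSphereTriangulation.exists_triangleFinset_edge (hK : IsSphereTriangulation K) {a b c : V}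
    (h : {a, b, c} ∈ triangleFinset K) : ∃ d, d ≠ c ∧ {a, b, d} ∈ triangleFinset K ∧
      ∀ e, {a, b, e} ∈ triangleFinset K → e = c ∨ e = d := by
  rw [mem_triangleFinset] at h
  obtain ⟨hab, hac, hbc⟩ := ne_of_card_eq_three h.2
  obtain ⟨d, hda, hdb, hdc, hd⟩ := hK.exists_ne_triangle hab hac hbc h.1
  refine ⟨d, hdc, mem_triangleFinset.2 ⟨hd, Finset.card_eq_three.2
    ⟨a, b, d, hab, hda.symm, hdb.symm, rfl⟩⟩, fun e he => ?_⟩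
  rw [mem_triangleFinset] at he
  obtain ⟨-, hae, hbe⟩ := ne_of_card_eq_three he.2
  exact hK.triangle_eq_or_eq hab hac hda.symm hae hbc hdb.symm hbe h.1 hd he.1 hdc.symm

theorem IsSphereTriangulation.exists_mem_triangleFinset (hK : IsSphereTriangulation K)
    {s : Finset V} (hs : s ∈ K) : ∃ t ∈ triangleFinset K, s ⊆ t := by
  obtain ⟨t, ht, hst, ht3⟩ := hK.exists_triangle hs
  exact ⟨t, mem_triangleFinset.2 ⟨ht, ht3⟩, hst⟩

omit [Fintype V] in
theorem exists_eq_insert {t : Finset V} (ht : t.card = 3) {v : V} (hv : v ∈ t) :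
    ∃ x y, v ≠ x ∧ v ≠ y ∧ x ≠ y ∧ t = {v, x, y} := by
  have h1 : (t.erase v).card = 2 := by rw [Finset.card_erase_of_mem hv, ht]
  obtain ⟨x, y, hxy, hxy'⟩ := Finset.card_eq_two.1 h1
  have hx : x ∈ t.erase v := by simp [hxy']
  have hy : y ∈ t.erase v := by simp [hxy']
  exact ⟨x, y, (Finset.ne_of_mem_erase hx).symm, (Finset.ne_of_mem_erase hy).symm, hxy, by
    rw [← hxy', Finset.insert_erase hv]⟩

/-- Connected links let `S` spread through all triangles at a vertex, and connectedness of the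
1-skeleton carries it from each vertex to its neighbours. -/
theorem IsSphereTriangulation.strongly_connected (hK : IsSphereTriangulation K)
    {S : Finset (Finset V)} (hS : S ⊆ triangleFinset K) (hne : S.Nonempty)
    (h : ∀ a b c d, {a, b, c} ∈ S → {a, b, d} ∈ triangleFinset K → {a, b, d} ∈ S) :
    S = triangleFinset K := by
  -- all triangles at a vertex of `S` belong to `S`
  have hstar : ∀ v, (∃ t ∈ S, v ∈ t) → ∀ t ∈ triangleFinset K, v ∈ t → t ∈ S := by
    rintro v ⟨s, hs, hvs⟩ t ht hvt
    let A : Set V := {a | ∃ b, {v, a, b} ∈ S}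
    obtain ⟨x, y, hvx, hvy, hxy, rfl⟩ := exists_eq_insert (mem_triangleFinset.1 (hS hs)).2 hvs
    obtain ⟨x', y', hvx', hvy', hxy', rfl⟩ := exists_eq_insert (mem_triangleFinset.1 ht).2 hvt
    have hA : x' ∈ A := by
      refine hK.link_connected v A ⟨x, ⟨y, hs⟩, hvx.symm, ?_⟩ ?_ x' hvx'.symm ?_
      · exact face_mono (mem_triangleFinset.1 (hS hs)).1 (by
          intro w; simp only [Finset.mem_insert, Finset.mem_singleton]; tauto) (by simp)
      · rintro a ⟨c, hc⟩ b hav hbv hab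
        by_cases hab' : a = b
        · exact hab' ▸ ⟨c, hc⟩
        · have := h v a c b hc (mem_triangleFinset.2 ⟨hab, Finset.card_eq_three.2
            ⟨v, a, b, hav.symm, hbv.symm, hab', rfl⟩⟩)
          exact ⟨a, by rwa [Finset.pair_comm]⟩
      · exact face_mono (mem_triangleFinset.1 ht).1 (by
          intro w; simp only [Finset.mem_insert, Finset.mem_singleton]; tauto) (by simp)
    obtain ⟨c, hc⟩ := hA
    exact h v x' c y' hc ht
  obtain ⟨s, hs⟩ := hne
  obtain ⟨v₀, hv₀⟩ := face_nonempty (mem_triangleFinset.1 (hS hs)).1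
  have hall : ∀ v, ∃ t ∈ S, v ∈ t := fun v => by
    refine hK.connected {v | ∃ t ∈ S, v ∈ t} ⟨v₀, s, hs, hv₀⟩ ?_ v
    intro a ha b hab hab'
    obtain ⟨t, ht, hat⟩ := hK.exists_mem_triangleFinset hab'
    exact ⟨t, hstar a ha t ht (hat (by simp)), hat (by simp)⟩
  refine Finset.Subset.antisymm hS fun t ht => ?_
  obtain ⟨v, hv⟩ := face_nonempty (mem_triangleFinset.1 ht).1
  exact hstar v (hall v) t ht hv

theorem IsSphereTriangulation.card_filter_triangleFinset (hK : IsSphereTriangulation K)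
    {e : Finset V} (he : e ∈ edgeFinset K) : {t ∈ triangleFinset K | e ⊆ t}.card = 2 := by
  rw [mem_edgeFinset] at he
  obtain ⟨a, b, hab, rfl⟩ := Finset.card_eq_two.1 he.2
  have key : ∀ t ∈ triangleFinset K, {a, b} ⊆ t → ∃ c, t = {a, b, c} := by
    intro t ht hs
    obtain ⟨x, y, h1, h2, h3, rfl⟩ := exists_eq_insert (mem_triangleFinset.1 ht).2 (hs (by simp : a ∈ _))
    have hb : b ∈ ({a, x, y} : Finset V) := hs (by simp)
    simp only [Finset.mem_insert, Finset.mem_singleton] at hb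
    rcases hb with rfl | rfl | rfl
    · exact (hab rfl).elim
    · exact ⟨y, rfl⟩
    · exact ⟨x, by rw [Finset.pair_comm]⟩
  obtain ⟨t, ht, hst⟩ := hK.exists_mem_triangleFinset he.1
  obtain ⟨c, rfl⟩ := key t ht hst
  obtain ⟨d, hdc, hd, hcd⟩ := hK.exists_triangleFinset_edge ht
  have hc' := ne_of_card_eq_three (mem_triangleFinset.1 ht).2
  rw [Finset.card_eq_two]
  refine ⟨{a, b, c}, {a, b, d}, fun h => ?_, ?_⟩
  · have : c ∈ ({a, b, d} : Finset V) := h ▸ (by simp)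
    simp only [Finset.mem_insert, Finset.mem_singleton] at this
    rcases this with h | h | h
    · exact hc'.2.1 h.symm
    · exact hc'.2.2 h.symm
    · exact hdc h.symm
  · ext u
    simp only [Finset.mem_filter, Finset.mem_insert, Finset.mem_singleton]
    constructor
    · rintro ⟨hu, hu'⟩
      obtain ⟨e, rfl⟩ := key u hu hu'
      rcases hcd e hu with rfl | rfl <;> simp
    · rintro (rfl | rfl)
      · exact ⟨ht, hst⟩
      · exact ⟨hd, by intro w; simp only [Finset.mem_insert, Finset.mem_singleton]; tauto⟩

theorem edgeFinset_filter_subset {t : Finset V} (ht : t ∈ triangleFinset K) :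
    {e ∈ edgeFinset K | e ⊆ t} = t.powersetCard 2 := by
  ext e
  rw [Finset.mem_filter, mem_edgeFinset, Finset.mem_powersetCard]
  constructor
  · exact fun h => ⟨h.2, h.1.2⟩
  · exact fun h => ⟨⟨face_mono (mem_triangleFinset.1 ht).1 h.1
      (Finset.card_pos.1 (by omega)), h.2⟩, h.1⟩

/-- Double counting of incidences: two triangles at each edge, three edges in each triangle. -/
theorem IsSphereTriangulation.two_mul_card_edgeFinset (hK : IsSphereTriangulation K) :
    2 * (edgeFinset K).card = 3 * (triangleFinset K).card := by
  have h : ∑ e ∈ edgeFinset K, {t ∈ triangleFinset K | e ⊆ t}.card =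
      ∑ t ∈ triangleFinset K, {e ∈ edgeFinset K | e ⊆ t}.card := by
    have h0 := Finset.sum_card_bipartiteAbove_eq_sum_card_bipartiteBelow (s := edgeFinset K)
      (t := triangleFinset K) (fun e t => e ⊆ t)
    simp only [Finset.bipartiteAbove, Finset.bipartiteBelow] at h0
    exact h0
  have h3 : ∀ t ∈ triangleFinset K, {e ∈ edgeFinset K | e ⊆ t}.card = 3 := fun t ht => by
    rw [edgeFinset_filter_subset ht, Finset.card_powersetCard, (mem_triangleFinset.1 ht).2]
    rfl
  rw [Finset.sum_congr rfl fun e he => hK.card_filter_triangleFinset he,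
    Finset.sum_congr rfl h3, Finset.sum_const, Finset.sum_const, smul_eq_mul, smul_eq_mul] at h
  rw [mul_comm, h, mul_comm]

omit [Fintype V] in
theorem powersetCard_two_triple {a b c : V} (hab : a ≠ b) (hac : a ≠ c) (hbc : b ≠ c) :
    ({a, b, c} : Finset V).powersetCard 2 = {{a, b}, {a, c}, {b, c}} := by
  symm
  apply Finset.eq_of_subset_of_card_le
  · intro s hs
    simp only [Finset.mem_insert, Finset.mem_singleton] at hs
    rw [Finset.mem_powersetCard]
    rcases hs with rfl | rfl | rfl
    · exact ⟨by intro w; simp only [Finset.mem_insert, Finset.mem_singleton]; tauto,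
        Finset.card_pair hab⟩
    · exact ⟨by intro w; simp only [Finset.mem_insert, Finset.mem_singleton]; tauto,
        Finset.card_pair hac⟩
    · exact ⟨by intro w; simp only [Finset.mem_insert, Finset.mem_singleton]; tauto,
        Finset.card_pair hbc⟩
  · rw [Finset.card_powersetCard, Finset.card_eq_three.2 ⟨a, b, c, hab, hac, hbc, rfl⟩]
    refine le_of_eq (Eq.symm (Finset.card_eq_three.2 ⟨_, _, _, ?_, ?_, ?_, rfl⟩))
    · intro h
      have : b ∈ ({a, c} : Finset V) := h ▸ (by simp)
      simp [hab.symm, hbc] at this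
    · intro h
      have : a ∈ ({b, c} : Finset V) := h ▸ (by simp)
      simp [hab, hac] at this
    · intro h
      have : a ∈ ({b, c} : Finset V) := h ▸ (by simp)
      simp [hab, hac] at this

/-- The sign of a residue modulo 2. -/
noncomputable def zmodSign (u : ZMod 2) : ℝ := if u = 0 then 1 else -1

theorem zmodSign_add (u v : ZMod 2) : zmodSign (u + v) = zmodSign u * zmodSign v := by
  have h0 : (1 : ZMod 2) ≠ 0 := by decide
  have h1 : (1 + 1 : ZMod 2) = 0 := by decide
  have h2 : ∀ w : ZMod 2, w = 0 ∨ w = 1 := by decide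
  rcases h2 u with rfl | rfl <;> rcases h2 v with rfl | rfl <;> simp [zmodSign, h0, h1]

theorem zmodSign_injective : Function.Injective zmodSign := by
  have h0 : (1 : ZMod 2) ≠ 0 := by decide
  have h2 : ∀ w : ZMod 2, w = 0 ∨ w = 1 := by decide
  intro u v h
  rcases h2 u with rfl | rfl <;> rcases h2 v with rfl | rfl <;>
    first
    | rfl
    | norm_num [zmodSign, h0] at h

theorem zmodSign_eq (u : ZMod 2) : zmodSign u = 1 ∨ zmodSign u = -1 := by
  unfold zmodSign; split_ifs <;> simp

/-- A cocycle modulo 2 on a triangulated sphere is a coboundary. -/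
theorem IsSphereTriangulation.exists_zmod_coboundary (hK : IsSphereTriangulation K)
    (X : Finset V → ZMod 2) (hX : ∀ s ∉ edgeFinset K, X s = 0)
    (hc : ∀ t ∈ triangleFinset K, ∑ e ∈ t.powersetCard 2, X e = 0) :
    ∃ y : V → ZMod 2, ∀ e ∈ edgeFinset K, X e = ∑ v ∈ e, y v := by
  have hX1 : ∀ a, X {a} = 0 := fun a => hX _ fun h => by simpa using (mem_edgeFinset.1 h).2
  have h2 : ∀ u : ZMod 2, u + u = 0 := by decide
  obtain ⟨s, hs, hse⟩ := hK.coboundary (ε := fun a b => zmodSign (X {a, b}))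
    (fun v w => zmodSign_eq _) (fun a b c habc => by
      rw [← zmodSign_add, ← zmodSign_add]
      suffices X {a, b} + X {a, c} + X {b, c} = 0 by rw [this]; simp [zmodSign]
      -- The cocycle condition is also imposed on degenerate triples. There `X` vanishes on
      -- singletons and the two remaining terms are equal.
      by_cases hab : a = b
      · subst hab; simp [hX1, h2]
      by_cases hac : a = c
      · subst hac; simp [hX1, Finset.pair_comm, h2]
      by_cases hbc : b = c
      · subst hbc; simp [hX1, h2]
      have := hc _ (mem_triangleFinset.2 ⟨habc, Finset.card_eq_three.2 ⟨a, b, c, hab, hac, hbc, rfl⟩⟩)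
      rw [powersetCard_two_triple hab hac hbc, Finset.sum_insert, Finset.sum_pair] at this
      · rw [add_assoc]; exact this
      · intro h
        have : a ∈ ({b, c} : Finset V) := h ▸ (by simp)
        simp [hab, hac] at this
      · simp only [Finset.mem_insert, Finset.mem_singleton, not_or]
        constructor
        · intro h
          have : b ∈ ({a, c} : Finset V) := h ▸ (by simp)
          simp [Ne.symm hab, hbc] at this
        · intro h
          have : a ∈ ({b, c} : Finset V) := h ▸ (by simp)
          simp [hab, hac] at this)
  have hy : ∀ v, ∃ u, zmodSign u = s v := fun v => by
    rcases hs v with h | h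
    · exact ⟨0, by simp [zmodSign, h]⟩
    · exact ⟨1, by simp [zmodSign, h]⟩
  choose y hy using hy
  refine ⟨y, fun e he => ?_⟩
  rw [mem_edgeFinset] at he
  obtain ⟨a, b, hab, rfl⟩ := Finset.card_eq_two.1 he.2
  rw [Finset.sum_pair hab]
  apply zmodSign_injective
  rw [zmodSign_add, hy, hy]
  exact hse a b hab he.1

/-- The Euler inequality. -/
theorem IsSphereTriangulation.card_triangleFinset_le [Nonempty V] (hK : IsSphereTriangulation K) :
    (triangleFinset K).card + 4 ≤ 2 * Fintype.card V := by
  have : Fact (Nat.Prime 2) := ⟨Nat.prime_two⟩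
  let E := {e // e ∈ edgeFinset K}
  let T := {t // t ∈ triangleFinset K}
  -- `N` and `D` are the coboundary matrices modulo 2. Each edge has two ends, so `D` kills the
  -- all-ones vector and has rank at most `|V| - 1`; each edge is in two triangles, so the transpose
  -- of `N` kills it too and `N` has rank at most `|T| - 1`. Vanishing cohomology puts the kernel of
  -- `N` into the range of `D`.
  let N : Matrix T E (ZMod 2) := Matrix.of fun t e => if e.1 ⊆ t.1 then 1 else 0
  let D : Matrix E V (ZMod 2) := Matrix.of fun e v => if v ∈ e.1 then 1 else 0
  have hNx : ∀ x t, N.mulVec x t = ∑ e : E, if e.1 ⊆ t.1 then x e else 0 := fun x t => by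
    simp [N, Matrix.mulVec, dotProduct]
  have hNw : ∀ w e, N.transpose.mulVec w e = ∑ t : T, if e.1 ⊆ t.1 then w t else 0 := fun w e => by
    simp [N, Matrix.mulVec, dotProduct]
  have hDy : ∀ y e, D.mulVec y e = ∑ v ∈ e.1, y v := fun y e => by
    simp [D, Matrix.mulVec, dotProduct]
  have h2 : ((2 : ℕ) : ZMod 2) = 0 := by rfl
  have hE : Fintype.card E = (edgeFinset K).card := Fintype.card_coe _
  have hT : Fintype.card T = (triangleFinset K).card := Fintype.card_coe _
  have hone : ∀ {ι κ : Type _} [Fintype ι] [Fintype κ] [Nonempty ι] (M : Matrix κ ι (ZMod 2)),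
      M.mulVec 1 = 0 → M.rank + 1 ≤ Fintype.card ι := by
    intro ι κ _ _ _ M hM
    have h1 := LinearMap.finrank_range_add_finrank_ker M.mulVecLin
    have h3 : 1 ≤ Module.finrank (ZMod 2) (LinearMap.ker M.mulVecLin) := by
      rw [Submodule.one_le_finrank_iff]
      intro hbot
      have : (1 : ι → ZMod 2) ∈ LinearMap.ker M.mulVecLin := by simpa using hM
      rw [hbot, Submodule.mem_bot] at this
      exact one_ne_zero this
    rw [Module.finrank_fintype_fun_eq_card] at h1
    unfold Matrix.rank
    omega
  have hD : D.rank + 1 ≤ Fintype.card V := hone D (by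
    ext e
    rw [hDy]
    simp only [Pi.one_apply, Finset.sum_const, nsmul_eq_mul, mul_one, Pi.zero_apply]
    rw [(mem_edgeFinset.1 e.2).2, h2])
  obtain ⟨v⟩ := ‹Nonempty V›
  have : Nonempty T := by
    obtain ⟨t, ht, -⟩ := hK.exists_mem_triangleFinset (K.singleton_mem v)
    exact ⟨⟨t, ht⟩⟩
  have hN : N.rank + 1 ≤ Fintype.card T := by
    rw [← Matrix.rank_transpose]
    refine hone _ ?_
    ext e
    rw [hNw]
    simp only [Pi.one_apply, Finset.sum_boole, Pi.zero_apply]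
    have : ({t : T | e.1 ⊆ t.1} : Finset T).card = 2 := by
      rw [← hK.card_filter_triangleFinset e.2, ← Finset.card_map (Function.Embedding.subtype _)]
      congr 1
      ext t
      simp [T, and_comm]
    rw [this, h2]
  have hker : LinearMap.ker N.mulVecLin ≤ LinearMap.range D.mulVecLin := by
    intro x hx
    rw [LinearMap.mem_ker, Matrix.mulVecLin_apply] at hx
    let X : Finset V → ZMod 2 := fun s => if h : s ∈ edgeFinset K then x ⟨s, h⟩ else 0
    have hXe : ∀ e : E, X e.1 = x e := fun e => dif_pos e.2
    obtain ⟨y, hy⟩ := hK.exists_zmod_coboundary X (fun s hs => dif_neg hs) fun t ht => by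
      rw [← edgeFinset_filter_subset ht, Finset.sum_filter, ← Finset.sum_coe_sort]
      have := congrFun hx ⟨t, ht⟩
      rw [hNx] at this
      refine Eq.trans ?_ this
      exact Finset.sum_congr rfl fun e _ => by rw [hXe]
    refine ⟨y, funext fun e => ?_⟩
    rw [← hXe, hy e.1 e.2, Matrix.mulVecLin_apply, hDy]
  have h1 := LinearMap.finrank_range_add_finrank_ker N.mulVecLin
  rw [Module.finrank_fintype_fun_eq_card] at h1
  have h3 := Submodule.finrank_mono hker
  have h4 := hK.two_mul_card_edgeFinset
  unfold Matrix.rank at hN hD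
  -- `|E| = rank N + dim ker N ≤ (|T| - 1) + (|V| - 1)`, combined with `2 |E| = 3 |T|`.
  omega

omit [DecidableEq V] in
theorem IsSphereTriangulation.nonempty (hK : IsSphereTriangulation K) : Nonempty V := by
  obtain ⟨v, hv⟩ : (Metric.sphere (0 : EuclideanSpace ℝ (Fin 3)) 1).Nonempty :=
    NormedSpace.sphere_nonempty.2 zero_le_one
  by_contra h
  have h1 := (mem_realization.1 (hK.some.symm ⟨v, hv⟩).2).2.1
  rw [not_nonempty_iff] at h
  simp at h1

theorem IsSphereTriangulation.combSphere (hK : IsSphereTriangulation K) :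
    CombSphere (triangleFinset K) where
  card_eq t ht := (mem_triangleFinset.1 ht).2
  edge _ _ _ h := hK.exists_triangleFinset_edge h
  connected _ hS hne h := hK.strongly_connected hS hne h
  cover v := by
    obtain ⟨t, ht, hvt⟩ := hK.exists_mem_triangleFinset (K.singleton_mem v)
    exact ⟨t, ht, hvt (by simp)⟩
  card_le := by
    have := hK.nonempty
    exact hK.card_triangleFinset_le

theorem IsSphereTriangulation.mem_iff (hK : IsSphereTriangulation K) {s : Finset V} :
    s ∈ K ↔ s.Nonempty ∧ ∃ t ∈ triangleFinset K, s ⊆ t := by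
  constructor
  · exact fun hs => ⟨face_nonempty hs, hK.exists_mem_triangleFinset hs⟩
  · rintro ⟨hs, t, ht, hst⟩
    exact face_mono (mem_triangleFinset.1 ht).1 hst hs

end

end SphereTri

/-! ### The exhaustive search and its soundness. -/

namespace SphereTri

section Search

/-- The vertex of the triangle `t` opposite to its edge `ab`, if there is one. -/
def third (a b : ℕ) (t : ℕ × ℕ × ℕ) : Option ℕ :=
  bif Nat.beq t.1 a then
    bif Nat.beq t.2.1 b then some t.2.2 else bif Nat.beq t.2.2 b then some t.2.1 else none
  else bif Nat.beq t.2.1 a then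
    bif Nat.beq t.1 b then some t.2.2 else bif Nat.beq t.2.2 b then some t.1 else none
  else bif Nat.beq t.2.2 a then
    bif Nat.beq t.1 b then some t.2.1 else bif Nat.beq t.2.1 b then some t.1 else none
  else none

/-- The vertices opposite to the edge `ab` in the triangles of `S`. -/
def opp (a b : ℕ) (S : List (ℕ × ℕ × ℕ)) : List ℕ := S.filterMap (third a b)

/-- The edge `ab` is in two triangles of `S`, none of them being `abc`. -/
def full (a b c : ℕ) (S : List (ℕ × ℕ × ℕ)) : Bool :=
  match opp a b S with
  | x :: y :: _ => !Nat.beq x y && !Nat.beq x c && !Nat.beq y c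
  | _ => false

/-- The edge `ab` is in two triangles of `S`. -/
def twice (a b : ℕ) (S : List (ℕ × ℕ × ℕ)) : Bool :=
  match opp a b S with
  | x :: y :: _ => !Nat.beq x y
  | _ => false

/-- Every edge of `S` is in two triangles of `S`. -/
def closed (S : List (ℕ × ℕ × ℕ)) : Bool :=
  S.all fun t => twice t.1 t.2.1 S && twice t.1 t.2.2 S && twice t.2.1 t.2.2 S

/-- The `j`-th octal digit of `c`. -/
def digit (c j : ℕ) : ℕ := Nat.land (Nat.shiftRight c (3 * j)) 7

/-- The octal digits of `c` describe an isomorphism from a member of the list `G` to `S`; the digit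
after the first eight is the position in the list. -/
def isoCheck (n : ℕ) (G : List (List (ℕ × ℕ × ℕ))) (c : ℕ) (S : List (ℕ × ℕ × ℕ)) : Bool :=
  match G[Nat.shiftRight c 24]? with
  | none => false
  | some L =>
    ((List.range n).all fun i => Nat.blt (digit c i) n &&
      (List.range i).all fun j => !Nat.beq (digit c i) (digit c j)) &&
    L.all fun t => (opp (digit c t.1) (digit c t.2.1) S).any (Nat.beq (digit c t.2.2))

/-- Apply a partial function that threads a state for all members of a list. -/
def foldOption {α β : Type*} (f : α → β → Option β) : List α → β → Option β
  | [], s => some s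
  | a :: l, s =>
    match f a s with
    | none => none
    | some s' => foldOption f l s'

/-- Search for all ways to complete the set `S` of triangles with the vertices `0, …, k - 1` to a
triangulation with `n` vertices and at most `F` triangles: `O` contains the edges whose second
triangle may be missing, each with the third vertex of a triangle in `S`. The list of numbers
contains the isomorphisms of the complete triangulations with members of `G`. -/
def search (n F : ℕ) (G : List (List (ℕ × ℕ × ℕ))) :
    ℕ → List (ℕ × ℕ × ℕ) → List (ℕ × ℕ × ℕ) → ℕ → List ℕ → Option (List ℕ)
  | 0, _, _, _, _ => none
  | _ + 1, S, [], k, cs =>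
    bif Nat.blt k n && closed S then some cs else
    match cs with
    | [] => none
    | c :: cs => bif isoCheck n G c S then some cs else none
  | fuel + 1, S, (a, b, c) :: O, k, cs =>
    bif (opp a b S).any fun x => !Nat.beq x c then search n F G fuel S O k cs
    else bif Nat.ble F S.length then some cs
    else foldOption (fun w cs =>
      bif Nat.beq w a || Nat.beq w b || Nat.beq w c || full a w b S || full b w a S then some cs
      else search n F G fuel ((a, b, w) :: S) ((a, w, b) :: (b, w, a) :: O)
        (bif Nat.blt w k then k else w + 1) cs) (List.range (bif Nat.blt k n then k + 1 else k)) cs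

end Search

section Soundness

variable {V : Type*} [DecidableEq V]

theorem beq_eq_false_iff {a b : ℕ} : Nat.beq a b = false ↔ a ≠ b := by
  rw [← Bool.not_eq_true, Nat.beq_eq]

/-- The set of the labels of the vertices of a triangle. -/
def tri (f : ℕ → V) (t : ℕ × ℕ × ℕ) : Finset V := {f t.1, f t.2.1, f t.2.2}

theorem tri_eq_of_third {a b x : ℕ} {t : ℕ × ℕ × ℕ} (h : third a b t = some x) (f : ℕ → V) :
    ({f a, f b, f x} : Finset V) = tri f t := by
  obtain ⟨p, q, r⟩ := t
  unfold third at h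
  simp only [cond_eq_ite, Nat.beq_eq] at h
  unfold tri
  split_ifs at h <;> simp only [Option.some.injEq] at h <;> subst_vars <;> ext v <;>
    simp only [Finset.mem_insert, Finset.mem_singleton] <;> tauto

theorem third_eq_of_tri {a b x : ℕ} {t : ℕ × ℕ × ℕ} (h : ({a, b, x} : Finset ℕ) = tri id t)
    (hab : a ≠ b) (hax : a ≠ x) (hbx : b ≠ x) : third a b t = some x := by
  obtain ⟨p, q, r⟩ := t
  simp only [tri, id] at h
  have h1 : a = p ∨ a = q ∨ a = r := by
    simpa [h] using (by simp : a ∈ ({a, b, x} : Finset ℕ))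
  have h2 : b = p ∨ b = q ∨ b = r := by
    simpa [h] using (by simp : b ∈ ({a, b, x} : Finset ℕ))
  have h3 : x = p ∨ x = q ∨ x = r := by
    simpa [h] using (by simp : x ∈ ({a, b, x} : Finset ℕ))
  unfold third
  simp only [cond_eq_ite, Nat.beq_eq]
  rcases h1 with rfl | rfl | rfl <;> rcases h2 with rfl | rfl | rfl <;>
    rcases h3 with rfl | rfl | rfl <;> simp [*] at * <;> simp [Ne.symm, *]

theorem mem_opp {a b x : ℕ} {S : List (ℕ × ℕ × ℕ)} :
    x ∈ opp a b S ↔ ∃ t ∈ S, third a b t = some x := by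
  simp [opp]

/-- The state in which a branch is entered depends on the earlier branches and is irrelevant for
soundness: success of the whole fold means that each branch succeeded from some state. -/
theorem exists_of_foldOption {α β : Type*} {f : α → β → Option β} {l : List α} {s s' : β}
    (h : foldOption f l s = some s') {a : α} (ha : a ∈ l) : ∃ r r', f a r = some r' := by
  induction l generalizing s with
  | nil => simp at ha
  | cons b l ih =>
    unfold foldOption at h
    split at h
    · simp at h
    · rename_i r hr
      rcases List.mem_cons.1 ha with rfl | ha
      · exact ⟨s, r, hr⟩
      · exact ih h ha

/-- The triangles of `S`, which have vertices below `k`, are labelled by members of `T`. -/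
structure Placed (T : Finset (Finset V)) (f : ℕ → V) (k : ℕ) (S : List (ℕ × ℕ × ℕ)) : Prop where
  lt : ∀ t ∈ S, t.1 < k ∧ t.2.1 < k ∧ t.2.2 < k
  mem : ∀ t ∈ S, tri f t ∈ T

theorem Placed.congr {T : Finset (Finset V)} {f g : ℕ → V} {k l : ℕ} {S : List (ℕ × ℕ × ℕ)}
    (h : Placed T f k S) (hkl : k ≤ l) (hfg : ∀ i < k, g i = f i) : Placed T g l S where
  lt t ht := by have := h.lt t ht; omega
  mem t ht := by
    obtain ⟨h1, h2, h3⟩ := h.lt t ht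
    have := h.mem t ht
    unfold tri at this ⊢
    rwa [hfg _ h1, hfg _ h2, hfg _ h3]

theorem Placed.cons {T : Finset (Finset V)} {f : ℕ → V} {k : ℕ} {S : List (ℕ × ℕ × ℕ)}
    (h : Placed T f k S) {a b c : ℕ} (ha : a < k) (hb : b < k) (hc : c < k)
    (hT : {f a, f b, f c} ∈ T) : Placed T f k ((a, b, c) :: S) where
  lt := List.forall_mem_cons.2 ⟨⟨ha, hb, hc⟩, h.lt⟩
  mem := List.forall_mem_cons.2 ⟨hT, h.mem⟩

theorem Placed.tail {T : Finset (Finset V)} {f : ℕ → V} {k : ℕ} {S : List (ℕ × ℕ × ℕ)}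
    {t : ℕ × ℕ × ℕ} (h : Placed T f k (t :: S)) : Placed T f k S where
  lt := (List.forall_mem_cons.1 h.lt).2
  mem := (List.forall_mem_cons.1 h.mem).2

theorem Placed.lt_of_mem_opp {T : Finset (Finset V)} {f : ℕ → V} {k : ℕ} {S : List (ℕ × ℕ × ℕ)}
    (h : Placed T f k S) {a b x : ℕ} (hx : x ∈ opp a b S) : x < k := by
  obtain ⟨t, ht, htx⟩ := mem_opp.1 hx
  have h1 := tri_eq_of_third htx id
  have h2 := h.lt t ht
  have h3 : x ∈ tri id t := h1 ▸ (by simp)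
  simp only [tri, id, Finset.mem_insert, Finset.mem_singleton] at h3
  omega

theorem Placed.mem_of_mem_opp {T : Finset (Finset V)} {f : ℕ → V} {k : ℕ}
    {S : List (ℕ × ℕ × ℕ)} (h : Placed T f k S) {a b x : ℕ} (hx : x ∈ opp a b S) :
    {f a, f b, f x} ∈ T := by
  obtain ⟨t, ht, htx⟩ := mem_opp.1 hx
  exact tri_eq_of_third htx f ▸ h.mem t ht

/-- All three vertices carry labels below `k`, where the labelling is injective, so equality of the
labelled triangles descends to the numerical ones. -/
theorem Placed.mem_opp_of_tri {T : Finset (Finset V)} {f : ℕ → V} {k : ℕ}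
    {S : List (ℕ × ℕ × ℕ)} (h : Placed T f k S) (hf : Set.InjOn f (Set.Iio k)) {a b : ℕ} {d : V}
    (ha : a < k) (hb : b < k) {t : ℕ × ℕ × ℕ} (ht : t ∈ S) (htd : tri f t = {f a, f b, d})
    (hd : ({f a, f b, d} : Finset V).card = 3) : ∃ x ∈ opp a b S, f x = d := by
  obtain ⟨hab, had, hbd⟩ := ne_of_card_eq_three hd
  obtain ⟨h1, h2, h3⟩ := h.lt t ht
  have h4 : d ∈ tri f t := htd ▸ (by simp)
  obtain ⟨x, hx, rfl⟩ : ∃ x < k, d = f x := by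
    simp only [tri, Finset.mem_insert, Finset.mem_singleton] at h4
    rcases h4 with h4 | h4 | h4
    exacts [⟨_, h1, h4⟩, ⟨_, h2, h4⟩, ⟨_, h3, h4⟩]
  refine ⟨x, mem_opp.2 ⟨t, ht, third_eq_of_tri ?_ (ne_of_apply_ne f hab) (ne_of_apply_ne f had)
    (ne_of_apply_ne f hbd)⟩, rfl⟩
  have h5 : Set.InjOn (Finset.image f) {s | (s : Set ℕ) ⊆ Set.Iio k} := fun s hs s' hs' h => by
    apply Finset.coe_injective
    have := congrArg ((↑) : Finset V → Set V) h
    rw [Finset.coe_image, Finset.coe_image] at this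
    exact (hf.image_eq_image_iff hs hs').1 this
  refine h5 ?_ ?_ ?_
  · intro y hy
    simp only [Finset.coe_insert, Finset.coe_singleton, Set.mem_insert_iff,
      Set.mem_singleton_iff] at hy
    simp only [Set.mem_Iio]
    omega
  · intro y hy
    simp only [tri, id, Finset.coe_insert, Finset.coe_singleton, Set.mem_insert_iff,
      Set.mem_singleton_iff] at hy
    simp only [Set.mem_Iio]
    omega
  · simpa [tri, Finset.image_insert] using htd.symm

/-- A member of the list `G` is isomorphic to a part of `T`. -/
def Listed (n : ℕ) (G : List (List (ℕ × ℕ × ℕ))) (T : Finset (Finset V)) : Prop :=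
  ∃ L ∈ G, ∃ f : ℕ → V, Set.InjOn f (Set.Iio n) ∧ ∀ t ∈ L, tri f t ∈ T

/-- The digits embed a listed complex into `S`, and `f` embeds `S` into `T`; the composite is the
required map. -/
theorem Placed.listed {T : Finset (Finset V)} {f : ℕ → V} {n k c : ℕ} {S : List (ℕ × ℕ × ℕ)}
    {G : List (List (ℕ × ℕ × ℕ))} (h : Placed T f k S) (hf : Set.InjOn f (Set.Iio n))
    (hc : isoCheck n G c S = true) : Listed n G T := by
  unfold isoCheck at hc
  split at hc
  · simp at hc
  · rename_i L hL
    simp only [Bool.and_eq_true, List.all_eq_true, List.mem_range, List.any_eq_true,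
      Bool.not_eq_true', Nat.beq_eq, Nat.blt_eq] at hc
    refine ⟨L, List.mem_of_getElem? hL, fun i => f (digit c i), ?_, fun t ht => ?_⟩
    · have key : ∀ i < n, ∀ j < i, digit c i ≠ digit c j := fun i hi j hj h => by
        have := (hc.1 i hi).2 j hj
        rw [h] at this
        simp at this
      intro i hi j hj hij
      have hij := hf (hc.1 i hi).1 (hc.1 j hj).1 hij
      rcases lt_trichotomy i j with h | h | h
      · exact (key j hj i h hij.symm).elim
      · exact h
      · exact (key i hi j h hij).elim
    · obtain ⟨x, hx, hxt⟩ := hc.2 t ht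
      have := h.mem_of_mem_opp hx
      rwa [← hxt] at this

variable [Fintype V]

/-- Two different triangles of `S` on the edge already exhaust those of `T`. -/
theorem CombSphere.mem_opp_of_twice {T : Finset (Finset V)} (hT : CombSphere T) {f : ℕ → V}
    {k : ℕ} {S : List (ℕ × ℕ × ℕ)} (h : Placed T f k S) (hf : Set.InjOn f (Set.Iio k)) {a b : ℕ}
    (hab : twice a b S = true) {d : V} (hd : {f a, f b, d} ∈ T) : ∃ x ∈ opp a b S, f x = d := by
  unfold twice at hab
  split at hab
  · rename_i x y l hl
    have hx : x ∈ opp a b S := by rw [hl]; simp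
    have hy : y ∈ opp a b S := by rw [hl]; simp
    have hxy : f x ≠ f y := fun he => by
      rw [hf (h.lt_of_mem_opp hx) (h.lt_of_mem_opp hy) he] at hab
      simp at hab
    obtain ⟨e, -, -, he⟩ := hT.edge _ _ _ (h.mem_of_mem_opp hx)
    rcases he d hd with rfl | rfl
    · exact ⟨x, hx, rfl⟩
    · rcases he _ (h.mem_of_mem_opp hy) with h1 | h1
      · exact (hxy h1.symm).elim
      · exact ⟨y, hy, h1⟩
  · simp at hab

/-- Otherwise the edge would be in three triangles of `T`. -/
theorem CombSphere.not_full {T : Finset (Finset V)} (hT : CombSphere T) {f : ℕ → V}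
    {k : ℕ} {S : List (ℕ × ℕ × ℕ)} (h : Placed T f k S) (hf : Set.InjOn f (Set.Iio k)) {a b c : ℕ}
    (hc : c < k) (habc : {f a, f b, f c} ∈ T) : full a b c S = false := by
  by_contra hab
  rw [Bool.not_eq_false] at hab
  unfold full at hab
  split at hab
  · rename_i x y l hl
    have hx : x ∈ opp a b S := by rw [hl]; simp
    have hy : y ∈ opp a b S := by rw [hl]; simp
    have hxk := h.lt_of_mem_opp hx
    have hyk := h.lt_of_mem_opp hy
    simp only [Bool.and_eq_true, Bool.not_eq_true', beq_eq_false_iff] at hab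
    obtain ⟨e, -, -, he⟩ := hT.edge _ _ _ habc
    have h1 := (he _ (h.mem_of_mem_opp hx)).resolve_left fun h1 => hab.1.2 (hf hxk hc h1)
    have h2 := (he _ (h.mem_of_mem_opp hy)).resolve_left fun h1 => hab.2 (hf hyk hc h1)
    exact hab.1.1 (hf hxk hyk (h1.trans h2.symm))
  · simp at hab

/-- A closed part would be all of `T` by strong connectedness, but the vertex `f k` is in none of
its triangles. This justifies discarding spheres that close up too early. -/
theorem CombSphere.not_closed {T : Finset (Finset V)} (hT : CombSphere T) {f : ℕ → V}
    {n k : ℕ} {S : List (ℕ × ℕ × ℕ)} (h : Placed T f k S) (hf : Set.InjOn f (Set.Iio n))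
    (hk : k < n) (hS : S ≠ []) : closed S = false := by
  by_contra hcl
  rw [Bool.not_eq_false] at hcl
  have hf' := hf.mono (Set.Iio_subset_Iio hk.le)
  simp only [closed, List.all_eq_true, Bool.and_eq_true] at hcl
  have hmem : ∀ s, s ∈ (S.map (tri f)).toFinset ↔ ∃ t ∈ S, tri f t = s := by simp
  have hE : (S.map (tri f)).toFinset = T := by
    refine hT.connected _ ?_ ?_ ?_
    · intro s hs
      obtain ⟨t, ht, rfl⟩ := (hmem s).1 hs
      exact h.mem t ht
    · obtain ⟨t, ht⟩ := List.exists_mem_of_ne_nil S hS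
      exact ⟨_, (hmem _).2 ⟨t, ht, rfl⟩⟩
    · intro p q r s hp hs
      have key : ∀ x y, twice x y S = true → {f x, f y, s} ∈ T →
          {f x, f y, s} ∈ (S.map (tri f)).toFinset := fun x y hxy hd => by
        obtain ⟨z, hz, rfl⟩ := hT.mem_opp_of_twice h hf' hxy hd
        obtain ⟨t, ht, htz⟩ := mem_opp.1 hz
        exact (hmem _).2 ⟨t, ht, (tri_eq_of_third htz f).symm⟩
      have key' : ∀ x y, twice x y S = true → {f y, f x, s} ∈ T →
          {f y, f x, s} ∈ (S.map (tri f)).toFinset := fun x y hxy hd => by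
        rw [Finset.insert_comm] at hd ⊢
        exact key x y hxy hd
      obtain ⟨t, ht, htp⟩ := (hmem _).1 hp
      obtain ⟨⟨h1, h2⟩, h3⟩ := hcl t ht
      have hpq := (ne_of_card_eq_three (hT.card_eq _ hs)).1
      have hp' : p ∈ tri f t := htp ▸ (by simp)
      have hq' : q ∈ tri f t := htp ▸ (by simp)
      simp only [tri, Finset.mem_insert, Finset.mem_singleton] at hp' hq'
      rcases hp' with rfl | rfl | rfl <;> rcases hq' with rfl | rfl | rfl
      exacts [(hpq rfl).elim, key _ _ h1 hs, key _ _ h2 hs, key' _ _ h1 hs, (hpq rfl).elim,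
        key _ _ h3 hs, key' _ _ h2 hs, key' _ _ h3 hs, (hpq rfl).elim]
  obtain ⟨s, hs, hks⟩ := hT.cover (f k)
  rw [← hE, hmem] at hs
  obtain ⟨t, ht, rfl⟩ := hs
  obtain ⟨h1, h2, h3⟩ := h.lt t ht
  have hne : ∀ i < k, f k ≠ f i := fun i hi he => hi.ne' (hf hk (hi.trans hk) he)
  simp only [tri, Finset.mem_insert, Finset.mem_singleton] at hks
  rcases hks with hks | hks | hks
  exacts [hne _ h1 hks, hne _ h2 hks, hne _ h3 hks]

/-- A vertex that is not yet labelled can be made the next one. -/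
theorem exists_relabel {f : ℕ → V} {n k : ℕ} (hf : Set.InjOn f (Set.Iio n))
    (hn : Fintype.card V = n) (hk : k ≤ n) (d : V) :
    ∃ (g : ℕ → V) (w : ℕ), Set.InjOn g (Set.Iio n) ∧ (∀ i < k, g i = f i) ∧ g w = d ∧
      w ∈ List.range (bif Nat.blt k n then k + 1 else k) ∧
      w < (bif Nat.blt w k then k else w + 1) ∧ k ≤ (bif Nat.blt w k then k else w + 1) ∧
      (bif Nat.blt w k then k else w + 1) ≤ n := by
  obtain ⟨j, hj, rfl⟩ : ∃ j < n, f j = d := by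
    have h1 : (Finset.range n).image f = Finset.univ := by
      apply Finset.eq_univ_of_card
      rw [Finset.card_image_of_injOn (by simpa using hf), Finset.card_range, hn]
    have := h1 ▸ Finset.mem_univ d
    simpa using this
  simp only [cond_eq_ite, Nat.blt_eq, List.mem_range]
  by_cases hjk : j < k
  · refine ⟨f, j, hf, fun _ _ => rfl, rfl, ?_⟩
    split_ifs <;> omega
  -- Numbers from `k` on are not yet in use, so exchanging `k` with the number `j` of `d` changes
  -- nothing below `k`: trying one new vertex suffices.
  · refine ⟨f ∘ Equiv.swap k j, k, ?_, fun i hi => ?_, by simp, ?_⟩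
    · refine hf.comp (Equiv.injective _).injOn fun i hi => ?_
      have hi : i < n := hi
      change Equiv.swap k j i < n
      rw [Equiv.swap_apply_def]
      split_ifs <;> omega
    · rw [Function.comp, Equiv.swap_apply_of_ne_of_ne (by omega) (by omega)]
    · simp only [lt_irrefl, if_false]
      split_ifs <;> omega

/-- The triangles of `T` themselves select a branch of the search. As long as `S` is a labelled part
of `T` without repetitions, the first open edge has a second triangle in `T`, and the branch that
adds it is never pruned. The branch can only end at a set in which a listed complex was found, since
exhausted fuel would return `none`. -/
theorem CombSphere.listed_of_search {T : Finset (Finset V)} (hT : CombSphere T) {n F : ℕ}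
    (hn : Fintype.card V = n) (hF : T.card ≤ F) {G : List (List (ℕ × ℕ × ℕ))} (fuel : ℕ) :
    ∀ {S O : List (ℕ × ℕ × ℕ)} {k : ℕ} {cs cs' : List ℕ} {f : ℕ → V},
      Set.InjOn f (Set.Iio n) → k ≤ n → Placed T f k S → Placed T f k O → S ≠ [] →
        (S.map (tri f)).Nodup → search n F G fuel S O k cs = some cs' → Listed n G T := by
  induction fuel with
  | zero => intro S O k cs cs' f _ _ _ _ _ _ h; simp [search] at h
  | succ fuel ih =>
    intro S O k cs cs' f hf hk hS hO hne hnd h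
    cases O with
    | nil =>
      unfold search at h
      have : (Nat.blt k n && closed S) = false := by
        rw [Bool.and_eq_false_iff]
        by_cases hkn : k < n
        · exact Or.inr (hT.not_closed hS hf hkn hne)
        · left
          rw [← Bool.not_eq_true, Nat.blt_eq]
          exact hkn
      rw [this, cond_false] at h
      split at h
      · simp at h
      · rename_i c cs
        cases hc : isoCheck n G c S
        · simp [hc] at h
        · exact hS.listed hf hc
    | cons e O =>
      obtain ⟨a, b, c⟩ := e
      obtain ⟨ha, hb, hc⟩ := hO.lt _ List.mem_cons_self
      have habc : {f a, f b, f c} ∈ T := hO.mem _ List.mem_cons_self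
      unfold search at h
      -- If another opposite vertex is present, the edge already has both triangles and is dropped;
      -- otherwise the second triangle, with vertex `d`, is not in `S`.
      cases h1 : (opp a b S).any fun x => !Nat.beq x c
      case true =>
        rw [h1, cond_true] at h
        exact ih hf hk hS hO.tail hne hnd h
      rw [h1, cond_false] at h
      simp only [List.any_eq_false, Bool.not_eq_true', beq_eq_false_iff, not_not] at h1
      obtain ⟨d, hdc, hd, -⟩ := hT.edge _ _ _ habc
      have hnew : {f a, f b, d} ∉ S.map (tri f) := fun hmem => by
        obtain ⟨t, ht, htd⟩ := List.mem_map.1 hmem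
        obtain ⟨x, hx, rfl⟩ := hS.mem_opp_of_tri (hf.mono (Set.Iio_subset_Iio hk)) ha hb ht htd
          (hT.card_eq _ hd)
        exact hdc (congrArg f (h1 x hx))
      -- `S` together with the new triangle is still contained in `T`, so the bound on the number of
      -- triangles does not cut this branch.
      have hcard : S.length < F := by
        have h2 : ({f a, f b, d} :: S.map (tri f)).toFinset ⊆ T := by
          intro s hs
          simp only [List.mem_toFinset, List.mem_cons, List.mem_map] at hs
          rcases hs with rfl | ⟨t, ht, rfl⟩
          exacts [hd, hS.mem t ht]
        have h3 := Finset.card_le_card h2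
        rw [List.toFinset_card_of_nodup (List.nodup_cons.2 ⟨hnew, hnd⟩), List.length_cons,
          List.length_map] at h3
        omega
      have h2 : Nat.ble F S.length = false := by
        rw [← Bool.not_eq_true, Nat.ble_eq]
        omega
      rw [h2, cond_false] at h
      -- After relabelling, `d` has a number `w` among those tried, and the labels of `S` and `O`
      -- are unchanged.
      obtain ⟨g, w, hg, hgf, rfl, hw, hwk, hkl, hkn⟩ := exists_relabel hf hn hk d
      obtain ⟨r, r', hr⟩ := exists_of_foldOption h hw
      generalize (bif Nat.blt w k then k else w + 1) = l at hwk hkl hkn hr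
      have hS' := hS.congr hkl hgf
      have hO' := hO.congr hkl hgf
      have hmap : S.map (tri g) = S.map (tri f) := List.map_congr_left fun t ht => by
        obtain ⟨h1, h2, h3⟩ := hS.lt t ht
        simp only [tri, hgf _ h1, hgf _ h2, hgf _ h3]
      rw [← hgf a ha, ← hgf b hb] at hd hnew
      rw [← hgf c hc] at hdc
      have hgl := hg.mono (Set.Iio_subset_Iio hkn)
      obtain ⟨-, hwa, hwb⟩ := ne_of_card_eq_three (hT.card_eq _ hd)
      have hd1 : {g a, g w, g b} ∈ T := by rwa [Finset.pair_comm (g w)]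
      have hd2 : {g b, g w, g a} ∈ T := by rwa [Finset.pair_comm (g w), Finset.insert_comm]
      have hcond : (Nat.beq w a || Nat.beq w b || Nat.beq w c || full a w b S || full b w a S)
          = false := by
        simp only [Bool.or_eq_false_iff, beq_eq_false_iff]
        exact ⟨⟨⟨⟨fun h => hwa (by rw [h]), fun h => hwb (by rw [h])⟩, fun h => hdc (by rw [h])⟩,
          hT.not_full hS' hgl (hb.trans_le hkl) hd1⟩, hT.not_full hS' hgl (ha.trans_le hkl) hd2⟩
      rw [hcond, cond_false] at hr
      refine ih hg hkn (hS'.cons (ha.trans_le hkl) (hb.trans_le hkl) hwk hd)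
        ((hO'.tail.cons (hb.trans_le hkl) hwk (ha.trans_le hkl) hd2).cons (ha.trans_le hkl) hwk
          (hb.trans_le hkl) hd1) (by simp) ?_ hr
      rw [List.map_cons, List.nodup_cons, hmap]
      exact ⟨hnew, hnd⟩

/-- A successful search, started with one triangle, shows that the list is complete. -/
theorem CombSphere.listed {T : Finset (Finset V)} (hT : CombSphere T) [Nonempty V] {n F : ℕ}
    (hn : Fintype.card V = n) (hF : T.card ≤ F) {G : List (List (ℕ × ℕ × ℕ))} {fuel : ℕ}
    {cs cs' : List ℕ} (h : search n F G fuel [(0, 1, 2)] [(0, 1, 2), (0, 2, 1), (1, 2, 0)] 3 cs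
      = some cs') : Listed n G T := by
  obtain ⟨v⟩ := ‹Nonempty V›
  obtain ⟨t, ht, -⟩ := hT.cover v
  obtain ⟨a, b, c, hab, hac, hbc, rfl⟩ := Finset.card_eq_three.1 (hT.card_eq t ht)
  have h3 : 3 ≤ n := by
    rw [← hn, ← hT.card_eq _ ht]
    exact Finset.card_le_univ _
  obtain ⟨e⟩ : Nonempty (Fin n ≃ V) := ⟨(Fintype.equivFinOfCardEq hn).symm⟩
  obtain ⟨f, hf⟩ : ∃ f : ℕ → V, Set.InjOn f (Set.Iio n) :=
    ⟨fun i => if h : i < n then e ⟨i, h⟩ else a, fun i hi j hj hij => by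
      have hi : i < n := hi
      have hj : j < n := hj
      simpa [hi, hj] using hij⟩
  -- Used for `k = 0, 1, 2`, this gives the vertices of one triangle of `T` the numbers of the
  -- initial triangle. The new number is exactly `k` because `d` is not among the earlier labels.
  have key : ∀ k < n, ∀ g : ℕ → V, Set.InjOn g (Set.Iio n) → ∀ d : V, (∀ i < k, g i ≠ d) →
      ∃ g' : ℕ → V, Set.InjOn g' (Set.Iio n) ∧ (∀ i < k, g' i = g i) ∧ g' k = d := by
    intro k hk g hg d hd
    obtain ⟨g', w, h1, h2, h3, h4, -⟩ := exists_relabel hg hn hk.le d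
    refine ⟨g', h1, h2, ?_⟩
    have h5 : w < k + 1 := by
      rw [show Nat.blt k n = true by rwa [Nat.blt_eq]] at h4
      simpa using h4
    have h6 : ¬ w < k := fun h => hd w h (by rw [← h2 w h, h3])
    obtain rfl : w = k := by omega
    exact h3
  obtain ⟨f0, hf0, -, h0⟩ := key 0 (by omega) f hf a (by simp)
  obtain ⟨f1, hf1, h10, h1⟩ := key 1 (by omega) f0 hf0 b (fun i hi => by
    obtain rfl : i = 0 := by omega
    rwa [h0])
  have h10 := h10 0 (by omega)
  obtain ⟨f2, hf2, h20, h2⟩ := key 2 (by omega) f1 hf1 c (fun i hi => by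
    obtain rfl | rfl : i = 0 ∨ i = 1 := by omega
    · rwa [h10, h0]
    · rwa [h1])
  have h21 := h20 1 (by omega)
  have h20 := h20 0 (by omega)
  rw [h10, h0] at h20
  rw [h1] at h21
  subst h20 h21 h2
  have hnil : Placed T f2 3 [] := ⟨by simp, by simp⟩
  refine hT.listed_of_search hn hF fuel hf2 h3
    (hnil.cons (by omega) (by omega) (by omega) ht)
    (((hnil.cons (a := 1) (b := 2) (c := 0) (by omega) (by omega) (by omega) ?_).cons
      (a := 0) (b := 2) (c := 1) (by omega) (by omega) (by omega) ?_).cons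
      (by omega) (by omega) (by omega) ht) (by simp) (by simp) h
  · rwa [Finset.pair_comm (f2 2), Finset.insert_comm]
  · rwa [Finset.pair_comm (f2 2)]

end Soundness

end SphereTri

/-! ### Boundaries of simplicial polytopes are spheres; certificates by integer coordinates. -/

namespace SphereTri

section Polytope

variable {V : Type*} [Fintype V]

theorem isCompact_realization (K : AbstractSimplicialComplex V) : IsCompact (realization K) := by
  have h : realization K = stdSimplex ℝ V ∩ ⋃ s ∈ {s : Finset V | s ∈ K},
      {x : V → ℝ | ∀ v, x v ≠ 0 → v ∈ s} := by
    ext x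
    simp [realization]
  rw [h]
  refine (isCompact_stdSimplex ℝ V).inter_right ((Set.toFinite _).isClosed_biUnion fun s _ => ?_)
  simp only [Set.ofPred_forall]
  refine isClosed_iInter fun v => ?_
  by_cases hv : v ∈ s
  · simp [hv]
  · simpa [hv] using isClosed_eq (continuous_apply v) continuous_const

/-- The boundary of a simplicial polytope with the vertices `P v`, that contains the origin in its
interior, is homeomorphic to the sphere; the functionals `l t` describe the facets. -/
theorem nonempty_homeomorph_sphere {E : Type*} [NormedAddCommGroup E] [NormedSpace ℝ E]
    {K : AbstractSimplicialComplex V} {T : Finset (Finset V)} (hTne : T.Nonempty)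
    (hK : ∀ s, s ∈ K ↔ s.Nonempty ∧ ∃ t ∈ T, s ⊆ t) (P : V → E) (l : Finset V → E →ₗ[ℝ] ℝ)
    (hone : ∀ t ∈ T, ∀ v ∈ t, l t (P v) = 1) (hlt : ∀ t ∈ T, ∀ v ∉ t, l t (P v) < 1)
    (hspan : ∀ t ∈ T, ∀ y, ∃ c : V → ℝ, (∀ v ∉ t, c v = 0) ∧ ∑ v, c v • P v = y)
    (hind : ∀ t ∈ T, ∀ c : V → ℝ, (∀ v ∉ t, c v = 0) → ∑ v, c v • P v = 0 → c = 0)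
    (hadj : ∀ t ∈ T, ∀ v ∈ t, ∃ u ∈ T, v ∉ u ∧ ∀ w ∈ t, w ≠ v → w ∈ u) :
    Nonempty (realization K ≃ₜ Metric.sphere (0 : E) 1) := by
  let φ : (V → ℝ) → E := fun x => ∑ v, x v • P v
  have hφ : ∀ t x, l t (φ x) = ∑ v, x v * l t (P v) := fun t x => by simp [φ]
  have hsupp : ∀ x ∈ realization K, ∃ t ∈ T, ∀ v ∉ t, x v = 0 := fun x hx => by
    obtain ⟨-, -, s, hs, hxs⟩ := mem_realization.1 hx
    obtain ⟨-, t, ht, hst⟩ := (hK s).1 hs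
    exact ⟨t, ht, fun v hv => by_contra fun h => hv (hst (hxs v h))⟩
  have hle : ∀ t ∈ T, ∀ v, l t (P v) ≤ 1 := fun t ht v => by
    by_cases hv : v ∈ t
    · exact (hone t ht v hv).le
    · exact (hlt t ht v hv).le
  have hφ1 : ∀ t ∈ T, ∀ x ∈ realization K, (∀ v ∉ t, x v = 0) → l t (φ x) = 1 :=
    fun t ht x hx hxt => by
      rw [hφ, ← (mem_realization.1 hx).2.1]
      refine Finset.sum_congr rfl fun v _ => ?_
      by_cases hv : v ∈ t
      · rw [hone t ht v hv, mul_one]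
      · rw [hxt v hv, zero_mul]
  have hφle : ∀ t ∈ T, ∀ x ∈ realization K, l t (φ x) ≤ 1 := fun t ht x hx => by
    rw [hφ, ← (mem_realization.1 hx).2.1]
    exact Finset.sum_le_sum fun v _ =>
      mul_le_of_le_one_right ((mem_realization.1 hx).1 v) (hle t ht v)
  have hφeq : ∀ t ∈ T, ∀ x ∈ realization K, l t (φ x) = 1 → ∀ v ∉ t, x v = 0 :=
    fun t ht x hx hxt v hv => by
      obtain ⟨hx0, hx1, -⟩ := mem_realization.1 hx
      rw [hφ, ← hx1] at hxt
      have h1 := (Finset.sum_eq_sum_iff_of_le fun v _ =>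
        mul_le_of_le_one_right (hx0 v) (hle t ht v)).1 hxt v (Finset.mem_univ v)
      have h2 := hlt t ht v hv
      by_contra h3
      exact h2.ne (mul_left_cancel₀ h3 (h1.trans (mul_one _).symm))
  have hφ0 : ∀ x ∈ realization K, φ x ≠ 0 := fun x hx h0 => by
    obtain ⟨t, ht, hxt⟩ := hsupp x hx
    have := hφ1 t ht x hx hxt
    rw [h0, map_zero] at this
    exact zero_ne_one this
  have hφc : Continuous φ := by fun_prop
  -- The homeomorphism is radial projection of the polytope boundary; continuity of the inverse
  -- comes from compactness.
  let F : realization K → Metric.sphere (0 : E) 1 := fun x => ⟨‖φ x.1‖⁻¹ • φ x.1, by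
    rw [mem_sphere_zero_iff_norm, norm_smul, norm_inv, norm_norm,
      inv_mul_cancel₀ (norm_ne_zero_iff.2 (hφ0 x.1 x.2))]⟩
  have hFc : Continuous F := by
    refine Continuous.subtype_mk (Continuous.smul (Continuous.inv₀ ?_ ?_) ?_) _
    · exact (hφc.comp continuous_subtype_val).norm
    · exact fun x => norm_ne_zero_iff.2 (hφ0 x.1 x.2)
    · exact hφc.comp continuous_subtype_val
  -- On a common ray let `x` be the point not farther out. The functional of a facet through `x`
  -- gives `1 = r · l t (φ y) ≤ r`, so `r = 1`, both points lie in this facet, and its independent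
  -- vertices determine the coordinates.
  have hcone : ∀ x ∈ realization K, ∀ y ∈ realization K, ∀ r : ℝ, 0 < r →
      φ x = r • φ y → r ≤ 1 → x = y := by
    intro x hx y hy r hr0 hxy hr
    obtain ⟨t, ht, hxt⟩ := hsupp x hx
    have h1 := hφ1 t ht x hx hxt
    have h2 := hφle t ht y hy
    rw [hxy, map_smul, smul_eq_mul] at h1
    have h3 : l t (φ y) = 1 := by nlinarith
    obtain rfl : r = 1 := by rwa [h3, mul_one] at h1
    have h4 := hφeq t ht y hy h3
    have h5 := hind t ht (x - y) (fun v hv => by simp [hxt v hv, h4 v hv]) (by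
      rw [one_smul] at hxy
      simp only [Pi.sub_apply, sub_smul, Finset.sum_sub_distrib]
      exact sub_eq_zero.2 hxy)
    exact sub_eq_zero.1 h5
  have hinj : Function.Injective F := by
    intro x y hxy
    have hx := norm_pos_iff.2 (hφ0 x.1 x.2)
    have hy := norm_pos_iff.2 (hφ0 y.1 y.2)
    have hxy : ‖φ x.1‖⁻¹ • φ x.1 = ‖φ y.1‖⁻¹ • φ y.1 := congrArg Subtype.val hxy
    have h1 : φ x.1 = (‖φ x.1‖ / ‖φ y.1‖) • φ y.1 := by
      rw [div_eq_mul_inv, mul_smul, ← hxy, smul_inv_smul₀ hx.ne']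
    have h2 : φ y.1 = (‖φ y.1‖ / ‖φ x.1‖) • φ x.1 := by
      rw [div_eq_mul_inv, mul_smul, hxy, smul_inv_smul₀ hy.ne']
    rcases le_total ‖φ x.1‖ ‖φ y.1‖ with h | h
    · exact Subtype.ext (hcone _ x.2 _ y.2 _ (div_pos hx hy) h1 ((div_le_one hy).2 h))
    · exact Subtype.ext (hcone _ y.2 _ x.2 _ (div_pos hy hx) h2 ((div_le_one hx).2 h)).symm
  have hsurj : Function.Surjective F := by
    rintro ⟨y, hy⟩
    rw [mem_sphere_zero_iff_norm] at hy
    -- The ray through `y` leaves the polytope in a facet whose functional is largest at `y`.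
    -- Comparison with the facet `u` opposite to `v` gives `0 ≤ l t y - l u y = c v (1 - l u (P
    -- v))`, so the coefficients are nonnegative.
    obtain ⟨t, ht, hmax⟩ := Finset.exists_max_image T (fun t => l t y) hTne
    obtain ⟨c, hc, rfl⟩ := hspan t ht y
    have hc0 : ∀ v, 0 ≤ c v := fun v => by
      by_cases hv : v ∈ t
      · obtain ⟨u, hu, hvu, htu⟩ := hadj t ht v hv
        have h1 := hmax u hu
        have h2 := hlt u hu v hvu
        have h3 := hφ t c
        have h4 := hφ u c
        simp only [φ] at h3 h4
        rw [h3, h4, ← sub_nonneg, ← Finset.sum_sub_distrib,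
          Finset.sum_eq_single_of_mem v (Finset.mem_univ v), hone t ht v hv] at h1
        · nlinarith
        · intro w _ hw
          by_cases hwt : w ∈ t
          · rw [hone t ht w hwt, hone u hu w (htu w hwt hw), sub_self]
          · rw [hc w hwt]; ring
      · exact (hc v hv).ge
    set s := ∑ v, c v with hs
    have hs0 : 0 < s := by
      refine (Finset.sum_nonneg fun v _ => hc0 v).lt_of_ne' fun h => ?_
      have h1 := (Finset.sum_eq_zero_iff_of_nonneg fun v _ => hc0 v).1 h
      rw [Finset.sum_eq_zero fun v hv => by rw [h1 v hv, zero_smul], norm_zero] at hy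
      exact zero_ne_one hy
    have hts : t.Nonempty := by
      rw [Finset.nonempty_iff_ne_empty]
      rintro rfl
      rw [hs, Finset.sum_eq_zero fun v _ => hc v (by simp)] at hs0
      exact hs0.false
    have hφs : φ (s⁻¹ • c) = s⁻¹ • φ c := by
      simp [φ, Finset.smul_sum, mul_smul]
    refine ⟨⟨s⁻¹ • c, mem_realization.2 ⟨fun v => ?_, ?_, t, (hK t).2 ⟨hts, t, ht, subset_rfl⟩,
      fun v hv => ?_⟩⟩, Subtype.ext ?_⟩
    · exact mul_nonneg (inv_nonneg.2 hs0.le) (hc0 v)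
    · simp only [Pi.smul_apply, smul_eq_mul]
      rw [← Finset.mul_sum, ← hs, inv_mul_cancel₀ hs0.ne']
    · by_contra h
      simp [hc v h] at hv
    · change ‖φ (s⁻¹ • c)‖⁻¹ • φ (s⁻¹ • c) = φ c
      rw [hφs, norm_smul, show ‖φ c‖ = 1 from hy, mul_one, norm_inv, inv_inv, Real.norm_eq_abs,
        abs_of_pos hs0, smul_inv_smul₀ hs0.ne']
  have : CompactSpace (realization K) := isCompact_iff_compactSpace.1 (isCompact_realization K)
  exact ⟨Continuous.homeoOfEquivCompactToT2 (f := Equiv.ofBijective F ⟨hinj, hsurj⟩) hFc⟩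

end Polytope

section Generates

variable {n : ℕ} [NeZero n]

/-- The complex `K` is generated by the triangles in the list `L`. -/
def Generates (L : List (ℕ × ℕ × ℕ)) (K : AbstractSimplicialComplex (Fin n)) : Prop :=
  ∀ s, s ∈ K ↔ s.Nonempty ∧ ∃ t ∈ L, s ⊆ tri (Fin.ofNat n) t

theorem generates_ofTriangles {L : List (ℕ × ℕ × ℕ)} {T : Finset (Finset (Fin n))}
    {hT : ∀ v, ∃ t ∈ T, v ∈ t} (h : T = (L.map (tri (Fin.ofNat n))).toFinset) :
    Generates L (ofTriangles T hT) := by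
  intro s
  change s.Nonempty ∧ (∃ t ∈ T, s ⊆ t) ↔ _
  simp [h]

/-- The determinant of three vectors. -/
def det3 {R : Type*} [CommRing R] (x y z : R × R × R) : R :=
  x.1 * (y.2.1 * z.2.2 - y.2.2 * z.2.1) + x.2.1 * (y.2.2 * z.1 - y.1 * z.2.2) +
    x.2.2 * (y.1 * z.2.1 - y.2.1 * z.1)

/-- The triangles in `L` are the facets of the simplicial polytope with the vertices `P i`, which
contains the origin in its interior. -/
def facetCheck (n : ℕ) (L : List (ℕ × ℕ × ℕ)) (P : List (ℤ × ℤ × ℤ)) : Bool :=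
  !L.isEmpty && L.all fun t =>
    let x := P.getD t.1 0
    let y := P.getD t.2.1 0
    let z := P.getD t.2.2 0
    let D := det3 x y z
    decide (t.1 < n ∧ t.2.1 < n ∧ t.2.2 < n ∧ D ≠ 0) &&
      ((List.range n).all fun i => Nat.beq i t.1 || Nat.beq i t.2.1 || Nat.beq i t.2.2 ||
        decide (D * (det3 (P.getD i 0) y z + det3 x (P.getD i 0) z + det3 x y (P.getD i 0))
          < D * D)) &&
      (opp t.1 t.2.1 L).any (fun i => !Nat.beq i t.2.2 && Nat.blt i n) &&
      (opp t.1 t.2.2 L).any (fun i => !Nat.beq i t.2.1 && Nat.blt i n) &&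
      (opp t.2.1 t.2.2 L).any (fun i => !Nat.beq i t.1 && Nat.blt i n)

theorem sum_smul_eq {V E : Type*} [Fintype V] [DecidableEq V] [AddCommGroup E] [Module ℝ E]
    {a b c : V} (hab : a ≠ b) (hac : a ≠ c) (hbc : b ≠ c) {x : V → ℝ}
    (hx : ∀ v ∉ ({a, b, c} : Finset V), x v = 0) (P : V → E) :
    ∑ v, x v • P v = x a • P a + (x b • P b + x c • P c) := by
  rw [← Finset.sum_subset (Finset.subset_univ {a, b, c}) fun v _ hv => by rw [hx v hv, zero_smul],
    Finset.sum_insert (by simp [hab, hac]), Finset.sum_pair hbc]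

/-- The coordinates of a point of Euclidean space. -/
def coords (y : EuclideanSpace ℝ (Fin 3)) : ℝ × ℝ × ℝ := (y 0, y 1, y 2)

/-- Cramer's rule. -/
theorem exists_linearMap_of_det3_ne_zero {A B C : EuclideanSpace ℝ (Fin 3)}
    (h : det3 (coords A) (coords B) (coords C) ≠ 0) :
    ∃ α β γ : EuclideanSpace ℝ (Fin 3) →ₗ[ℝ] ℝ,
      (∀ y, det3 (coords A) (coords B) (coords C) * α y = det3 (coords y) (coords B) (coords C)) ∧
      (∀ y, det3 (coords A) (coords B) (coords C) * β y = det3 (coords A) (coords y) (coords C)) ∧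
      (∀ y, det3 (coords A) (coords B) (coords C) * γ y = det3 (coords A) (coords B) (coords y)) ∧
      ∀ y, α y • A + (β y • B + γ y • C) = y := by
  set D := det3 (coords A) (coords B) (coords C) with hD
  refine ⟨⟨⟨fun y => D⁻¹ * det3 (coords y) (coords B) (coords C), fun x y => ?_⟩, fun r y => ?_⟩,
    ⟨⟨fun y => D⁻¹ * det3 (coords A) (coords y) (coords C), fun x y => ?_⟩, fun r y => ?_⟩,
    ⟨⟨fun y => D⁻¹ * det3 (coords A) (coords B) (coords y), fun x y => ?_⟩, fun r y => ?_⟩,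
    fun y => mul_inv_cancel_left₀ h _, fun y => mul_inv_cancel_left₀ h _,
    fun y => mul_inv_cancel_left₀ h _, fun y => ?_⟩
  iterate 6 simp [det3, coords]; ring
  ext i
  apply mul_left_cancel₀ h
  simp only [LinearMap.coe_mk, AddHom.coe_mk, PiLp.add_apply, PiLp.smul_apply, smul_eq_mul,
    mul_add, mul_assoc, mul_inv_cancel_left₀ h]
  rw [hD]
  fin_cases i <;> simp [det3, coords] <;> ring

theorem fin_ofNat_ne {i j : ℕ} (hi : i < n) (hj : j < n) (h : i ≠ j) :
    Fin.ofNat n i ≠ Fin.ofNat n j := fun he => h <| by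
  have := congrArg Fin.val he
  rwa [Fin.val_ofNat, Fin.val_ofNat, Nat.mod_eq_of_lt hi, Nat.mod_eq_of_lt hj] at this

theorem Generates.isSphereTriangulation {L : List (ℕ × ℕ × ℕ)} {P : List (ℤ × ℤ × ℤ)}
    {K : AbstractSimplicialComplex (Fin n)} (hK : Generates L K) (h : facetCheck n L P = true) :
    IsSphereTriangulation K := by
  simp only [facetCheck, Bool.and_eq_true, List.all_eq_true, List.any_eq_true, Bool.or_eq_true,
    Nat.beq_eq, Nat.blt_eq, Bool.not_eq_true', beq_eq_false_iff, decide_eq_true_eq,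
    List.mem_range] at h
  obtain ⟨hne, h⟩ := h
  have hne : L ≠ [] := by simpa using hne
  obtain ⟨t₀, ht₀⟩ := List.exists_mem_of_ne_nil L hne
  let p : ℤ × ℤ × ℤ → EuclideanSpace ℝ (Fin 3) := fun x => !₂[(x.1 : ℝ), (x.2.1 : ℝ), (x.2.2 : ℝ)]
  have hp : ∀ x y z, det3 (coords (p x)) (coords (p y)) (coords (p z)) = (det3 x y z : ℤ) :=
    fun x y z => by simp [det3, coords, p]
  let Q : Fin n → EuclideanSpace ℝ (Fin 3) := fun v => p (P.getD v 0)
  have hQ : ∀ i < n, Q (Fin.ofNat n i) = p (P.getD i 0) := fun i hi => by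
    simp [Q, Nat.mod_eq_of_lt hi]
  have hmem : ∀ s, s ∈ (L.map (tri (Fin.ofNat n))).toFinset ↔ ∃ t ∈ L, tri (Fin.ofNat n) t = s := by
    simp
  have hne3 : ∀ t ∈ L, t.1 ≠ t.2.1 ∧ t.1 ≠ t.2.2 ∧ t.2.1 ≠ t.2.2 := fun t ht => by
    obtain ⟨⟨⟨⟨⟨-, -, -, h1⟩, -⟩, -⟩, -⟩, -⟩ := h t ht
    refine ⟨fun h2 => h1 ?_, fun h2 => h1 ?_, fun h2 => h1 ?_⟩ <;> rw [h2] <;> simp only [det3] <;>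
      ring
  have hfacet : ∀ s ∈ (L.map (tri (Fin.ofNat n))).toFinset,
      ∃ l : EuclideanSpace ℝ (Fin 3) →ₗ[ℝ] ℝ, (∀ v ∈ s, l (Q v) = 1) ∧ (∀ v ∉ s, l (Q v) < 1) ∧
      (∀ y, ∃ c : Fin n → ℝ, (∀ v ∉ s, c v = 0) ∧ ∑ v, c v • Q v = y) ∧
      (∀ c : Fin n → ℝ, (∀ v ∉ s, c v = 0) → ∑ v, c v • Q v = 0 → c = 0) := by
    intro s hs
    obtain ⟨⟨a, b, c⟩, ht, rfl⟩ := (hmem s).1 hs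
    obtain ⟨⟨⟨⟨⟨ha, hb, hc, hD⟩, hlt⟩, -⟩, -⟩, -⟩ := h _ ht
    obtain ⟨hab, hac, hbc⟩ := hne3 _ ht
    simp only at ha hb hc hD hlt hab hac hbc
    have hab := fin_ofNat_ne ha hb hab
    have hac := fin_ofNat_ne ha hc hac
    have hbc := fin_ofNat_ne hb hc hbc
    have hD' : det3 (coords (Q (Fin.ofNat n a))) (coords (Q (Fin.ofNat n b)))
        (coords (Q (Fin.ofNat n c))) ≠ 0 := by
      rw [hQ a ha, hQ b hb, hQ c hc, hp]
      exact_mod_cast hD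
    obtain ⟨α, β, γ, hα, hβ, hγ, hsum⟩ := exists_linearMap_of_det3_ne_zero hD'
    have hbasis : α (Q (Fin.ofNat n a)) = 1 ∧ α (Q (Fin.ofNat n b)) = 0 ∧
        α (Q (Fin.ofNat n c)) = 0 ∧ β (Q (Fin.ofNat n a)) = 0 ∧ β (Q (Fin.ofNat n b)) = 1 ∧
        β (Q (Fin.ofNat n c)) = 0 ∧ γ (Q (Fin.ofNat n a)) = 0 ∧ γ (Q (Fin.ofNat n b)) = 0 ∧
        γ (Q (Fin.ofNat n c)) = 1 := by
      refine ⟨?_, ?_, ?_, ?_, ?_, ?_, ?_, ?_, ?_⟩ <;> apply mul_left_cancel₀ hD'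
      iterate 3 rw [hα]; simp only [det3]; ring
      iterate 3 rw [hβ]; simp only [det3]; ring
      iterate 3 rw [hγ]; simp only [det3]; ring
    obtain ⟨haa, hba, hca, hab', hbb, hcb, hac', hbc', hcc⟩ := hbasis
    -- The sum of the three coordinates with respect to the vertices of the triangle is 1 exactly on
    -- its plane, so it is the facet functional.
    refine ⟨α + (β + γ), fun v hv => ?_, fun v hv => ?_, fun y => ?_, fun x hx h0 => ?_⟩
    · simp only [tri, Finset.mem_insert, Finset.mem_singleton] at hv
      rcases hv with rfl | rfl | rfl <;>
        simp only [LinearMap.add_apply, haa, hba, hca, hab', hbb, hcb, hac', hbc', hcc, add_zero,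
          zero_add]
    · have hlt := (hlt v v.2).resolve_left fun he => hv <| by
        rcases he with (he | he) | he <;> simp [tri, ← he]
      have hlt : (_ : ℝ) < _ := Int.cast_lt.2 hlt
      simp only [Int.cast_mul, Int.cast_add, ← hp] at hlt
      rw [← hQ a ha, ← hQ b hb, ← hQ c hc] at hlt
      change _ * (det3 (coords (Q v)) _ _ + det3 _ (coords (Q v)) _ + det3 _ _ (coords (Q v))) < _
        at hlt
      rw [← hα (Q v), ← hβ (Q v), ← hγ (Q v)] at hlt
      simp only [LinearMap.add_apply]
      set D := det3 (coords (Q (Fin.ofNat n a))) (coords (Q (Fin.ofNat n b)))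
        (coords (Q (Fin.ofNat n c)))
      -- The integer test is the facet inequality multiplied by `D²` rather than `D`, so that the
      -- orientation of the triangle does not matter.
      have hpos : 0 < D * D := mul_self_pos.2 hD'
      refine lt_of_mul_lt_mul_left ?_ hpos.le
      linear_combination hlt
    · let x : Fin n → ℝ := fun v => if v = Fin.ofNat n a then α y else if v = Fin.ofNat n b then β y
        else if v = Fin.ofNat n c then γ y else 0
      have hx : ∀ v ∉ ({Fin.ofNat n a, Fin.ofNat n b, Fin.ofNat n c} : Finset (Fin n)), x v = 0 :=
        fun v hv => by
          simp only [Finset.mem_insert, Finset.mem_singleton, not_or] at hv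
          simp only [x, if_neg hv.1, if_neg hv.2.1, if_neg hv.2.2]
      refine ⟨x, hx, ?_⟩
      rw [sum_smul_eq hab hac hbc hx]
      simp only [x, if_true, if_neg hab.symm, if_neg hac.symm, if_neg hbc.symm]
      exact hsum y
    · rw [sum_smul_eq hab hac hbc hx] at h0
      have h1 := congrArg α h0
      have h2 := congrArg β h0
      have h3 := congrArg γ h0
      simp only [map_add, map_smul, map_zero, smul_eq_mul, mul_one, mul_zero, add_zero, zero_add,
        haa, hba, hca, hab', hbb, hcb, hac', hbc', hcc] at h1 h2 h3
      ext v
      by_cases hv : v ∈ tri (Fin.ofNat n) (a, b, c)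
      · simp only [tri, Finset.mem_insert, Finset.mem_singleton] at hv
        rcases hv with rfl | rfl | rfl <;> simpa
      · exact hx v hv
  choose! l hone hlt hspan hind using hfacet
  refine nonempty_homeomorph_sphere ⟨_, (hmem _).2 ⟨t₀, ht₀, rfl⟩⟩ (fun s => ?_) Q l hone hlt hspan
    hind ?_
  · rw [hK s]
    simp
  · intro s hs v hv
    obtain ⟨⟨a, b, c⟩, ht, rfl⟩ := (hmem s).1 hs
    obtain ⟨⟨⟨⟨⟨ha, hb, hc, -⟩, -⟩, ⟨x, hx, hxc, hxn⟩⟩, ⟨y, hy, hyb, hyn⟩⟩, ⟨z, hz, hza, hzn⟩⟩ := h _ ht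
    obtain ⟨hab, hac, hbc⟩ := hne3 _ ht
    have key : ∀ a b x, x ∈ opp a b L → ∀ c, c ≠ Fin.ofNat n a → c ≠ Fin.ofNat n b →
        c ≠ Fin.ofNat n x → ∃ u ∈ (L.map (tri (Fin.ofNat n))).toFinset, c ∉ u ∧
          ∀ w, w = Fin.ofNat n a ∨ w = Fin.ofNat n b → w ∈ u := by
      intro a b x hx c h1 h2 h3
      obtain ⟨t, ht, htx⟩ := mem_opp.1 hx
      have h4 := tri_eq_of_third htx (Fin.ofNat n)
      refine ⟨_, (hmem _).2 ⟨t, ht, rfl⟩, ?_, fun w hw => ?_⟩ <;> rw [← h4]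
      · simp only [Finset.mem_insert, Finset.mem_singleton, not_or]
        exact ⟨h1, h2, h3⟩
      · simp only [Finset.mem_insert]
        tauto
    simp only [tri, Finset.mem_insert, Finset.mem_singleton] at hv
    rcases hv with rfl | rfl | rfl
    · obtain ⟨u, hu, h1, h2⟩ := key _ _ _ hz (Fin.ofNat n a) (fin_ofNat_ne ha hb hab)
        (fin_ofNat_ne ha hc hac) (fin_ofNat_ne ha hzn hza.symm)
      refine ⟨u, hu, h1, fun w hw hwa => h2 w ?_⟩
      simp only [tri, Finset.mem_insert, Finset.mem_singleton] at hw
      tauto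
    · obtain ⟨u, hu, h1, h2⟩ := key _ _ _ hy (Fin.ofNat n b) (fin_ofNat_ne hb ha hab.symm)
        (fin_ofNat_ne hb hc hbc) (fin_ofNat_ne hb hyn hyb.symm)
      refine ⟨u, hu, h1, fun w hw hwa => h2 w ?_⟩
      simp only [tri, Finset.mem_insert, Finset.mem_singleton] at hw
      tauto
    · obtain ⟨u, hu, h1, h2⟩ := key _ _ _ hx (Fin.ofNat n c) (fin_ofNat_ne hc ha hac.symm)
        (fin_ofNat_ne hc hb hbc.symm) (fin_ofNat_ne hc hxn hxc.symm)
      refine ⟨u, hu, h1, fun w hw hwa => h2 w ?_⟩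
      simp only [tri, Finset.mem_insert, Finset.mem_singleton] at hw
      tauto

end Generates

end SphereTri

/-! ### From lists of triangles to isomorphism, degrees, graph invariants and counting. -/

namespace SphereTri

section GeneratedBy

variable {V W : Type*}

/-- The faces of `K` are the nonempty subsets of the members of `T`. -/
def GeneratedBy (T : Finset (Finset V)) (K : AbstractSimplicialComplex V) : Prop :=
  ∀ s, s ∈ K ↔ s.Nonempty ∧ ∃ t ∈ T, s ⊆ t

theorem generatedBy_ofTriangles (T : Finset (Finset V)) (hT : ∀ v, ∃ t ∈ T, v ∈ t) :
    GeneratedBy T (ofTriangles T hT) := fun _ => Iff.rfl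

theorem Generates.generatedBy {n : ℕ} [NeZero n] {L : List (ℕ × ℕ × ℕ)}
    {K : AbstractSimplicialComplex (Fin n)} (hK : Generates L K) :
    GeneratedBy (L.map (tri (Fin.ofNat n))).toFinset K := fun s => by
  rw [hK s]
  simp

theorem GeneratedBy.iso [DecidableEq W] {T : Finset (Finset V)} {K : AbstractSimplicialComplex V}
    {U : Finset (Finset W)} {M : AbstractSimplicialComplex W} (hK : GeneratedBy T K)
    (hM : GeneratedBy U M) (e : V ≃ W) (he : T.image (Finset.image e) = U) : Iso K M := by
  refine ⟨e, fun s => ?_⟩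
  rw [hK s, hM, ← he]
  have h : ∀ t : Finset V, t.image e = t.map e.toEmbedding := fun t =>
    (Finset.map_eq_image e.toEmbedding t).symm
  simp [h]

theorem GeneratedBy.triangles_eq {T : Finset (Finset V)} {K : AbstractSimplicialComplex V}
    (hK : GeneratedBy T K) (hT : ∀ t ∈ T, t.card = 3) : triangles K = T := by
  ext s
  constructor
  · rintro ⟨hs, hs3⟩
    obtain ⟨-, t, ht, hst⟩ := (hK s).1 hs
    rwa [Finset.eq_of_subset_of_card_le hst (by rw [hT t ht, hs3])]
  · intro hs
    have h3 := hT s hs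
    refine ⟨(hK s).2 ⟨?_, s, hs, subset_rfl⟩, h3⟩
    rw [← Finset.card_pos]
    omega

theorem IsSphereTriangulation.generatedBy [Fintype V] [DecidableEq V] {K : AbstractSimplicialComplex V}
    (hK : IsSphereTriangulation K) : GeneratedBy (triangleFinset K) K := fun _ => hK.mem_iff

end GeneratedBy

section Complete

variable {n : ℕ}

/-- A triangle and its neighbour across one edge already involve four vertices. -/
theorem IsSphereTriangulation.four_le {V : Type*} [Fintype V] [DecidableEq V]
    {K : AbstractSimplicialComplex V} (hK : IsSphereTriangulation K) : 4 ≤ Fintype.card V := by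
  have hT := hK.combSphere
  obtain ⟨v⟩ := hK.nonempty
  obtain ⟨t, ht, -⟩ := hT.cover v
  obtain ⟨a, b, c, hab, hac, hbc, rfl⟩ := Finset.card_eq_three.1 (hT.card_eq t ht)
  obtain ⟨d, hdc, hd, -⟩ := hT.edge _ _ _ ht
  obtain ⟨-, had, hbd⟩ := ne_of_card_eq_three (hT.card_eq _ hd)
  have : ({a, b, c, d} : Finset V).card = 4 := by
    rw [Finset.card_insert_of_notMem (by simp [*]), Finset.card_insert_of_notMem (by simp [*]),
      Finset.card_pair hdc.symm]
  rw [← this]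
  exact Finset.card_le_univ _

/-- The triangles in `L` have vertices below `n`, and there are as many of them as in a sphere. -/
def wellFormed (n : ℕ) [NeZero n] (L : List (ℕ × ℕ × ℕ)) : Prop :=
  (∀ t ∈ L, t.1 < n ∧ t.2.1 < n ∧ t.2.2 < n) ∧
    2 * n ≤ (L.map (tri (Fin.ofNat n))).toFinset.card + 4

instance [NeZero n] (L : List (ℕ × ℕ × ℕ)) : Decidable (wellFormed n L) :=
  inferInstanceAs (Decidable (_ ∧ _))

/-- The search yields only an embedding of the listed triangles. The list has at least `2 n - 4` of
them and `K` at most that many, so the embedding is onto. -/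
theorem IsSphereTriangulation.iso_of_generates [NeZero n] {K M : AbstractSimplicialComplex (Fin n)}
    (hK : IsSphereTriangulation K) {L : List (ℕ × ℕ × ℕ)} (hM : Generates L M)
    (hL : wellFormed n L) {f : ℕ → Fin n} (hf : Set.InjOn f (Set.Iio n))
    (hLf : ∀ t ∈ L, tri f t ∈ triangleFinset K) : Iso K M := by
  have hinj : Function.Injective fun v : Fin n => f v := fun v w h => Fin.ext (hf v.2 w.2 h)
  let e : Fin n ≃ Fin n := Equiv.ofBijective _ (Finite.injective_iff_bijective.1 hinj)
  refine (hM.generatedBy.iso hK.generatedBy e ?_).symm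
  apply Finset.eq_of_subset_of_card_le
  · intro s hs
    simp only [Finset.mem_image, List.mem_toFinset, List.mem_map] at hs
    obtain ⟨_, ⟨t, ht, rfl⟩, rfl⟩ := hs
    obtain ⟨h1, h2, h3⟩ := hL.1 t ht
    convert hLf t ht using 1
    simp only [tri, Finset.image_insert, Finset.image_singleton]
    simp only [e, Equiv.ofBijective_apply, Fin.val_ofNat, Nat.mod_eq_of_lt h1, Nat.mod_eq_of_lt h2,
      Nat.mod_eq_of_lt h3]
  · rw [Finset.card_image_of_injective _ (Finset.image_injective e.injective)]
    have h1 := hL.2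
    have h2 := hK.combSphere.card_le
    rw [Fintype.card_fin] at h2
    omega

/-- The graph of the edges of the triangles in `L`. -/
def edgeGraph (n : ℕ) [NeZero n] (L : List (ℕ × ℕ × ℕ)) : SimpleGraph (Fin n) where
  Adj a b := a ≠ b ∧ ∃ t ∈ L, a ∈ tri (Fin.ofNat n) t ∧ b ∈ tri (Fin.ofNat n) t
  symm := ⟨fun _ _ h => ⟨h.1.symm, h.2.imp fun _ ht => ⟨ht.1, ht.2.2, ht.2.1⟩⟩⟩
  loopless := ⟨fun _ h => h.1 rfl⟩

instance [NeZero n] (L : List (ℕ × ℕ × ℕ)) : DecidableRel (edgeGraph n L).Adj :=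
  fun _ _ => inferInstanceAs (Decidable (_ ∧ _))

theorem Generates.skeleton_eq [NeZero n] {L : List (ℕ × ℕ × ℕ)}
    {K : AbstractSimplicialComplex (Fin n)} (hK : Generates L K) :
    skeleton K = edgeGraph n L := by
  ext a b
  change a ≠ b ∧ _ ↔ a ≠ b ∧ _
  rw [hK]
  simp [Finset.insert_subset_iff]

/-- The degree of a vertex, as the size of an explicit finite set. -/
def vertexDegree {V : Type*} [Fintype V] (G : SimpleGraph V) [DecidableRel G.Adj] (v : V) : ℕ :=
  (Finset.univ.filter (G.Adj v)).card

theorem vertexDegree_eq {V : Type*} [Fintype V] (G : SimpleGraph V) [DecidableRel G.Adj] (v : V) :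
    vertexDegree G v = (G.neighborSet v).ncard := by
  rw [vertexDegree, ← Set.ncard_coe_finset]
  congr 1
  ext w
  simp

theorem Generates.degrees_eq [NeZero n] {L : List (ℕ × ℕ × ℕ)}
    {K : AbstractSimplicialComplex (Fin n)} (hK : Generates L K) {m : Multiset ℕ}
    (h : Finset.univ.val.map (vertexDegree (edgeGraph n L)) = m) : degrees K = m := by
  rw [← h, degrees, hK.skeleton_eq]
  exact Multiset.map_congr rfl fun v _ => (vertexDegree_eq _ v).symm

/-- An invariant of graphs: the sum of the numbers `d(v)²d(w)` over the pairs of adjacent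
vertices. -/
def graphInvariant {V : Type*} [Fintype V] (G : SimpleGraph V) [DecidableRel G.Adj] : ℕ :=
  ∑ v, ∑ w, if G.Adj v w then vertexDegree G v ^ 2 * vertexDegree G w else 0

theorem graphInvariant_eq_of_iso {V W : Type*} [Fintype V] [Fintype W] {G : SimpleGraph V}
    {H : SimpleGraph W} [DecidableRel G.Adj] [DecidableRel H.Adj] (e : G ≃g H) :
    graphInvariant G = graphInvariant H := by
  have hd : ∀ v, vertexDegree H (e v) = vertexDegree G v := fun v => by
    rw [vertexDegree_eq, vertexDegree_eq, ← Set.ncard_image_of_injective _ e.injective]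
    congr 1
    ext w
    obtain ⟨w, rfl⟩ := e.surjective w
    simp [e.map_adj_iff]
  unfold graphInvariant
  rw [← e.toEquiv.sum_comp]
  refine Finset.sum_congr rfl fun v _ => ?_
  rw [← e.toEquiv.sum_comp]
  refine Finset.sum_congr rfl fun w _ => ?_
  change _ = if H.Adj (e v) (e w) then vertexDegree H (e v) ^ 2 * vertexDegree H (e w) else 0
  simp only [hd, e.map_adj_iff]

/-- A list of complexes is complete if a search has found all its members, and an invariant
distinguishes their graphs. -/
theorem isCompleteList_of_search [NeZero n] {m F fuel : ℕ} {G : List (List (ℕ × ℕ × ℕ))}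
    {K : Fin m → AbstractSimplicialComplex (Fin n)} {cs cs' : List ℕ} (hG : G.length = m)
    (hK : ∀ i : Fin m, Generates (G.getD i []) (K i)) (hS : ∀ i, IsSphereTriangulation (K i))
    (hwf : ∀ L ∈ G, wellFormed n L) (hF : 2 * n ≤ F + 4)
    (hs : search n F G fuel [(0, 1, 2)] [(0, 1, 2), (0, 2, 1), (1, 2, 0)] 3 cs = some cs')
    (hinv : (G.map fun L => graphInvariant (edgeGraph n L)).Nodup) : IsCompleteList K := by
  refine ⟨hS, fun M hM => ?_, fun i j ⟨e⟩ => ?_⟩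
  · have := hM.nonempty
    have hcard := hM.combSphere.card_le
    rw [Fintype.card_fin] at hcard
    obtain ⟨L, hL, f, hf, hLf⟩ := hM.combSphere.listed (Fintype.card_fin n) (by omega) hs
    obtain ⟨i, hi, rfl⟩ := List.mem_iff_getElem.1 hL
    have h1 := hK ⟨i, hG ▸ hi⟩
    have h2 : G.getD i [] = G[i] := by simp [hi]
    simp only [h2] at h1
    exact ⟨_, hM.iso_of_generates h1 (hwf _ hL) hf hLf⟩
  · rw [(hK i).skeleton_eq, (hK j).skeleton_eq] at e
    have h1 := graphInvariant_eq_of_iso e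
    have hi : (i : ℕ) < G.length := hG ▸ i.2
    have hj : (j : ℕ) < G.length := hG ▸ j.2
    apply Fin.ext
    rw [← hinv.getElem_inj_iff (hi := by simpa using hi) (hj := by simpa using hj)]
    simpa [hi, hj] using h1

theorem Iso.skeleton {V W : Type*} [DecidableEq V] [DecidableEq W]
    {K : AbstractSimplicialComplex V} {M : AbstractSimplicialComplex W} (h : Iso K M) :
    Nonempty (skeleton K ≃g skeleton M) := by
  obtain ⟨e, he⟩ := h
  refine ⟨⟨e, fun {a b} => ?_⟩⟩
  change e a ≠ e b ∧ _ ↔ a ≠ b ∧ _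
  rw [he {a, b}]
  simp

/-- Different members have non-isomorphic skeletons, hence are themselves non-isomorphic; one list
thus counts the classes of complexes and the classes of graphs. -/
theorem IsCompleteList.mu_eq {m : ℕ} {K : Fin m → AbstractSimplicialComplex (Fin n)}
    (h : IsCompleteList K) : mu n = m := by
  have hb : Function.Bijective fun i : Fin m =>
      (Quotient.mk (isoSetoid n) ⟨K i, h.1 i⟩ : Quotient (isoSetoid n)) := by
    refine ⟨fun i j hij => h.2.2 i j (Iso.skeleton (Quotient.exact hij)), fun q => ?_⟩
    induction q using Quotient.inductionOn with
    | h M =>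
      obtain ⟨i, hi⟩ := h.2.1 M.1 M.2
      exact ⟨i, Quotient.sound hi.symm⟩
  rw [mu, ← Nat.card_eq_of_bijective _ hb, Nat.card_fin]

theorem IsCompleteList.muGraph_eq {m : ℕ} {K : Fin m → AbstractSimplicialComplex (Fin n)}
    (h : IsCompleteList K) : muGraph n = m := by
  have hb : Function.Bijective fun i : Fin m =>
      (Quotient.mk (skeletonSetoid n) ⟨K i, h.1 i⟩ : Quotient (skeletonSetoid n)) := by
    refine ⟨fun i j hij => h.2.2 i j (Quotient.exact hij), fun q => ?_⟩
    induction q using Quotient.inductionOn with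
    | h M =>
      obtain ⟨i, hi⟩ := h.2.1 M.1 M.2
      exact ⟨i, Quotient.sound hi.symm.skeleton⟩
  rw [muGraph, ← Nat.card_eq_of_bijective _ hb, Nat.card_fin]

end Complete

/-! ### Insertion of a vertex. -/

section Insertion

variable {n : ℕ} [NeZero n]

/-- The triangles in `M` are, after the relabelling `g`, obtained from those in `L` by replacing
`old` by `new`. -/
def insertionCheck (L M : List (ℕ × ℕ × ℕ)) (old : Finset (Finset (Fin n)))
    (new : Finset (Finset (Option (Fin n)))) (g : Option (Fin n) → Fin (n + 1)) : Prop :=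
  old ⊆ (L.map (tri (Fin.ofNat n))).toFinset ∧
    (∀ t ∈ (L.map (tri (Fin.ofNat n))).toFinset, t.card = 3) ∧ (∀ t ∈ new, t.card = 3) ∧
    (∀ v : Fin (n + 1), ∃ w, g w = v) ∧
    (((L.map (tri (Fin.ofNat n))).toFinset \ old).image (Finset.image some) ∪ new).image
      (Finset.image g) = (M.map (tri (Fin.ofNat (n + 1)))).toFinset

instance (L M : List (ℕ × ℕ × ℕ)) (old : Finset (Finset (Fin n)))
    (new : Finset (Finset (Option (Fin n)))) (g : Option (Fin n) → Fin (n + 1)) :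
    Decidable (insertionCheck L M old new g) :=
  inferInstanceAs (Decidable (_ ∧ _))

/-- The intermediate complex is generated directly by the replaced set of triangles on `Option (Fin
n)`. Its vertices are all covered because `g` carries this set bijectively to the triangles of `K'`.
-/
theorem Generates.exists_replaces {L M : List (ℕ × ℕ × ℕ)} {K : AbstractSimplicialComplex (Fin n)}
    {K' : AbstractSimplicialComplex (Fin (n + 1))} (hK : Generates L K) (hK' : Generates M K')
    {old : Finset (Finset (Fin n))} {new : Finset (Finset (Option (Fin n)))}
    {g : Option (Fin n) → Fin (n + 1)} (h : insertionCheck L M old new g) :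
    ∃ N : AbstractSimplicialComplex (Option (Fin n)), Iso N K' ∧ Replaces K N old new := by
  obtain ⟨hold, hL3, hnew, hg, hM⟩ := h
  have hbij : Function.Bijective g := by
    rw [Fintype.bijective_iff_surjective_and_card]
    exact ⟨hg, by simp⟩
  set TL := (L.map (tri (Fin.ofNat n))).toFinset with hTL
  set TN := (TL \ old).image (Finset.image some) ∪ new with hTN
  have hcover : ∀ v, ∃ t ∈ TN, v ∈ t := fun v => by
    have h1 : {g v} ∈ K' := K'.singleton_mem (g v)
    obtain ⟨-, t, ht, hvt⟩ := (hK'.generatedBy _).1 h1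
    rw [← hM, Finset.mem_image] at ht
    obtain ⟨u, hu, rfl⟩ := ht
    refine ⟨u, hu, ?_⟩
    simpa [hbij.1.eq_iff] using hvt
  refine ⟨ofTriangles TN hcover, (generatedBy_ofTriangles TN hcover).iso hK'.generatedBy
    (Equiv.ofBijective g hbij) hM, ?_, ?_⟩
  · rw [hK.generatedBy.triangles_eq hL3]
    exact_mod_cast hold
  · have hN3 : ∀ t ∈ TN, t.card = 3 := fun t ht => by
      rcases Finset.mem_union.1 ht with ht | ht
      · obtain ⟨u, hu, rfl⟩ := Finset.mem_image.1 ht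
        rw [Finset.card_image_of_injective _ (Option.some_injective _)]
        exact hL3 u (Finset.mem_sdiff.1 hu).1
      · exact hnew t ht
    rw [hK.generatedBy.triangles_eq hL3, (generatedBy_ofTriangles TN hcover).triangles_eq hN3, hTN,
      Finset.coe_union, Finset.coe_image, Finset.coe_sdiff]
    congr 1
    refine Set.image_congr fun s _ => ?_
    rw [Finset.map_eq_image]
    rfl

theorem Generates.exists_faceInsertion {L M : List (ℕ × ℕ × ℕ)}
    {K : AbstractSimplicialComplex (Fin n)} {K' : AbstractSimplicialComplex (Fin (n + 1))}
    (hK : Generates L K) (hK' : Generates M K') (a b c : Fin n)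
    (g : Option (Fin n) → Fin (n + 1))
    (h : [a, b, c].Nodup ∧ insertionCheck L M {{a, b, c}}
      {{none, some a, some b}, {none, some b, some c}, {none, some c, some a}} g) :
    ∃ N : AbstractSimplicialComplex (Option (Fin n)), Iso N K' ∧ FaceInsertion K N := by
  obtain ⟨N, hN, hr⟩ := hK.exists_replaces hK' h.2
  push_cast at hr
  exact ⟨N, hN, a, b, c, h.1, hr⟩

theorem Generates.exists_edgeInsertion {L M : List (ℕ × ℕ × ℕ)}
    {K : AbstractSimplicialComplex (Fin n)} {K' : AbstractSimplicialComplex (Fin (n + 1))}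
    (hK : Generates L K) (hK' : Generates M K') (a b c d : Fin n)
    (g : Option (Fin n) → Fin (n + 1))
    (h : [a, b, c, d].Nodup ∧ insertionCheck L M {{a, b, c}, {a, c, d}}
      {{none, some a, some b}, {none, some b, some c}, {none, some c, some d},
        {none, some d, some a}} g) :
    ∃ N : AbstractSimplicialComplex (Option (Fin n)), Iso N K' ∧ EdgeInsertion K N := by
  obtain ⟨N, hN, hr⟩ := hK.exists_replaces hK' h.2
  push_cast at hr
  exact ⟨N, hN, a, b, c, d, h.1, hr⟩

/-- The complex `K'` arises from a triangulation of the sphere by inserting one vertex. -/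
def ArisesByInsertion {n : ℕ} (K' : AbstractSimplicialComplex (Fin (n + 1))) : Prop :=
  ∃ (K : AbstractSimplicialComplex (Fin n)) (L : AbstractSimplicialComplex (Option (Fin n))),
    IsSphereTriangulation K ∧ Iso L K' ∧
      (FaceInsertion K L ∨ EdgeInsertion K L ∨ PentagonInsertion K L)

omit [NeZero n] in
theorem IsSphereTriangulation.arises_of_face {K : AbstractSimplicialComplex (Fin n)}
    {K' M : AbstractSimplicialComplex (Fin (n + 1))} (hK : IsSphereTriangulation K)
    (h : ∃ N : AbstractSimplicialComplex (Option (Fin n)), Iso N M ∧ FaceInsertion K N)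
    (hM : Iso K' M) : ArisesByInsertion K' := by
  obtain ⟨N, hN, hi⟩ := h
  exact ⟨K, N, hK, hN.trans hM.symm, Or.inl hi⟩

omit [NeZero n] in
theorem IsSphereTriangulation.arises_of_edge {K : AbstractSimplicialComplex (Fin n)}
    {K' M : AbstractSimplicialComplex (Fin (n + 1))} (hK : IsSphereTriangulation K)
    (h : ∃ N : AbstractSimplicialComplex (Option (Fin n)), Iso N M ∧ EdgeInsertion K N)
    (hM : Iso K' M) : ArisesByInsertion K' := by
  obtain ⟨N, hN, hi⟩ := h
  exact ⟨K, N, hK, hN.trans hM.symm, Or.inr (Or.inl hi)⟩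

end Insertion

end SphereTri

/-! ### Certificates for the lists with 4 to 8 vertices, and the insertions that produce them. -/

namespace SphereTri

section Lists

set_option maxRecDepth 100000

/-- The triangles of the triangulations with 4 vertices. -/
def triangleLists4 : List (List (ℕ × ℕ × ℕ)) :=
  [[(0, 1, 2), (0, 1, 3), (0, 2, 3), (1, 2, 3)]]

/-- The isomorphisms of the triangulations found by the search with members of
`triangleLists4`. -/
def searchLabels4 : List ℕ :=
  [209]

/-- The bound is `2 n - 4` triangles, and 60 limits the depth of the recursion. The empty result
says that each recorded isomorphism was used. Here 209 is 0321 in octal; read from the last digit it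
sends 0, 1, 2, 3 to 1, 2, 3, 0. -/
theorem search_triangleLists4 : search 4 4 triangleLists4 60 [(0, 1, 2)]
    [(0, 1, 2), (0, 2, 1), (1, 2, 0)] 3 searchLabels4 = some [] := by
  decide +kernel

theorem generates_G4 : Generates (triangleLists4.getD 0 []) G4 :=
  generates_ofTriangles (by decide +kernel)

/-- The integer points realize the complex as the boundary of a convex polytope around the origin.
Their choice is a certificate without further meaning; the same holds for the other complexes. -/
theorem isSphereTriangulation_G4 : IsSphereTriangulation G4 :=
  generates_G4.isSphereTriangulation (P :=
    [(0, 1, 0), (1, 0, 1), (0, -1, -1), (-1, -1, 1)])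
    (by decide +kernel)

theorem isCompleteList_4 : IsCompleteList ![G4] := by
  refine isCompleteList_of_search (G := triangleLists4) rfl (fun i => ?_) (fun i => ?_)
    (by decide +kernel) (by decide) search_triangleLists4 ?_
  · fin_cases i
    exacts [generates_G4]
  · fin_cases i
    exacts [isSphereTriangulation_G4]
  · have h : (triangleLists4.map fun L => graphInvariant (edgeGraph 4 L)) =
        [324] := by
      decide +kernel
    rw [h]
    decide

/-- The triangles of the triangulations with 5 vertices. -/
def triangleLists5 : List (List (ℕ × ℕ × ℕ)) :=
  [[(0, 2, 3), (0, 2, 4), (0, 3, 4), (1, 2, 3), (1, 2, 4), (1, 3, 4)]]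

/-- The isomorphisms of the triangulations found by the search with members of
`triangleLists5`. -/
def searchLabels5 : List ℕ :=
  [5764, 6163, 9740]

theorem search_triangleLists5 : search 5 6 triangleLists5 60 [(0, 1, 2)]
    [(0, 1, 2), (0, 2, 1), (1, 2, 0)] 3 searchLabels5 = some [] := by
  decide +kernel

theorem generates_G5 : Generates (triangleLists5.getD 0 []) G5 :=
  generates_ofTriangles (by decide +kernel)

theorem isSphereTriangulation_G5 : IsSphereTriangulation G5 :=
  generates_G5.isSphereTriangulation (P :=
    [(-1, 1, 1), (1, 0, 0), (-1, -1, 0), (0, 0, -1), (1, 1, 1)])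
    (by decide +kernel)

theorem isCompleteList_5 : IsCompleteList ![G5] := by
  refine isCompleteList_of_search (G := triangleLists5) rfl (fun i => ?_) (fun i => ?_)
    (by decide +kernel) (by decide) search_triangleLists5 ?_
  · fin_cases i
    exacts [generates_G5]
  · fin_cases i
    exacts [isSphereTriangulation_G5]
  · have h : (triangleLists5.map fun L => graphInvariant (edgeGraph 5 L)) =
        [888] := by
      decide +kernel
    rw [h]
    decide

/-- The triangles of the triangulations with 6 vertices. -/
def triangleLists6 : List (List (ℕ × ℕ × ℕ)) :=
  [[(0, 1, 2), (0, 1, 3), (0, 2, 4), (0, 3, 4), (1, 2, 5), (1, 3, 5), (2, 4, 5), (3, 4, 5)],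
   [(0, 2, 4), (0, 2, 5), (0, 4, 5), (1, 3, 4), (1, 3, 5), (1, 4, 5), (2, 3, 4), (2, 3, 5)]]

/-- The isomorphisms of the triangulations found by the search with members of
`triangleLists6`. -/
def searchLabels6 : List ℕ :=
  [16820456, 16886368, 16824488, 16912597, 16855596, 16827435, 172824, 16885801, 16941780,
   16812819, 16878241, 16794269, 16844557]

theorem search_triangleLists6 : search 6 8 triangleLists6 60 [(0, 1, 2)]
    [(0, 1, 2), (0, 2, 1), (1, 2, 0)] 3 searchLabels6 = some [] := by
  decide +kernel

theorem generates_G6_1 : Generates (triangleLists6.getD 0 []) G6_1 :=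
  generates_ofTriangles (by decide +kernel)

theorem isSphereTriangulation_G6_1 : IsSphereTriangulation G6_1 :=
  generates_G6_1.isSphereTriangulation (P :=
    [(1, 0, 0), (-1, -1, 1), (0, 1, 1), (-1, -1, 0), (0, 0, -1), (-1, 1, 1)])
    (by decide +kernel)

theorem generates_G6_2 : Generates (triangleLists6.getD 1 []) G6_2 :=
  generates_ofTriangles (by decide +kernel)

theorem isSphereTriangulation_G6_2 : IsSphereTriangulation G6_2 :=
  generates_G6_2.isSphereTriangulation (P :=
    [(-1, 0, -1), (0, 0, 1), (0, -1, 0), (1, -1, 1), (-1, 0, 1), (1, 1, -1)])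
    (by decide +kernel)

theorem isCompleteList_6 : IsCompleteList ![G6_1, G6_2] := by
  refine isCompleteList_of_search (G := triangleLists6) rfl (fun i => ?_) (fun i => ?_)
    (by decide +kernel) (by decide) search_triangleLists6 ?_
  · fin_cases i
    exacts [generates_G6_1, generates_G6_2]
  · fin_cases i
    exacts [isSphereTriangulation_G6_1, isSphereTriangulation_G6_2]
  · have h : (triangleLists6.map fun L => graphInvariant (edgeGraph 6 L)) =
        [1536, 1746] := by
      decide +kernel
    rw [h]
    decide

/-- The triangles of the triangulations with 7 vertices. -/
def triangleLists7 : List (List (ℕ × ℕ × ℕ)) :=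
  [[(0, 4, 5), (0, 4, 6), (0, 5, 6), (1, 2, 3), (1, 2, 4), (1, 3, 5), (1, 4, 5), (2, 3, 6),
    (2, 4, 6), (3, 5, 6)],
   [(0, 1, 5), (0, 1, 6), (0, 2, 5), (0, 2, 6), (1, 3, 5), (1, 3, 6), (2, 4, 5), (2, 4, 6),
    (3, 4, 5), (3, 4, 6)],
   [(0, 2, 4), (0, 2, 6), (0, 4, 6), (1, 3, 5), (1, 3, 6), (1, 5, 6), (2, 4, 5), (2, 5, 6),
    (3, 4, 5), (3, 4, 6)],
   [(0, 2, 5), (0, 2, 6), (0, 5, 6), (1, 3, 5), (1, 3, 6), (1, 5, 6), (2, 4, 5), (2, 4, 6),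
    (3, 4, 5), (3, 4, 6)],
   [(0, 3, 4), (0, 3, 6), (0, 4, 6), (1, 3, 5), (1, 3, 6), (1, 5, 6), (2, 4, 5), (2, 4, 6),
    (2, 5, 6), (3, 4, 5)]]

/-- The isomorphisms of the triangulations found by the search with members of
`triangleLists7`. -/
def searchLabels7 : List ℕ :=
  [50678512, 33959144, 34129734, 34198278, 67487046, 67688324, 33962672, 371616, 34547816,
   51210848, 34479272, 68068144, 50711216, 33960278, 51428394, 34708018, 34384436, 50961452,
   34126388, 33901107, 51414254, 435750, 50956398, 1415302, 17427040, 51202609, 34644381,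
   50735667, 1713733, 17194136, 34193805, 1225742, 34482737, 34965618, 33949554, 68465044,
   67551635, 1346842, 34407284, 34506929, 34608366, 34093166, 658525, 68198813, 67748237,
   34899188, 33981747, 1412236, 68067745, 396459, 34612062, 34096974, 18360931, 855337, 51917589,
   33764180, 67168413, 33610964, 50617619, 33765545, 51145377, 51389341, 33697001, 51647732,
   33609886, 67228942, 33694558, 50874190]

theorem search_triangleLists7 : search 7 10 triangleLists7 60 [(0, 1, 2)]
    [(0, 1, 2), (0, 2, 1), (1, 2, 0)] 3 searchLabels7 = some [] := by
  decide +kernel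

theorem generates_G7_1 : Generates (triangleLists7.getD 0 []) G7_1 :=
  generates_ofTriangles (by decide +kernel)

theorem isSphereTriangulation_G7_1 : IsSphereTriangulation G7_1 :=
  generates_G7_1.isSphereTriangulation (P :=
    [(0, -1, 1), (0, -1, -2), (-1, 2, 0), (-2, -1, -1), (2, 0, -2), (-1, -2, -1), (-2, 1, 2)])
    (by decide +kernel)

theorem generates_G7_2 : Generates (triangleLists7.getD 1 []) G7_2 :=
  generates_ofTriangles (by decide +kernel)

theorem isSphereTriangulation_G7_2 : IsSphereTriangulation G7_2 :=
  generates_G7_2.isSphereTriangulation (P :=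
    [(-1, -2, -2), (2, 0, 1), (-2, 1, -2), (1, 2, 0), (1, 2, -1), (-2, 2, 2), (2, 1, -2)])
    (by decide +kernel)

theorem generates_G7_3 : Generates (triangleLists7.getD 2 []) G7_3 :=
  generates_ofTriangles (by decide +kernel)

theorem isSphereTriangulation_G7_3 : IsSphereTriangulation G7_3 :=
  generates_G7_3.isSphereTriangulation (P :=
    [(2, 1, 0), (-2, 1, -1), (2, -2, 0), (1, 2, -2), (2, 2, -2), (-1, -2, -1), (-1, 2, 2)])
    (by decide +kernel)

theorem generates_G7_4 : Generates (triangleLists7.getD 3 []) G7_4 :=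
  generates_ofTriangles (by decide +kernel)

theorem isSphereTriangulation_G7_4 : IsSphereTriangulation G7_4 :=
  generates_G7_4.isSphereTriangulation (P :=
    [(2, 2, 0), (1, -2, -1), (0, 1, 2), (-1, -1, 1), (-1, 0, 2), (-2, 0, -1), (2, -2, -1)])
    (by decide +kernel)

theorem generates_G7_5 : Generates (triangleLists7.getD 4 []) G7_5 :=
  generates_ofTriangles (by decide +kernel)

theorem isSphereTriangulation_G7_5 : IsSphereTriangulation G7_5 :=
  generates_G7_5.isSphereTriangulation (P :=
    [(-1, 0, 1), (0, 1, -1), (1, -1, 0), (-1, 1, -1), (-1, -1, 1), (1, -1, -1), (1, 1, 1)])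
    (by decide +kernel)

theorem isCompleteList_7 : IsCompleteList ![G7_1, G7_2, G7_3, G7_4, G7_5] := by
  refine isCompleteList_of_search (G := triangleLists7) rfl (fun i => ?_) (fun i => ?_)
    (by decide +kernel) (by decide) search_triangleLists7 ?_
  · fin_cases i
    exacts [generates_G7_1, generates_G7_2, generates_G7_3, generates_G7_4, generates_G7_5]
  · fin_cases i
    exacts [isSphereTriangulation_G7_1, isSphereTriangulation_G7_2, isSphereTriangulation_G7_3,
      isSphereTriangulation_G7_4, isSphereTriangulation_G7_5]
  · have h : (triangleLists7.map fun L => graphInvariant (edgeGraph 7 L)) =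
        [2574, 2440, 2842, 2944, 2946] := by
      decide +kernel
    rw [h]
    decide

/-- The triangles of the triangulations with 8 vertices. -/
def triangleLists8 : List (List (ℕ × ℕ × ℕ)) :=
  [[(0, 4, 5), (0, 4, 6), (0, 5, 6), (1, 4, 5), (1, 4, 7), (1, 5, 7), (2, 4, 6), (2, 4, 7),
    (2, 6, 7), (3, 5, 6), (3, 5, 7), (3, 6, 7)],
   [(0, 3, 5), (0, 3, 6), (0, 5, 6), (1, 4, 5), (1, 4, 7), (1, 5, 7), (2, 4, 6), (2, 4, 7),
    (2, 6, 7), (3, 5, 7), (3, 6, 7), (4, 5, 6)],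
   [(0, 3, 6), (0, 3, 7), (0, 6, 7), (1, 4, 5), (1, 4, 7), (1, 5, 7), (2, 4, 6), (2, 4, 7),
    (2, 6, 7), (3, 5, 6), (3, 5, 7), (4, 5, 6)],
   [(0, 2, 6), (0, 2, 7), (0, 6, 7), (1, 3, 6), (1, 3, 7), (1, 6, 7), (2, 4, 6), (2, 4, 7),
    (3, 5, 6), (3, 5, 7), (4, 5, 6), (4, 5, 7)],
   [(0, 2, 5), (0, 2, 7), (0, 5, 7), (1, 3, 6), (1, 3, 7), (1, 6, 7), (2, 5, 6), (2, 6, 7),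
    (3, 4, 6), (3, 4, 7), (4, 5, 6), (4, 5, 7)],
   [(0, 2, 4), (0, 2, 7), (0, 4, 7), (1, 3, 5), (1, 3, 7), (1, 5, 7), (2, 4, 6), (2, 6, 7),
    (3, 5, 6), (3, 6, 7), (4, 5, 6), (4, 5, 7)],
   [(0, 4, 6), (0, 4, 7), (0, 6, 7), (1, 5, 6), (1, 5, 7), (1, 6, 7), (2, 3, 4), (2, 3, 5),
    (2, 4, 6), (2, 5, 6), (3, 4, 7), (3, 5, 7)],
   [(0, 2, 4), (0, 2, 6), (0, 4, 6), (1, 3, 5), (1, 3, 7), (1, 5, 7), (2, 4, 7), (2, 6, 7),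
    (3, 5, 6), (3, 6, 7), (4, 5, 6), (4, 5, 7)],
   [(0, 3, 4), (0, 3, 7), (0, 4, 7), (1, 5, 6), (1, 5, 7), (1, 6, 7), (2, 3, 4), (2, 3, 5),
    (2, 4, 6), (2, 5, 6), (3, 5, 7), (4, 6, 7)],
   [(0, 2, 3), (0, 2, 4), (0, 3, 4), (1, 5, 6), (1, 5, 7), (1, 6, 7), (2, 3, 5), (2, 4, 6),
    (2, 5, 6), (3, 4, 7), (3, 5, 7), (4, 6, 7)],
   [(0, 1, 6), (0, 1, 7), (0, 6, 7), (1, 5, 6), (1, 5, 7), (2, 3, 4), (2, 3, 5), (2, 4, 6),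
    (2, 5, 6), (3, 4, 7), (3, 5, 7), (4, 6, 7)],
   [(0, 4, 5), (0, 4, 7), (0, 5, 7), (1, 2, 6), (1, 2, 7), (1, 3, 6), (1, 3, 7), (2, 4, 6),
    (2, 4, 7), (3, 5, 6), (3, 5, 7), (4, 5, 6)],
   [(0, 1, 6), (0, 1, 7), (0, 2, 6), (0, 2, 7), (1, 3, 6), (1, 3, 7), (2, 4, 6), (2, 4, 7),
    (3, 5, 6), (3, 5, 7), (4, 5, 6), (4, 5, 7)],
   [(0, 1, 4), (0, 1, 5), (0, 4, 6), (0, 5, 6), (1, 4, 7), (1, 5, 7), (2, 3, 6), (2, 3, 7),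
    (2, 4, 6), (2, 4, 7), (3, 5, 6), (3, 5, 7)]]

/-- The isomorphisms of the triangulations found by the search with members of
`triangleLists8`. -/
def searchLabels8 : List ℕ :=
  [53136632, 71747526, 69912455, 87239416, 38164464, 36333544, 170556312, 89184135, 126331632,
   70352104, 122738630, 25519992, 72408312, 89506695, 72732272, 123061127, 19545135, 36781894,
   36322351, 38190119, 39164295, 36809670, 103496504, 187804656, 70376632, 138799431, 22331142,
   39107847, 87211696, 137868592, 190159288, 126270648, 153967879, 130951800, 72278791, 30229368,
   38753080, 174803912, 20032965, 126819000, 24451463, 36579902, 103722800, 6728743, 36591032,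
   22649285, 38738492, 25552360, 141763560, 24423687, 70174087, 107650528, 170815312, 192747944,
   75319920, 92154984, 40620848, 74150661, 57375328, 91462320, 74513576, 41201414, 73844166,
   41490885, 40573500, 40265192, 40283175, 53398712, 70147130, 124177970, 86953018, 70463831,
   24170938, 36823418, 176545218, 124951610, 76001622, 59227178, 93232690, 42328442, 76340282,
   73751612, 124080614, 90526119, 74125671, 19517884, 40427900, 120241212, 172809668, 72323430,
   55548972, 88522292, 38592892, 71687228, 69884987, 86691379, 122080315, 70322039, 70354351,
   53491182, 75859375, 170559287, 178599998, 178832951, 72124847, 57154030, 73959855, 174491831,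
   104177975, 191568423, 57281143, 189733415, 206535264, 57299343, 175423678, 178628663,
   191615750, 228933536, 74105294, 189747975, 72270223, 126411103, 36786619, 21389803, 70427039,
   171011907, 75827133, 53545719, 181016111, 187870239, 113907247, 187913863, 231264088, 72221629,
   89252175, 145859127, 74056574, 191548942, 112071735, 40522225, 147927599, 187906583, 189746701,
   38691305, 229514704, 233942344, 174751041, 175509687, 91401273, 92860766, 76086315, 75932126,
   42295787, 53652539, 178073710, 176916085, 193451654, 193408541, 204693144, 122810702, 72481833,
   179413566, 126791217, 114373167, 193411607, 26042857, 175276727, 74538041, 128730007, 78401138,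
   95175575, 126193018, 70270834, 87133562, 28085527, 44833175, 36722583, 138006842, 187862266,
   36867287, 153271575, 44404390, 44862743, 37097118, 111642866, 195857722, 20319391, 144992471,
   90738044, 73932660, 122457468, 90351735, 91506063, 74731185, 125060495, 120687805, 75775669,
   92638397, 124292413, 72097589, 88902973, 144285821, 42215343, 163948605, 42274031, 193268989,
   21892207, 38552495, 105935598, 189664381, 42504030, 140034301, 25496815, 38899534, 38669423,
   120917244, 94418231, 87362875, 86164727, 44316134, 36980190, 171210518, 164156988, 40391591,
   142135484, 191532156, 40537191, 179070055, 41167247, 170943839, 137970043, 92347127, 88226423,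
   42474462, 176715374, 38812622, 197204711, 174614863, 197236911, 230795641, 107505999,
   230737275, 104007035, 227048345, 193498995, 189894513, 76045435, 72375545, 197278295,
   141060431, 94703348, 77868284, 128257843, 70528315, 146616436, 195399348, 24448782, 112133244,
   41225487, 166369331, 188092083, 126374878, 89151438, 199403614, 229084323, 139229966,
   230863996, 192220473, 142895775, 92820383, 122705807, 197313743, 155311375, 79835991,
   123922554, 46252922, 24663010, 180477706, 17196719, 18029271, 118799639, 69360855, 170049330,
   27540962, 35835130, 46241981, 30153684, 12979883, 113385194, 20211668, 35842235, 135845844,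
   102977363, 186587874, 118433903, 130169529, 73493095, 73590031, 30164457, 40064313, 174280529,
   75541743, 118111343, 176242293, 42015997, 22035917, 75703135, 118581071, 77698359, 117884151,
   44086590, 20202974, 178310870, 18196879, 17650487, 118561527, 71420535, 172105454, 25697246,
   37894782, 186558558, 111230580, 135321054, 44083132, 27535859, 104980238, 5607308, 21124027,
   37902265, 79739055, 119118503, 17253615, 117892775, 69425311, 180465253, 24652237, 174268076,
   40053372, 109112989, 42034043, 25257849, 186598605, 135476713, 178319004, 170045347, 77666215,
   118794655, 18169103, 118117279, 71485327, 186563668, 107044748, 186522291, 168910283,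
   168455129, 216214115, 186493353, 65157746, 69088149, 35509154, 84899946, 68151906, 35527326,
   34839765, 34928532, 34011315, 68729322, 85564386, 34033386, 67563220, 52649747, 69061297,
   85867689, 34592049, 68121869, 56851105, 68395870, 85030734, 58815389, 68254953, 60890868,
   68464435, 34946830, 84562910, 67815374, 63019183, 68785532, 35177823, 84338343, 67590303,
   35236301, 34548348, 34694011, 34236393, 68491175, 85240223, 34258023, 67787899, 51009423]

theorem search_triangleLists8 : search 8 12 triangleLists8 60 [(0, 1, 2)]
    [(0, 1, 2), (0, 2, 1), (1, 2, 0)] 3 searchLabels8 = some [] := by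
  decide +kernel

theorem generates_G8_3 : Generates (triangleLists8.getD 0 []) G8_3 :=
  generates_ofTriangles (by decide +kernel)

theorem isSphereTriangulation_G8_3 : IsSphereTriangulation G8_3 :=
  generates_G8_3.isSphereTriangulation (P :=
    [(1, -2, -2), (-1, 0, 1), (-1, 1, 0), (2, 2, 1), (-2, -1, -2), (2, -2, 0), (2, 2, 0),
     (-2, 2, 2)])
    (by decide +kernel)

theorem generates_G8_2 : Generates (triangleLists8.getD 1 []) G8_2 :=
  generates_ofTriangles (by decide +kernel)

theorem isSphereTriangulation_G8_2 : IsSphereTriangulation G8_2 :=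
  generates_G8_2.isSphereTriangulation (P :=
    [(-1, 0, 1), (-2, -1, -1), (0, -2, -1), (2, 1, 0), (-2, -2, -1), (-2, 1, 1), (0, -2, 1),
     (2, 0, -2)])
    (by decide +kernel)

theorem generates_G8_1 : Generates (triangleLists8.getD 2 []) G8_1 :=
  generates_ofTriangles (by decide +kernel)

theorem isSphereTriangulation_G8_1 : IsSphereTriangulation G8_1 :=
  generates_G8_1.isSphereTriangulation (P :=
    [(0, 0, -2), (1, 1, 2), (2, 1, -1), (-1, 1, -1), (2, -1, 2), (-2, 2, 2), (0, -2, -1),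
     (2, 2, -2)])
    (by decide +kernel)

theorem generates_G8_14 : Generates (triangleLists8.getD 3 []) G8_14 :=
  generates_ofTriangles (by decide +kernel)

theorem isSphereTriangulation_G8_14 : IsSphereTriangulation G8_14 :=
  generates_G8_14.isSphereTriangulation (P :=
    [(-1, -2, 1), (1, 0, 2), (-2, -2, 0), (1, 2, 0), (-1, -1, -1), (1, 2, -1), (2, -2, 2),
     (-1, 1, 2)])
    (by decide +kernel)

theorem generates_G8_10 : Generates (triangleLists8.getD 4 []) G8_10 :=
  generates_ofTriangles (by decide +kernel)

theorem isSphereTriangulation_G8_10 : IsSphereTriangulation G8_10 :=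
  generates_G8_10.isSphereTriangulation (P :=
    [(2, 1, 1), (-2, -1, 1), (2, 2, 1), (-2, -1, 0), (-1, -1, -2), (1, 1, -1), (-1, 2, 2),
     (2, -2, 2)])
    (by decide +kernel)

theorem generates_G8_16 : Generates (triangleLists8.getD 5 []) G8_16 :=
  generates_ofTriangles (by decide +kernel)

theorem isSphereTriangulation_G8_16 : IsSphereTriangulation G8_16 :=
  generates_G8_16.isSphereTriangulation (P :=
    [(-1, 1, 1), (0, -1, -2), (1, 2, 2), (1, -1, -2), (-2, 2, 0), (-2, 1, -2), (2, 2, 1),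
     (0, -2, 1)])
    (by decide +kernel)

theorem generates_G8_4 : Generates (triangleLists8.getD 6 []) G8_4 :=
  generates_ofTriangles (by decide +kernel)

theorem isSphereTriangulation_G8_4 : IsSphereTriangulation G8_4 :=
  generates_G8_4.isSphereTriangulation (P :=
    [(-1, -2, 2), (1, 1, -1), (-2, 1, -2), (-1, 0, -2), (-2, -2, 1), (0, 2, -2), (2, 2, 2),
     (2, -2, -1)])
    (by decide +kernel)

theorem generates_G8_27 : Generates (triangleLists8.getD 7 []) G8_27 :=
  generates_ofTriangles (by decide +kernel)

theorem isSphereTriangulation_G8_27 : IsSphereTriangulation G8_27 :=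
  generates_G8_27.isSphereTriangulation (P :=
    [(2, -2, 0), (-1, 1, 1), (1, -2, -1), (0, 2, 1), (-1, -2, 2), (-2, -1, 2), (2, 2, 1),
     (-1, -1, -1)])
    (by decide +kernel)

theorem generates_G8_9 : Generates (triangleLists8.getD 8 []) G8_9 :=
  generates_ofTriangles (by decide +kernel)

theorem isSphereTriangulation_G8_9 : IsSphereTriangulation G8_9 :=
  generates_G8_9.isSphereTriangulation (P :=
    [(0, -2, 0), (2, 0, -1), (0, 1, 1), (1, -2, 1), (-1, 0, 0), (2, 2, 2), (1, 2, 0), (2, -1, -2)])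
    (by decide +kernel)

theorem generates_G8_39 : Generates (triangleLists8.getD 9 []) G8_39 :=
  generates_ofTriangles (by decide +kernel)

theorem isSphereTriangulation_G8_39 : IsSphereTriangulation G8_39 :=
  generates_G8_39.isSphereTriangulation (P :=
    [(0, 1, 2), (0, 1, -1), (0, -2, 0), (1, 2, 2), (-2, 0, 2), (2, 1, -2), (-2, -2, -2),
     (-2, 2, 1)])
    (by decide +kernel)

theorem generates_G8_11 : Generates (triangleLists8.getD 10 []) G8_11 :=
  generates_ofTriangles (by decide +kernel)

theorem isSphereTriangulation_G8_11 : IsSphereTriangulation G8_11 :=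
  generates_G8_11.isSphereTriangulation (P :=
    [(-1, 2, -1), (-1, 1, -2), (1, -2, 1), (2, 1, 1), (2, 1, 2), (0, -1, -2), (-2, 2, 0),
     (2, 2, 1)])
    (by decide +kernel)

theorem generates_G8_6 : Generates (triangleLists8.getD 11 []) G8_6 :=
  generates_ofTriangles (by decide +kernel)

theorem isSphereTriangulation_G8_6 : IsSphereTriangulation G8_6 :=
  generates_G8_6.isSphereTriangulation (P :=
    [(0, 1, 2), (-1, -1, -1), (1, 0, -2), (-2, 0, 0), (1, 1, 0), (-1, 2, 2), (-2, 2, 0),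
     (0, -2, 1)])
    (by decide +kernel)

theorem generates_G8_13 : Generates (triangleLists8.getD 12 []) G8_13 :=
  generates_ofTriangles (by decide +kernel)

theorem isSphereTriangulation_G8_13 : IsSphereTriangulation G8_13 :=
  generates_G8_13.isSphereTriangulation (P :=
    [(1, 1, 0), (0, 1, -1), (1, 0, 1), (-1, 0, -2), (-2, -2, 2), (-2, -2, -2), (-1, 1, 0),
     (1, -1, -2)])
    (by decide +kernel)

theorem generates_G8_28 : Generates (triangleLists8.getD 13 []) G8_28 :=
  generates_ofTriangles (by decide +kernel)

theorem isSphereTriangulation_G8_28 : IsSphereTriangulation G8_28 :=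
  generates_G8_28.isSphereTriangulation (P :=
    [(-2, 1, -1), (-1, -1, 0), (2, 0, -2), (2, 0, 2), (1, 0, -2), (-1, 1, 2), (-2, 2, -1),
     (1, -2, 1)])
    (by decide +kernel)

theorem isCompleteList_8 : IsCompleteList ![G8_3, G8_2, G8_1, G8_14, G8_10, G8_16, G8_4,
    G8_27, G8_9, G8_39, G8_11, G8_6, G8_13, G8_28] := by
  refine isCompleteList_of_search (G := triangleLists8) rfl (fun i => ?_) (fun i => ?_)
    (by decide +kernel) (by decide) search_triangleLists8 ?_
  · fin_cases i
    exacts [generates_G8_3, generates_G8_2, generates_G8_1, generates_G8_14, generates_G8_10,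
      generates_G8_16, generates_G8_4, generates_G8_27, generates_G8_9, generates_G8_39,
      generates_G8_11, generates_G8_6, generates_G8_13, generates_G8_28]
  · fin_cases i
    exacts [isSphereTriangulation_G8_3, isSphereTriangulation_G8_2, isSphereTriangulation_G8_1,
      isSphereTriangulation_G8_14, isSphereTriangulation_G8_10, isSphereTriangulation_G8_16,
      isSphereTriangulation_G8_4, isSphereTriangulation_G8_27, isSphereTriangulation_G8_9,
      isSphereTriangulation_G8_39, isSphereTriangulation_G8_11, isSphereTriangulation_G8_6,
      isSphereTriangulation_G8_13, isSphereTriangulation_G8_28]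
  -- The values 3968 and 4054 separate `G8_4` and `G8_27`, which have equal degree sequences: the
  -- invariant also sees which degrees are adjacent.
  · have h : (triangleLists8.map fun L => graphInvariant (edgeGraph 8 L)) =
        [4536, 4302, 4422, 4542, 4298, 4174, 3968, 4054, 3844, 3720, 3864, 3688, 3648, 3416] := by
      decide +kernel
    rw [h]
    decide

theorem arisesByInsertion_4 (K' : AbstractSimplicialComplex (Fin 5))
    (hK' : IsSphereTriangulation K') : ArisesByInsertion K' := by
  obtain ⟨i, hi⟩ := isCompleteList_5.2.1 K' hK'
  fin_cases i
  -- In this and all later cases the inserted vertex becomes vertex 0, which has degree 3 or 4 in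
  -- the larger complex; the vector lists the new names of the old vertices.
  · exact isSphereTriangulation_G4.arises_of_face
      (generates_G4.exists_faceInsertion generates_G5 0 1 2
        (fun v => v.elim 0 ![2, 3, 4, 1]) (by decide +kernel)) hi

theorem arisesByInsertion_5 (K' : AbstractSimplicialComplex (Fin 6))
    (hK' : IsSphereTriangulation K') : ArisesByInsertion K' := by
  obtain ⟨i, hi⟩ := isCompleteList_6.2.1 K' hK'
  fin_cases i
  · exact isSphereTriangulation_G5.arises_of_edge
      (generates_G5.exists_edgeInsertion generates_G6_1 2 0 4 1
        (fun v => v.elim 0 ![2, 3, 1, 5, 4]) (by decide +kernel)) hi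
  · exact isSphereTriangulation_G5.arises_of_face
      (generates_G5.exists_faceInsertion generates_G6_2 1 2 3
        (fun v => v.elim 0 ![1, 2, 4, 5, 3]) (by decide +kernel)) hi

theorem arisesByInsertion_6 (K' : AbstractSimplicialComplex (Fin 7))
    (hK' : IsSphereTriangulation K') : ArisesByInsertion K' := by
  obtain ⟨i, hi⟩ := isCompleteList_7.2.1 K' hK'
  fin_cases i
  · exact isSphereTriangulation_G6_1.arises_of_face
      (generates_G6_1.exists_faceInsertion generates_G7_1 1 2 5
        (fun v => v.elim 0 ![1, 4, 5, 2, 3, 6]) (by decide +kernel)) hi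
  · exact isSphereTriangulation_G6_1.arises_of_edge
      (generates_G6_1.exists_edgeInsertion generates_G7_2 4 3 0 2
        (fun v => v.elim 0 ![2, 4, 6, 5, 1, 3]) (by decide +kernel)) hi
  · exact isSphereTriangulation_G6_2.arises_of_face
      (generates_G6_2.exists_faceInsertion generates_G7_3 0 2 4
        (fun v => v.elim 0 ![2, 1, 4, 3, 6, 5]) (by decide +kernel)) hi
  · exact isSphereTriangulation_G6_2.arises_of_face
      (generates_G6_2.exists_faceInsertion generates_G7_4 0 5 4
        (fun v => v.elim 0 ![2, 1, 4, 3, 6, 5]) (by decide +kernel)) hi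
  · exact isSphereTriangulation_G6_2.arises_of_face
      (generates_G6_2.exists_faceInsertion generates_G7_5 3 2 4
        (fun v => v.elim 0 ![2, 1, 4, 3, 6, 5]) (by decide +kernel)) hi

theorem arisesByInsertion_7 (K' : AbstractSimplicialComplex (Fin 8))
    (hK' : IsSphereTriangulation K') : ArisesByInsertion K' := by
  obtain ⟨i, hi⟩ := isCompleteList_8.2.1 K' hK'
  fin_cases i
  · exact isSphereTriangulation_G7_5.arises_of_face
      (generates_G7_5.exists_faceInsertion generates_G8_3 3 4 5
        (fun v => v.elim 0 ![1, 2, 3, 4, 5, 6, 7]) (by decide +kernel)) hi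
  · exact isSphereTriangulation_G7_5.arises_of_face
      (generates_G7_5.exists_faceInsertion generates_G8_2 2 4 5
        (fun v => v.elim 0 ![1, 2, 3, 4, 5, 6, 7]) (by decide +kernel)) hi
  · exact isSphereTriangulation_G7_5.arises_of_face
      (generates_G7_5.exists_faceInsertion generates_G8_1 2 5 6
        (fun v => v.elim 0 ![1, 2, 3, 4, 5, 6, 7]) (by decide +kernel)) hi
  · exact isSphereTriangulation_G7_4.arises_of_face
      (generates_G7_4.exists_faceInsertion generates_G8_14 0 5 6
        (fun v => v.elim 0 ![2, 1, 4, 3, 5, 6, 7]) (by decide +kernel)) hi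
  · exact isSphereTriangulation_G7_4.arises_of_face
      (generates_G7_4.exists_faceInsertion generates_G8_10 1 3 5
        (fun v => v.elim 0 ![1, 2, 3, 5, 4, 7, 6]) (by decide +kernel)) hi
  · exact isSphereTriangulation_G7_3.arises_of_face
      (generates_G7_3.exists_faceInsertion generates_G8_16 0 2 6
        (fun v => v.elim 0 ![2, 1, 4, 3, 6, 5, 7]) (by decide +kernel)) hi
  · exact isSphereTriangulation_G7_1.arises_of_face
      (generates_G7_1.exists_faceInsertion generates_G8_4 3 6 5
        (fun v => v.elim 0 ![1, 3, 2, 4, 5, 7, 6]) (by decide +kernel)) hi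
  · exact isSphereTriangulation_G7_3.arises_of_face
      (generates_G7_3.exists_faceInsertion generates_G8_27 0 2 4
        (fun v => v.elim 0 ![2, 1, 4, 3, 6, 5, 7]) (by decide +kernel)) hi
  · exact isSphereTriangulation_G7_1.arises_of_face
      (generates_G7_1.exists_faceInsertion generates_G8_9 1 3 5
        (fun v => v.elim 0 ![1, 3, 2, 4, 5, 7, 6]) (by decide +kernel)) hi
  · exact isSphereTriangulation_G7_1.arises_of_face
      (generates_G7_1.exists_faceInsertion generates_G8_39 2 1 3
        (fun v => v.elim 0 ![1, 3, 2, 4, 5, 7, 6]) (by decide +kernel)) hi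
  · exact isSphereTriangulation_G7_1.arises_of_face
      (generates_G7_1.exists_faceInsertion generates_G8_11 0 6 5
        (fun v => v.elim 0 ![1, 3, 2, 4, 5, 7, 6]) (by decide +kernel)) hi
  · exact isSphereTriangulation_G7_2.arises_of_face
      (generates_G7_2.exists_faceInsertion generates_G8_6 3 1 5
        (fun v => v.elim 0 ![3, 5, 1, 4, 2, 7, 6]) (by decide +kernel)) hi
  · exact isSphereTriangulation_G7_2.arises_of_edge
      (generates_G7_2.exists_edgeInsertion generates_G8_13 2 6 4 5
        (fun v => v.elim 0 ![3, 5, 1, 4, 2, 7, 6]) (by decide +kernel)) hi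
  · exact isSphereTriangulation_G7_2.arises_of_edge
      (generates_G7_2.exists_edgeInsertion generates_G8_28 3 4 6 1
        (fun v => v.elim 0 ![3, 5, 2, 1, 4, 7, 6]) (by decide +kernel)) hi

end Lists

end SphereTri

/-! ### The classification. -/

theorem mainTheorem2 :
    -- the numbers of isomorphism classes
    (mu 4 = 1 ∧ mu 5 = 1 ∧ mu 6 = 2 ∧ mu 7 = 5 ∧ mu 8 = 14) ∧
    (muGraph 4 = 1 ∧ muGraph 5 = 1 ∧ muGraph 6 = 2 ∧ muGraph 7 = 5 ∧ muGraph 8 = 14) ∧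
    -- four is the least number of vertices
    (∀ n < 4, ∀ K : AbstractSimplicialComplex (Fin n), ¬ IsSphereTriangulation K) ∧
    -- the explicit lists
    IsCompleteList ![G4] ∧
    IsCompleteList ![G5] ∧
    IsCompleteList ![G6_1, G6_2] ∧
    IsCompleteList ![G7_1, G7_2, G7_3, G7_4, G7_5] ∧
    IsCompleteList ![G8_3, G8_2, G8_1, G8_14, G8_10, G8_16, G8_4, G8_27, G8_9, G8_39,
      G8_11, G8_6, G8_13, G8_28] ∧
    -- the degree sequences
    (degrees G4 = {3, 3, 3, 3} ∧
      degrees G5 = {3, 3, 4, 4, 4} ∧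
      degrees G6_1 = {4, 4, 4, 4, 4, 4} ∧
      degrees G6_2 = {3, 3, 4, 4, 5, 5} ∧
      degrees G7_1 = {3, 4, 4, 4, 5, 5, 5} ∧
      degrees G7_2 = {4, 4, 4, 4, 4, 5, 5} ∧
      degrees G7_3 = {3, 3, 4, 4, 5, 5, 6} ∧
      degrees G7_4 = {3, 3, 4, 4, 4, 6, 6} ∧
      degrees G7_5 = {3, 3, 3, 5, 5, 5, 6} ∧
      degrees G8_3 = {3, 3, 3, 3, 6, 6, 6, 6} ∧
      degrees G8_2 = {3, 3, 3, 4, 5, 6, 6, 6} ∧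
      degrees G8_1 = {3, 3, 3, 4, 5, 5, 6, 7} ∧
      degrees G8_14 = {3, 3, 4, 4, 4, 4, 7, 7} ∧
      degrees G8_10 = {3, 3, 4, 4, 4, 5, 6, 7} ∧
      degrees G8_16 = {3, 3, 4, 4, 5, 5, 5, 7} ∧
      degrees G8_4 = {3, 3, 4, 4, 5, 5, 6, 6} ∧
      degrees G8_27 = {3, 3, 4, 4, 5, 5, 6, 6} ∧
      degrees G8_9 = {3, 3, 4, 5, 5, 5, 5, 6} ∧
      degrees G8_39 = {3, 3, 5, 5, 5, 5, 5, 5} ∧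
      degrees G8_11 = {3, 4, 4, 4, 4, 5, 6, 6} ∧
      degrees G8_6 = {3, 4, 4, 4, 5, 5, 5, 6} ∧
      degrees G8_13 = {4, 4, 4, 4, 4, 4, 6, 6} ∧
      degrees G8_28 = {4, 4, 4, 4, 5, 5, 5, 5}) ∧
    -- every triangulation on the lists after the first arises by inserting one vertex
    (∀ n, 4 ≤ n → n < 8 → ∀ K' : AbstractSimplicialComplex (Fin (n + 1)),
      IsSphereTriangulation K' →
        ∃ (K : AbstractSimplicialComplex (Fin n)) (L : AbstractSimplicialComplex (Option (Fin n))),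
          IsSphereTriangulation K ∧ Iso L K' ∧
            (FaceInsertion K L ∨ EdgeInsertion K L ∨ PentagonInsertion K L)) := by
  refine ⟨⟨isCompleteList_4.mu_eq, isCompleteList_5.mu_eq, isCompleteList_6.mu_eq,
      isCompleteList_7.mu_eq, isCompleteList_8.mu_eq⟩,
    ⟨isCompleteList_4.muGraph_eq, isCompleteList_5.muGraph_eq, isCompleteList_6.muGraph_eq,
      isCompleteList_7.muGraph_eq, isCompleteList_8.muGraph_eq⟩, fun n hn K hK => ?_,
    isCompleteList_4, isCompleteList_5, isCompleteList_6, isCompleteList_7, isCompleteList_8,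
    ⟨?_, ?_, ?_, ?_, ?_, ?_, ?_, ?_, ?_, ?_, ?_, ?_, ?_, ?_, ?_, ?_, ?_, ?_, ?_, ?_, ?_, ?_, ?_⟩,
    fun n h4 h8 => ?_⟩
  · have := hK.four_le
    rw [Fintype.card_fin] at this
    omega
  · exact generates_G4.degrees_eq (by decide +kernel)
  · exact generates_G5.degrees_eq (by decide +kernel)
  · exact generates_G6_1.degrees_eq (by decide +kernel)
  · exact generates_G6_2.degrees_eq (by decide +kernel)
  · exact generates_G7_1.degrees_eq (by decide +kernel)
  · exact generates_G7_2.degrees_eq (by decide +kernel)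
  · exact generates_G7_3.degrees_eq (by decide +kernel)
  · exact generates_G7_4.degrees_eq (by decide +kernel)
  · exact generates_G7_5.degrees_eq (by decide +kernel)
  · exact generates_G8_3.degrees_eq (by decide +kernel)
  · exact generates_G8_2.degrees_eq (by decide +kernel)
  · exact generates_G8_1.degrees_eq (by decide +kernel)
  · exact generates_G8_14.degrees_eq (by decide +kernel)
  · exact generates_G8_10.degrees_eq (by decide +kernel)
  · exact generates_G8_16.degrees_eq (by decide +kernel)
  · exact generates_G8_4.degrees_eq (by decide +kernel)
  · exact generates_G8_27.degrees_eq (by decide +kernel)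
  · exact generates_G8_9.degrees_eq (by decide +kernel)
  · exact generates_G8_39.degrees_eq (by decide +kernel)
  · exact generates_G8_11.degrees_eq (by decide +kernel)
  · exact generates_G8_6.degrees_eq (by decide +kernel)
  · exact generates_G8_13.degrees_eq (by decide +kernel)
  · exact generates_G8_28.degrees_eq (by decide +kernel)
  · interval_cases n
    exacts [arisesByInsertion_4, arisesByInsertion_5, arisesByInsertion_6, arisesByInsertion_7]
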